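/- Let $K(x)=\frac{1}{2\pi}\frac{x^\perp}{|x|^2}$ for $x\in\mathbb R^2\setminus\{0\}$, where $(x_1,x_2)^\perp=(-x_2,x_1)$. Given $\omega_0\in L^1\cap L^\infty(\mathbb R^2)$ and $z_0\in\mathbb R^2$, a global Eulerian solution of the vortex-wave system with initial condition $(\omega_0,z_0)$ is a pair $(\omega,z)$ with $\omega\in L^\infty(\mathbb R^+,L^1\cap L^\infty(\mathbb R^2))$ and $z\in C(\mathbb R^+,\mathbb R^2)$ such that, with $v(t,\cdot)=K*\omega(t)$ and $H(t,x)=K(x-z(t))$, $$-\int_{\mathbb R^2}\omega_0(x)\,\psi(0,x)\,dx=\int_{\mathbb R^+}\int_{\mathbb R^2}\omega\,\bigl(\partial_t\psi+(v+H)\cdot\nabla\psi\bigr)\,dx\,dt$$ for every smooth $\psi$ with compact support in $[0,\infty)\times\mathbb R^2$ (not necessarily vanishing at $t=0$), and $$z(t)=z_0+\int_0^t v(s,z(s))\,ds\qquad\text{for all } t\ge 0.$$ Set $\|\omega_0\|=\|\omega_0\|_{L^1(\mathbb R^2)}+\|\omega_0\|_{L^\infty(\mathbb R^2)}$. Proposition.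 There are a constant $C=C(\|\omega_0\|)>0$ depending only on $\|\omega_0\|$ and, for every $R_0>0$, a continuous positive function $t\mapsto R(t)$ on $[0,\infty)$ depending only on $t$, $R_0$ and $\|\omega_0\|$, with $R(0)=R_0$ and, if $R_0\le 1$, given explicitly by $$R(t)=\exp\bigl(1-(1-\ln R_0)\,e^{2Ct}\bigr),$$ such that the following holds. Let $(\omega,z)$ be a global Eulerian solution with initial condition $(\omega_0,z_0)$ such that, for some $\alpha\in\mathbb R$ and $R_0>0$, $\omega_0=\alpha$ almost everywhere on the open ball $B(z_0,R_0)$. Then $\omega$ has a representative, with respect to equality at almost every time, that is continuous from $[0,\infty)$ to $L^2_{\mathrm{loc}}(\mathbb R^2)$ with its weak topology, and, $\omega(t)$ denoting the value at time $t$ of any such representative, $$\omega(t)=\alpha\quad\text{almost everywhere on } B(z(t),R(t)),\qquad\text{for every } t\ge 0.$$ -/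

import Mathlib

open MeasureTheory Set
open scoped NNReal ENNReal

noncomputable section

namespace VortexWave

/-- The plane `ℝ²` with its Euclidean norm and Lebesgue measure. -/
abbrev Plane : Type := EuclideanSpace ℝ (Fin 2)

/-- The rotation `(x₁, x₂)^⊥ = (-x₂, x₁)`. -/
def perp (x : Plane) : Plane := !₂[-x 1, x 0]

/-- The Biot-Savart kernel `K(x) = x^⊥ / (2π|x|²)` (its value at `x = 0` is irrelevant). -/
def biotSavart (x : Plane) : Plane := (2 * Real.pi * ‖x‖ ^ 2)⁻¹ • perp x

/-- The velocity `K ∗ f` generated by a vorticity `f`. -/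
def velocity (f : Plane → ℝ) (x : Plane) : Plane := ∫ y, f y • biotSavart (x - y)

/-- `ω ∈ L^∞(ℝ⁺, L¹ ∩ L^∞(ℝ²))`: joint measurability on `ℝ⁺ × ℝ²`, and for almost every time both
norms are at most a constant that does not depend on time. -/
def MemLinftyL1Linfty (ω : ℝ → Plane → ℝ) : Prop :=
  AEStronglyMeasurable (fun p : ℝ × Plane => ω p.1 p.2)
      ((volume.restrict (Ici (0 : ℝ))).prod volume) ∧
    ∃ M : ℝ≥0, ∀ᵐ t ∂(volume.restrict (Ici (0 : ℝ))),
      eLpNorm (ω t) 1 volume ≤ M ∧ eLpNorm (ω t) ∞ volume ≤ M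

/-- `(ω, z)` is a global Eulerian solution of the vortex-wave system with one point vortex and
initial condition `(ω₀, z₀)`. Only times `t ≥ 0` matter. The test functions on `ℝ⁺ × ℝ²` are the
restrictions of smooth compactly supported functions on `ℝ × ℝ²`; in particular they need not
vanish at `t = 0`. -/
structure IsEulerianSolution (ω₀ : Plane → ℝ) (z₀ : Plane) (ω : ℝ → Plane → ℝ) (z : ℝ → Plane) :
    Prop where
  initial_memL1 : MemLp ω₀ 1 volume
  initial_memLinfty : MemLp ω₀ ∞ volume
  vorticity_mem : MemLinftyL1Linfty ω
  trajectory_continuous : ContinuousOn z (Ici 0)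
  transport : ∀ ψ : ℝ × Plane → ℝ, ContDiff ℝ ((⊤ : ℕ∞) : WithTop ℕ∞) ψ → HasCompactSupport ψ →
    -∫ x, ω₀ x * ψ (0, x) =
      ∫ t in Ici (0 : ℝ), ∫ x, ω t x *
        (fderiv ℝ ψ (t, x) (1, 0) +
          fderiv ℝ ψ (t, x) (0, velocity (ω t) x + biotSavart (x - z t)))
  trajectory : ∀ t : ℝ, 0 ≤ t → z t = z₀ + ∫ s in (0 : ℝ)..t, velocity (ω s) (z s)

/-- `‖f‖ = ‖f‖_{L¹} + ‖f‖_{L^∞}`. -/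
def vorticityNorm (f : Plane → ℝ) : ℝ :=
  (eLpNorm f 1 volume).toReal + (eLpNorm f ∞ volume).toReal

/-- `f ∈ C_w(ℝ⁺, L²_loc(ℝ²))`: the map `t ↦ f t` is continuous for the weak topology of `L²_loc`,
whose dual consists of the compactly supported `L²` functions. -/
def WeaklyContinuousL2loc (f : ℝ → Plane → ℝ) : Prop :=
  (∀ t : ℝ, 0 ≤ t → ∀ S : Set Plane, IsCompact S → MemLp (f t) 2 (volume.restrict S)) ∧
    ∀ φ : Plane → ℝ, MemLp φ 2 volume → HasCompactSupport φ →
      ContinuousOn (fun t => ∫ x, f t x * φ x) (Ici 0)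

/-- `ω'` is a representative of `ω` (equal to it at almost every time, almost everywhere in space)
that is weakly continuous in time. The elements of `L^∞(ℝ⁺, L¹ ∩ L^∞(ℝ²))` are classes modulo
almost everywhere equality, and `ω(t)` at a given time means `ω'(t)`. -/
def IsContinuousRepresentative (ω ω' : ℝ → Plane → ℝ) : Prop :=
  (∀ᵐ t ∂(volume.restrict (Ici (0 : ℝ))), ω' t =ᵐ[volume] ω t) ∧ WeaklyContinuousL2loc ω'

end VortexWave

end

noncomputable section

namespace VortexWave

/-! ### The regularised Biot-Savart kernel -/

lemma norm_perp (x : Plane) : ‖perp x‖ = ‖x‖ := by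
  simp [perp, EuclideanSpace.norm_eq, Fin.sum_univ_two, add_comm]

lemma perp_sub (x y : Plane) : perp (x - y) = perp x - perp y := by
  ext i; fin_cases i <;> simp [perp]; ring

lemma inner_perp_self (x : Plane) : inner ℝ x (perp x) = 0 := by
  simp [perp, PiLp.inner_apply, Fin.sum_univ_two]; ring

@[fun_prop]
lemma continuous_perp : Continuous perp := by
  unfold perp
  fun_prop

/-- The Biot-Savart kernel truncated at distance `ε` from the origin. -/
def regKernel (ε : ℝ) (x : Plane) : Plane := (2 * Real.pi * (max ‖x‖ ε) ^ 2)⁻¹ • perp x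

lemma regKernel_zero : regKernel 0 = biotSavart := by
  ext1 x; simp [regKernel, biotSavart]

@[fun_prop]
lemma measurable_regKernel (ε : ℝ) : Measurable (regKernel ε) := by
  unfold regKernel
  exact (by fun_prop : Measurable fun x : Plane => (2 * Real.pi * (max ‖x‖ ε) ^ 2)⁻¹).smul
    continuous_perp.measurable

lemma inner_regKernel_self (ε : ℝ) (x : Plane) : inner ℝ x (regKernel ε x) = 0 := by
  simp [regKernel, inner_smul_right, inner_perp_self]

lemma regKernel_eq_of_le {ε ε' : ℝ} {x : Plane} (h : ε ≤ ‖x‖) (h' : ε' ≤ ‖x‖) :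
    regKernel ε x = regKernel ε' x := by
  simp [regKernel, max_eq_left h, max_eq_left h']

lemma norm_regKernel (ε : ℝ) (x : Plane) :
    ‖regKernel ε x‖ = (2 * Real.pi)⁻¹ * (‖x‖ / (max ‖x‖ ε) ^ 2) := by
  rw [regKernel, norm_smul, norm_perp, Real.norm_of_nonneg (by positivity)]
  field_simp

lemma norm_regKernel_le (ε : ℝ) (x : Plane) :
    ‖regKernel ε x‖ ≤ (2 * Real.pi)⁻¹ * ‖x‖⁻¹ := by
  rw [norm_regKernel]
  refine mul_le_mul_of_nonneg_left ?_ (by positivity)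
  rcases eq_or_lt_of_le (norm_nonneg x) with h | h
  · simp [← h]
  · rw [div_le_iff₀ (by positivity), inv_mul_eq_div, le_div_iff₀ h]
    nlinarith [le_max_left ‖x‖ ε]

lemma norm_regKernel_le_inv {ε : ℝ} (hε : 0 < ε) (x : Plane) :
    ‖regKernel ε x‖ ≤ (2 * Real.pi)⁻¹ * ε⁻¹ := by
  rw [norm_regKernel]
  refine mul_le_mul_of_nonneg_left ?_ (by positivity)
  have := le_max_right ‖x‖ ε
  have h2 := le_max_left ‖x‖ ε
  rw [div_le_iff₀ (by positivity), inv_mul_eq_div, le_div_iff₀ hε]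
  nlinarith [norm_nonneg x]

lemma abs_max_norm_sub_le (ε : ℝ) (x y : Plane) :
    |max ‖x‖ ε - max ‖y‖ ε| ≤ ‖x - y‖ :=
  (abs_max_sub_max_le_abs _ _ _).trans (abs_norm_sub_norm_le x y)

lemma norm_regKernel_sub_le {ε : ℝ} (hε : 0 < ε) (x y : Plane) :
    ‖regKernel ε x - regKernel ε y‖ ≤
      3 * (2 * Real.pi)⁻¹ * (‖x - y‖ / (max ‖x‖ ε * max ‖y‖ ε)) := by
  set a := max ‖x‖ ε with ha
  set b := max ‖y‖ ε with hb
  have ha0 : 0 < a := lt_max_of_lt_right hε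
  have hb0 : 0 < b := lt_max_of_lt_right hε
  have hxa : ‖x‖ ≤ a := le_max_left _ _
  have hyb : ‖y‖ ≤ b := le_max_left _ _
  have hab : |a - b| ≤ ‖x - y‖ := abs_max_norm_sub_le ε x y
  have key : regKernel ε x - regKernel ε y = (2 * Real.pi)⁻¹ • ((a * b)⁻¹ • perp (x - y)
      + (((b - a) / (a ^ 2 * b)) • perp x + ((b - a) / (a * b ^ 2)) • perp y)) := by
    rw [perp_sub, regKernel, regKernel, ← ha, ← hb]
    ext i
    simp only [PiLp.sub_apply, PiLp.smul_apply, smul_eq_mul, PiLp.add_apply]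
    field_simp
    ring
  rw [key, norm_smul, Real.norm_of_nonneg (by positivity), mul_comm (3 : ℝ), mul_assoc]
  refine mul_le_mul_of_nonneg_left ?_ (by positivity)
  have h1 : ‖(a * b)⁻¹ • perp (x - y)‖ = ‖x - y‖ / (a * b) := by
    rw [norm_smul, norm_perp, Real.norm_of_nonneg (by positivity), inv_mul_eq_div]
  have h2 : ‖((b - a) / (a ^ 2 * b)) • perp x‖ ≤ ‖x - y‖ / (a * b) := by
    rw [norm_smul, norm_perp, norm_div, Real.norm_eq_abs, abs_sub_comm,
      Real.norm_of_nonneg (by positivity), div_mul_eq_mul_div,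
      div_le_div_iff₀ (by positivity) (by positivity)]
    calc |a - b| * ‖x‖ * (a * b) ≤ ‖x - y‖ * a * (a * b) := by gcongr
      _ = _ := by ring
  have h3 : ‖((b - a) / (a * b ^ 2)) • perp y‖ ≤ ‖x - y‖ / (a * b) := by
    rw [norm_smul, norm_perp, norm_div, Real.norm_eq_abs, abs_sub_comm,
      Real.norm_of_nonneg (by positivity), div_mul_eq_mul_div,
      div_le_div_iff₀ (by positivity) (by positivity)]
    calc |a - b| * ‖y‖ * (a * b) ≤ ‖x - y‖ * b * (a * b) := by gcongr
      _ = _ := by ring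
  calc _ ≤ _ := norm_add₃_le' h1 h2 h3
    _ = _ := by ring
where
  norm_add₃_le' {u v w : Plane} {c : ℝ} (h1 : ‖u‖ = c) (h2 : ‖v‖ ≤ c) (h3 : ‖w‖ ≤ c) :
      ‖u + (v + w)‖ ≤ c + (c + c) :=
    (norm_add_le _ _).trans (add_le_add h1.le ((norm_add_le _ _).trans (add_le_add h2 h3)))

lemma lipschitzWith_regKernel {ε : ℝ} (hε : 0 < ε) :
    LipschitzWith (Real.toNNReal (3 * (2 * Real.pi)⁻¹ * (ε ^ 2)⁻¹)) (regKernel ε) := by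
  refine LipschitzWith.of_dist_le_mul fun x y => ?_
  rw [dist_eq_norm, dist_eq_norm, Real.coe_toNNReal _ (by positivity)]
  refine (norm_regKernel_sub_le hε x y).trans ?_
  rw [mul_assoc, mul_assoc, mul_assoc]
  gcongr 3 * ((2 * Real.pi)⁻¹ * ?_)
  rw [inv_mul_eq_div]
  have h1 := le_max_right ‖x‖ ε
  have h2 := le_max_right ‖y‖ ε
  gcongr
  nlinarith

lemma norm_regKernel_sub_regKernel_le {ε ε' : ℝ} (h' : ε' ≤ ε) (x : Plane) :
    ‖regKernel ε' x - regKernel ε x‖ ≤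
      (Metric.ball (0 : Plane) ε).indicator (fun x => (2 * Real.pi)⁻¹ * ‖x‖⁻¹) x := by
  by_cases hx : ε ≤ ‖x‖
  · rw [regKernel_eq_of_le hx (h'.trans hx), sub_self, norm_zero]
    exact indicator_nonneg (fun _ _ => by positivity) _
  · rw [indicator_of_mem (by simpa using hx)]
    have : regKernel ε' x - regKernel ε x =
        ((2 * Real.pi * (max ‖x‖ ε') ^ 2)⁻¹ - (2 * Real.pi * (max ‖x‖ ε) ^ 2)⁻¹) • perp x := by
      rw [sub_smul]; rfl
    refine le_trans ?_ (norm_regKernel_le ε' x)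
    rcases eq_or_lt_of_le (norm_nonneg x) with hx0 | hx0
    · rw [← norm_perp, eq_comm, norm_eq_zero] at hx0
      rw [this, hx0, smul_zero, norm_zero]
      exact norm_nonneg _
    rw [this, regKernel, norm_smul, norm_smul]
    refine mul_le_mul_of_nonneg_right ?_ (norm_nonneg _)
    have hp : 0 < max ‖x‖ ε' := lt_max_of_lt_left hx0
    rw [Real.norm_of_nonneg, Real.norm_of_nonneg (by positivity)]
    · simp only [tsub_le_iff_right, le_add_iff_nonneg_right]; positivity
    · rw [sub_nonneg]
      gcongr

lemma integral_radial (F : ℝ → ℝ) :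
    ∫ x : Plane, F ‖x‖ = 2 * Real.pi * ∫ y in Ioi (0 : ℝ), y * F y := by
  have := integral_fun_norm_addHaar (E := Plane) volume F
  rw [this]
  simp [Measure.real, ENNReal.toReal_ofReal Real.pi_pos.le]
  ring

lemma integrableOn_inv_norm (r : ℝ) :
    IntegrableOn (fun x : Plane => ‖x‖⁻¹) (Metric.ball 0 r) := by
  rw [integrableOn_fun_norm_addHaar volume (f := fun y => y⁻¹)]
  have : IntegrableOn (fun _ : ℝ => (1 : ℝ)) (Ioo 0 r) := by simp
  refine this.congr_fun (fun y hy => ?_) measurableSet_Ioo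
  have := hy.1.ne'
  simp [this]

lemma integral_inv_norm_ball {r : ℝ} (hr : 0 ≤ r) :
    ∫ x in Metric.ball (0 : Plane) r, ‖x‖⁻¹ = 2 * Real.pi * r := by
  rw [← integral_indicator measurableSet_ball]
  have : (Metric.ball (0 : Plane) r).indicator (fun x => ‖x‖⁻¹) =
      fun x => (Iio r).indicator (fun y => y⁻¹) ‖x‖ := by
    ext x; simp [indicator]
  rw [this, integral_radial]
  congr 1
  have : EqOn (fun y : ℝ => y * (Iio r).indicator (fun y => y⁻¹) y)
      ((Iio r).indicator (fun _ => (1 : ℝ))) (Ioi 0) := by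
    intro y hy
    by_cases h : y < r
    · simp [h, (mem_Ioi.1 hy).ne']
    · simp [h]
  rw [setIntegral_congr_fun measurableSet_Ioi this, setIntegral_indicator measurableSet_Iio,
    Ioi_inter_Iio]
  simp [hr]

lemma integral_inv_max_sq_ball {ε : ℝ} (hε : 0 < ε) (h1 : ε ≤ 1) :
    ∫ x in Metric.ball (0 : Plane) 1, ((max ‖x‖ ε) ^ 2)⁻¹ =
      Real.pi + 2 * Real.pi * Real.log (1 / ε) := by
  rw [← integral_indicator measurableSet_ball]
  have : (Metric.ball (0 : Plane) 1).indicator (fun x => ((max ‖x‖ ε) ^ 2)⁻¹) =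
      fun x => (Iio 1).indicator (fun y => ((max y ε) ^ 2)⁻¹) ‖x‖ := by
    ext x; simp [indicator]
  rw [this, integral_radial]
  have : (fun y : ℝ => y * (Iio 1).indicator (fun y => ((max y ε) ^ 2)⁻¹) y) =
      ((Iio 1).indicator (fun y => y * ((max y ε) ^ 2)⁻¹)) := by
    ext y
    by_cases h : y < 1 <;> simp [h]
  rw [this, setIntegral_indicator measurableSet_Iio,
    Ioi_inter_Iio, ← integral_Ioc_eq_integral_Ioo, ← intervalIntegral.integral_of_le zero_le_one]
  have hc : Continuous fun y : ℝ => y * ((max y ε) ^ 2)⁻¹ := by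
    refine continuous_id.mul (Continuous.inv₀ (by fun_prop) fun y => ?_)
    have : 0 < max y ε := lt_max_of_lt_right hε
    positivity
  rw [← intervalIntegral.integral_add_adjacent_intervals (b := ε)
    (hc.intervalIntegrable _ _) (hc.intervalIntegrable _ _)]
  have e1 : ∫ y in (0 : ℝ)..ε, y * ((max y ε) ^ 2)⁻¹ = 1 / 2 := by
    have : ∫ y in (0 : ℝ)..ε, y * ((max y ε) ^ 2)⁻¹ = ∫ y in (0 : ℝ)..ε, y * (ε ^ 2)⁻¹ := by
      refine intervalIntegral.integral_congr fun y hy => ?_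
      rw [uIcc_of_le hε.le] at hy
      simp [max_eq_right hy.2]
    rw [this, intervalIntegral.integral_mul_const, integral_id]
    field_simp
    ring
  have e2 : ∫ y in ε..1, y * ((max y ε) ^ 2)⁻¹ = Real.log (1 / ε) := by
    rw [← integral_inv_of_pos hε one_pos]
    refine intervalIntegral.integral_congr fun y hy => ?_
    rw [uIcc_of_le h1] at hy
    have : 0 < y := hε.trans_le hy.1
    simp only [max_eq_left hy.1]
    field_simp
  rw [e1, e2]
  ring

/-! ### Velocity fields generated by bounded integrable vorticities -/

/-- `f` is measurable, `|f| ≤ M` and `‖f‖_{L¹} ≤ M`. -/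
structure BddInt (M : ℝ) (f : Plane → ℝ) : Prop where
  measurable : Measurable f
  bound : ∀ x, |f x| ≤ M
  integrable : Integrable f
  integral_le : ∫ x, |f x| ≤ M

lemma BddInt.nonneg {M : ℝ} {f : Plane → ℝ} (h : BddInt M f) : 0 ≤ M :=
  (abs_nonneg _).trans (h.bound 0)

lemma BddInt.conv_bound {M : ℝ} {f : Plane → ℝ} (h : BddInt M f) {g : Plane → ℝ}
    (hg : Measurable g) (hg0 : ∀ x, 0 ≤ g x) {r a b : ℝ} (hb : 0 ≤ b)
    (hgi : IntegrableOn g (Metric.ball 0 r)) (hga : ∫ x in Metric.ball 0 r, g x ≤ a)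
    (hgb : ∀ x : Plane, r ≤ ‖x‖ → g x ≤ b) (x : Plane) :
    Integrable (fun y => |f y| * g (x - y)) ∧ ∫ y, |f y| * g (x - y) ≤ M * a + M * b := by
  have hM := h.nonneg
  set G := (Metric.ball (0 : Plane) r).indicator g
  have hG : Integrable G := (integrable_indicator_iff measurableSet_ball).2 hgi
  have hGx : Integrable fun y => G (x - y) := hG.comp_sub_left x
  have hdom : Integrable fun y => M * G (x - y) + b * |f y| :=
    (hGx.const_mul M).add (h.integrable.abs.const_mul b)
  have hle : ∀ y, |f y| * g (x - y) ≤ M * G (x - y) + b * |f y| := by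
    intro y
    by_cases hy : x - y ∈ Metric.ball (0 : Plane) r
    · simp only [G, indicator_of_mem hy]
      have := mul_le_mul_of_nonneg_right (h.bound y) (hg0 (x - y))
      have := mul_nonneg hb (abs_nonneg (f y))
      linarith
    · simp only [G, indicator_of_notMem hy]
      have := hgb (x - y) (by simpa using hy)
      have := mul_le_mul_of_nonneg_left this (abs_nonneg (f y))
      linarith
  have hm : Measurable fun y => |f y| * g (x - y) :=
    h.measurable.abs.mul (hg.comp (measurable_const.sub measurable_id))
  have hi : Integrable (fun y => |f y| * g (x - y)) :=
    hdom.mono' hm.aestronglyMeasurable (ae_of_all _ fun y => by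
      rw [Real.norm_of_nonneg (mul_nonneg (abs_nonneg _) (hg0 _))]; exact hle y)
  refine ⟨hi, (integral_mono hi hdom hle).trans ?_⟩
  rw [integral_add (hGx.const_mul M) (h.integrable.abs.const_mul b), integral_const_mul,
    integral_const_mul, integral_sub_left_eq_self G volume x,
    integral_indicator measurableSet_ball]
  have := mul_le_mul_of_nonneg_left hga hM
  have := mul_le_mul_of_nonneg_left h.integral_le hb
  linarith

/-- The velocity generated by a vorticity `f` through the truncated kernel. -/
def vel (ε : ℝ) (f : Plane → ℝ) (x : Plane) : Plane := ∫ y, f y • regKernel ε (x - y)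

lemma velocity_eq_vel (f : Plane → ℝ) : velocity f = vel 0 f := by
  ext1 x; simp [velocity, vel, regKernel_zero]

section
variable {M : ℝ} {f : Plane → ℝ}

lemma inv_two_pi_mul_two_pi (r : ℝ) : (2 * Real.pi)⁻¹ * (2 * Real.pi * r) = r := by
  field_simp

lemma inv_two_pi_le_one : (2 * Real.pi)⁻¹ ≤ 1 :=
  inv_le_one_of_one_le₀ (by linarith [Real.two_le_pi])

lemma BddInt.integral_inv_norm (h : BddInt M f) (x : Plane) :
    Integrable (fun y => |f y| * ((2 * Real.pi)⁻¹ * ‖x - y‖⁻¹)) ∧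
      ∫ y, |f y| * ((2 * Real.pi)⁻¹ * ‖x - y‖⁻¹) ≤ 2 * M := by
  have := h.conv_bound (g := fun x => (2 * Real.pi)⁻¹ * ‖x‖⁻¹) (by fun_prop)
    (fun _ => by positivity) (r := 1) (a := 1) (b := 1) zero_le_one
    ((integrableOn_inv_norm 1).const_mul _)
    (by rw [integral_const_mul, integral_inv_norm_ball zero_le_one, inv_two_pi_mul_two_pi])
    (fun y hy => mul_le_one₀ inv_two_pi_le_one (by positivity) (inv_le_one_of_one_le₀ hy)) x
  exact ⟨this.1, this.2.trans (by linarith)⟩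

lemma BddInt.integrable_smul_regKernel (h : BddInt M f) (ε : ℝ) (x : Plane) :
    Integrable fun y => f y • regKernel ε (x - y) := by
  refine (h.integral_inv_norm x).1.mono' ?_ (ae_of_all _ fun y => ?_)
  · exact (h.measurable.smul ((measurable_regKernel ε).comp
      (measurable_const.sub measurable_id))).aestronglyMeasurable
  · rw [norm_smul, Real.norm_eq_abs]
    exact mul_le_mul_of_nonneg_left (norm_regKernel_le _ _) (abs_nonneg _)

lemma BddInt.norm_vel_le (h : BddInt M f) (ε : ℝ) (x : Plane) : ‖vel ε f x‖ ≤ 2 * M := by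
  refine (norm_integral_le_of_norm_le (h.integral_inv_norm x).1 (ae_of_all _ fun y => ?_)).trans
    (h.integral_inv_norm x).2
  rw [norm_smul, Real.norm_eq_abs]
  exact mul_le_mul_of_nonneg_left (norm_regKernel_le _ _) (abs_nonneg _)

lemma BddInt.norm_vel_sub_vel_le (h : BddInt M f) {ε ε' : ℝ} (h0 : 0 ≤ ε') (h' : ε' ≤ ε)
    (x : Plane) : ‖vel ε' f x - vel ε f x‖ ≤ M * ε := by
  rw [vel, vel, ← integral_sub (h.integrable_smul_regKernel _ _) (h.integrable_smul_regKernel _ _)]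
  have hε : 0 ≤ ε := h0.trans h'
  have := h.conv_bound
    (g := (Metric.ball (0 : Plane) ε).indicator (fun x => (2 * Real.pi)⁻¹ * ‖x‖⁻¹))
    ((by fun_prop : Measurable fun x : Plane => (2 * Real.pi)⁻¹ * ‖x‖⁻¹).indicator
      measurableSet_ball)
    (fun _ => indicator_nonneg (fun _ _ => by positivity) _) (r := ε) (a := ε) (b := 0) le_rfl
    (IntegrableOn.indicator ((integrableOn_inv_norm ε).const_mul _) measurableSet_ball)
    (by rw [setIntegral_indicator measurableSet_ball, inter_self, integral_const_mul,
      integral_inv_norm_ball hε, inv_two_pi_mul_two_pi])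
    (fun y hy => by rw [indicator_of_notMem (by simpa using hy)]) x
  refine (norm_integral_le_of_norm_le this.1 (ae_of_all _ fun y => ?_)).trans
    (this.2.trans (by simp))
  rw [← smul_sub, norm_smul, Real.norm_eq_abs]
  exact mul_le_mul_of_nonneg_left (norm_regKernel_sub_regKernel_le h' _) (abs_nonneg _)

lemma BddInt.integral_inv_max_sq (h : BddInt M f) {ε : ℝ} (hε : 0 < ε) (h1 : ε ≤ 1) (x : Plane) :
    Integrable (fun y => |f y| * ((max ‖x - y‖ ε) ^ 2)⁻¹) ∧
      ∫ y, |f y| * ((max ‖x - y‖ ε) ^ 2)⁻¹ ≤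
        M * (Real.pi + 2 * Real.pi * Real.log (1 / ε)) + M * 1 := by
  refine h.conv_bound (g := fun x => ((max ‖x‖ ε) ^ 2)⁻¹) (by fun_prop)
    (fun _ => by positivity) (r := 1) zero_le_one ?_
    (integral_inv_max_sq_ball hε h1).le
    (fun y hy => inv_le_one_of_one_le₀ (one_le_pow₀ (hy.trans (le_max_left _ _)))) x
  have : ContinuousOn (fun x : Plane => ((max ‖x‖ ε) ^ 2)⁻¹) (Metric.closedBall 0 1) := by
    refine (Continuous.inv₀ (by fun_prop) fun y => ?_).continuousOn
    have : 0 < max ‖y‖ ε := lt_max_of_lt_right hε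
    positivity
  exact (this.integrableOn_compact (isCompact_closedBall 0 1)).mono_set Metric.ball_subset_closedBall

lemma BddInt.norm_vel_sub_le (h : BddInt M f) {ε : ℝ} (hε : 0 < ε) (h1 : ε ≤ 1) (x y : Plane) :
    ‖vel ε f x - vel ε f y‖ ≤ 3 * M * (1 + Real.log (1 / ε)) * ‖x - y‖ := by
  have hM := h.nonneg
  rw [vel, vel, ← integral_sub (h.integrable_smul_regKernel _ _) (h.integrable_smul_regKernel _ _)]
  have ix := h.integral_inv_max_sq hε h1 x
  have iy := h.integral_inv_max_sq hε h1 y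
  set D := 3 * (2 * Real.pi)⁻¹ * ‖x - y‖ * (1 / 2) with hD
  have hbd : ∀ w, ‖f w • regKernel ε (x - w) - f w • regKernel ε (y - w)‖ ≤
      D * (|f w| * ((max ‖x - w‖ ε) ^ 2)⁻¹ + |f w| * ((max ‖y - w‖ ε) ^ 2)⁻¹) := by
    intro w
    rw [← smul_sub, norm_smul, Real.norm_eq_abs, ← mul_add, mul_left_comm]
    refine mul_le_mul_of_nonneg_left ?_ (abs_nonneg _)
    refine (norm_regKernel_sub_le hε _ _).trans ?_
    rw [sub_sub_sub_cancel_right, hD]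
    set a := max ‖x - w‖ ε
    set b := max ‖y - w‖ ε
    have ha : 0 < a := lt_max_of_lt_right hε
    have hb : 0 < b := lt_max_of_lt_right hε
    have : 1 / (a * b) ≤ 1 / 2 * ((a ^ 2)⁻¹ + (b ^ 2)⁻¹) := by
      have := sq_nonneg (a⁻¹ - b⁻¹)
      rw [one_div, mul_inv, ← inv_pow, ← inv_pow]
      nlinarith
    calc 3 * (2 * Real.pi)⁻¹ * (‖x - y‖ / (a * b)) =
        3 * (2 * Real.pi)⁻¹ * ‖x - y‖ * (1 / (a * b)) := by ring
      _ ≤ 3 * (2 * Real.pi)⁻¹ * ‖x - y‖ * (1 / 2 * ((a ^ 2)⁻¹ + (b ^ 2)⁻¹)) := by gcongr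
      _ = _ := by ring
  refine (norm_integral_le_of_norm_le ((ix.1.add iy.1).const_mul D)
    (ae_of_all _ fun w => hbd w)).trans ?_
  rw [integral_const_mul, integral_add' ix.1 iy.1]
  have hL : 0 ≤ Real.log (1 / ε) := Real.log_nonneg (by rw [le_div_iff₀ hε]; linarith)
  have hD0 : 0 ≤ D := by positivity
  calc D * _ ≤ D * (2 * (M * (Real.pi + 2 * Real.pi * Real.log (1 / ε)) + M * 1)) := by
        refine mul_le_mul_of_nonneg_left ?_ hD0
        linarith [ix.2, iy.2]
    _ = ‖x - y‖ * M * (3 / 2 + 3 * Real.log (1 / ε) + 3 / 2 * Real.pi⁻¹) := by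
        rw [hD]; field_simp
    _ ≤ ‖x - y‖ * M * (3 / 2 + 3 * Real.log (1 / ε) + 3 / 2 * 1) := by
        gcongr
        exact inv_le_one_of_one_le₀ (by linarith [Real.two_le_pi])
    _ = _ := by ring

/-- The log-Lipschitz modulus `r ↦ r max(1, 1 - log r)`. -/
def logMod (r : ℝ) : ℝ := r * max 1 (1 - Real.log r)

lemma BddInt.norm_vel_sub_le_logMod (h : BddInt M f) {ε : ℝ} (hε : 0 ≤ ε) (h1 : ε ≤ 1)
    (x y : Plane) : ‖vel ε f x - vel ε f y‖ ≤ 5 * M * logMod ‖x - y‖ := by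
  have hM := h.nonneg
  set r := ‖x - y‖ with hr
  rcases eq_or_lt_of_le (norm_nonneg (x - y)) with h0 | h0
  · rw [← hr] at h0
    have : x = y := by rw [← sub_eq_zero, ← norm_eq_zero, ← hr, ← h0]
    simp [this, ← h0, logMod]
  rw [← hr] at h0
  have hμ1 : r ≤ logMod r := by
    rw [logMod]; nlinarith [le_max_left 1 (1 - Real.log r)]
  have hμ2 : r * (1 + Real.log (1 / r)) ≤ logMod r := by
    rw [logMod, one_div, Real.log_inv]
    exact mul_le_mul_of_nonneg_left (le_max_right _ _) h0.le
  rcases le_or_gt 1 r with h2 | h2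
  · have := norm_sub_le (vel ε f x) (vel ε f y)
    have := h.norm_vel_le ε x
    have := h.norm_vel_le ε y
    nlinarith
  rcases le_or_gt r ε with h3 | h3
  · have hε' : 0 < ε := h0.trans_le h3
    refine (h.norm_vel_sub_le hε' h1 x y).trans ?_
    have hL : Real.log (1 / ε) ≤ Real.log (1 / r) :=
      Real.log_le_log (by positivity) (by gcongr)
    calc 3 * M * (1 + Real.log (1 / ε)) * ‖x - y‖ ≤ 3 * M * (1 + Real.log (1 / r)) * r := by
          gcongr
      _ = 3 * M * (r * (1 + Real.log (1 / r))) := by ring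
      _ ≤ 3 * M * logMod r := by gcongr
      _ ≤ _ := by nlinarith
  · have e1 := h.norm_vel_sub_vel_le hε h3.le x
    have e2 := h.norm_vel_sub_vel_le hε h3.le y
    have e3 := h.norm_vel_sub_le h0 h2.le x y
    have : vel ε f x - vel ε f y = (vel ε f x - vel r f x) + (vel r f x - vel r f y)
        - (vel ε f y - vel r f y) := by abel
    rw [this]
    have t1 := norm_sub_le ((vel ε f x - vel r f x) + (vel r f x - vel r f y))
      (vel ε f y - vel r f y)
    have t2 := norm_add_le (vel ε f x - vel r f x) (vel r f x - vel r f y)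
    rw [← hr] at e3
    have : 3 * M * (1 + Real.log (1 / r)) * r ≤ 3 * M * logMod r := by
      calc _ = 3 * M * (r * (1 + Real.log (1 / r))) := by ring
        _ ≤ 3 * M * logMod r := by gcongr
    nlinarith
end

end VortexWave
end

noncomputable section

namespace VortexWave

/-! ### Flows of bounded Lipschitz fields -/

section Flow

variable {E : Type*} [NormedAddCommGroup E] [NormedSpace ℝ E]
  {F : ℝ → E → E} {K B : ℝ≥0}

/-- `Y` solves `Y' = F(σ, Y)` on a neighbourhood of `[a, b]`. -/
def IsTrajectory (F : ℝ → E → E) (a b : ℝ) (Y : ℝ → E) : Prop :=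
  ∀ σ ∈ Icc a b, HasDerivAt Y (F σ (Y σ)) σ

lemma IsTrajectory.mono {a b a' b' : ℝ} {Y : ℝ → E} (h : IsTrajectory F a b Y) (ha : a ≤ a')
    (hb : b' ≤ b) : IsTrajectory F a' b' Y :=
  fun σ hσ => h σ ⟨ha.trans hσ.1, hσ.2.trans hb⟩

lemma IsTrajectory.continuousOn {a b : ℝ} {Y : ℝ → E} (h : IsTrajectory F a b Y) :
    ContinuousOn Y (Icc a b) :=
  fun σ hσ => (h σ hσ).continuousAt.continuousWithinAt

lemma IsTrajectory.norm_sub_le {a b : ℝ} {Y : ℝ → E} (h : IsTrajectory F a b Y)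
    (hB : ∀ t x, ‖F t x‖ ≤ B) {σ τ : ℝ} (hσ : σ ∈ Icc a b) (hτ : τ ∈ Icc a b) :
    ‖Y τ - Y σ‖ ≤ B * |τ - σ| := by
  have := (convex_Icc a b).norm_image_sub_le_of_norm_hasDerivWithin_le
    (fun x hx => (h x hx).hasDerivWithinAt) (fun x _ => hB x (Y x)) hσ hτ
  simpa using this

lemma IsTrajectory.dist_le {a b : ℝ} {Y Z : ℝ → E} (hY : IsTrajectory F a b Y)
    (hZ : IsTrajectory F a b Z) (hK : ∀ t, LipschitzWith K (F t)) (hab : a ≤ b) :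
    dist (Y b) (Z b) ≤ dist (Y a) (Z a) * Real.exp (K * (b - a)) :=
  dist_le_of_trajectories_ODE hK hY.continuousOn
    (fun t ht => (hY t (Ico_subset_Icc_self ht)).hasDerivWithinAt) hZ.continuousOn
    (fun t ht => (hZ t (Ico_subset_Icc_self ht)).hasDerivWithinAt) le_rfl b ⟨hab, le_rfl⟩

lemma exists_isTrajectory [CompleteSpace E] (hK : ∀ t, LipschitzWith K (F t))
    (hc : ∀ x, Continuous fun t => F t x) (hB : ∀ t x, ‖F t x‖ ≤ B) {a b σ : ℝ}
    (hσ : σ ∈ Icc a b) (y : E) : ∃ Y : ℝ → E, Y σ = y ∧ IsTrajectory F a b Y := by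
  have hσ' : σ ∈ Icc (a - 1) (b + 1) := ⟨by linarith [hσ.1], by linarith [hσ.2]⟩
  have hp : IsPicardLindelof F (⟨σ, hσ'⟩ : Icc (a - 1) (b + 1)) y
      (B * Real.toNNReal (max (b + 1 - σ) (σ - (a - 1)))) 0 B K := by
    refine ⟨fun t _ => (hK t).lipschitzOnWith, fun x _ => (hc x).continuousOn,
      fun t _ x _ => hB t x, ?_⟩
    rw [NNReal.coe_mul, Real.coe_toNNReal _ (le_max_of_le_left (by linarith [hσ.2]))]
    simp
  obtain ⟨Y, h0, h1⟩ := hp.exists_eq_forall_mem_Icc_hasDerivWithinAt₀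
  refine ⟨Y, h0, fun τ hτ => (h1 τ ⟨by linarith [hτ.1], by linarith [hτ.2]⟩).hasDerivAt
    (Icc_mem_nhds (by linarith [hτ.1]) (by linarith [hτ.2]))⟩

/-- The terminal value at time `t` of trajectories started in `[s, t]` is a Lipschitz function of
the initial time and position. -/
lemma exists_terminalFlow [CompleteSpace E] (hK : ∀ t, LipschitzWith K (F t))
    (hc : ∀ x, Continuous fun t => F t x) (hB : ∀ t x, ‖F t x‖ ≤ B) {s t : ℝ} :
    ∃ Φ : ℝ → E → E, (∀ y, Φ t y = y) ∧
      (∀ σ ∈ Icc s t, ∀ σ' ∈ Icc s t, ∀ y y', dist (Φ σ y) (Φ σ' y') ≤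
        Real.exp (K * (t - s)) * (dist y y' + B * |σ - σ'|)) ∧
      ∀ σ ∈ Icc s t, ∀ y, ∃ Y : ℝ → E, Y σ = y ∧ IsTrajectory F s t Y ∧
        ∀ τ ∈ Icc s t, Φ τ (Y τ) = Y t := by
  classical
  choose Y hY0 hY using fun (σ : Icc s t) (y : E) => exists_isTrajectory hK hc hB σ.2 y
  let Φ : ℝ → E → E := fun σ y => if h : σ ∈ Icc s t then Y ⟨σ, h⟩ y t else y
  have hΦ : ∀ σ (h : σ ∈ Icc s t) y, Φ σ y = Y ⟨σ, h⟩ y t := fun σ h y => by simp only [Φ, dif_pos h]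
  have key : ∀ Z : ℝ → E, IsTrajectory F s t Z → ∀ σ ∈ Icc s t, ∀ y,
      dist (Z t) (Φ σ y) ≤ Real.exp (K * (t - s)) * dist (Z σ) y := by
    intro Z hZ σ hσ y
    rw [hΦ σ hσ y]
    have := (hZ.mono hσ.1 le_rfl).dist_le ((hY ⟨σ, hσ⟩ y).mono hσ.1 le_rfl) hK hσ.2
    rw [hY0, mul_comm] at this
    refine this.trans ?_
    have := hσ.1
    gcongr
  have huniq : ∀ Z : ℝ → E, IsTrajectory F s t Z → ∀ τ ∈ Icc s t, Φ τ (Z τ) = Z t := by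
    intro Z hZ τ hτ
    have := key Z hZ τ hτ (Z τ)
    rw [dist_self, mul_zero] at this
    exact (dist_le_zero.1 this).symm
  have hlip : ∀ σ ∈ Icc s t, ∀ σ' ∈ Icc s t, ∀ y y', dist (Φ σ y) (Φ σ' y') ≤
        Real.exp (K * (t - s)) * (dist y y' + B * |σ - σ'|) := by
    intro σ hσ σ' hσ' y y'
    have h1 := key _ (hY ⟨σ, hσ⟩ y) σ' hσ' y'
    rw [← hΦ σ hσ y] at h1
    refine h1.trans ?_
    gcongr
    have h2 := (hY ⟨σ, hσ⟩ y).norm_sub_le hB hσ hσ'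
    rw [hY0, ← dist_eq_norm, abs_sub_comm] at h2
    linarith [dist_triangle (Y ⟨σ, hσ⟩ y σ') y y']
  refine ⟨Φ, fun y => ?_, hlip, fun σ hσ y => ⟨Y ⟨σ, hσ⟩ y, hY0 _ _, hY _ _, huniq _ (hY _ _)⟩⟩
  by_cases h : t ∈ Icc s t
  · rw [hΦ t h y, hY0]
  · simp only [Φ, dif_neg h]

end Flow

/-! ### Barriers for log-Lipschitz fields vanishing at the origin -/

section Barrier

variable {F : ℝ → Plane → Plane} {A C : ℝ} {s t : ℝ} {Y : ℝ → Plane}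

lemma hasDerivAt_barrier (l k c d x : ℝ) :
    HasDerivAt (fun σ => Real.exp (l + k * (1 - Real.exp (c * σ + d))) ^ 2)
      (-(2 * c * (k * Real.exp (c * x + d))) * Real.exp (l + k * (1 - Real.exp (c * x + d))) ^ 2)
      x := by
  have h1 : HasDerivAt (fun σ => Real.exp (c * σ + d)) (Real.exp (c * x + d) * c) x := by
    have := (((hasDerivAt_id x).const_mul c).add_const d).exp
    simpa using this
  have h2 := (((h1.const_sub 1).const_mul k).const_add l).exp.pow 2
  refine h2.congr_deriv ?_
  push_cast
  ring

lemma logMod_barrier {l k e : ℝ} (he : 1 ≤ e) (hk : 1 ≤ k) (hkl : 1 - l ≤ k) :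
    logMod (Real.exp (l + k * (1 - e))) ≤ k * e * Real.exp (l + k * (1 - e)) := by
  rw [logMod, Real.log_exp, mul_comm]
  refine mul_le_mul_of_nonneg_right (max_le (by nlinarith) (by nlinarith)) (Real.exp_pos _).le

lemma abs_inner_trajectory (hA : ∀ σ y, |inner ℝ y (F σ y)| ≤ A * (‖y‖ * logMod ‖y‖))
    (σ : ℝ) : |2 * inner ℝ (Y σ) (F σ (Y σ))| ≤ 2 * A * (‖Y σ‖ * logMod ‖Y σ‖) := by
  rw [abs_mul, abs_two]
  linarith [hA σ (Y σ)]

lemma barrier_lower (hY : IsTrajectory F s t Y) (hst : s ≤ t) (hs : 0 ≤ s)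
    (hA : ∀ σ y, |inner ℝ y (F σ y)| ≤ A * (‖y‖ * logMod ‖y‖)) (hA0 : 0 ≤ A) (hC : A < C)
    {l k : ℝ} (hk : 1 ≤ k) (hkl : 1 - l ≤ k)
    (h : Real.exp (l + k * (1 - Real.exp (2 * C * s))) ≤ ‖Y s‖) :
    Real.exp (l + k * (1 - Real.exp (2 * C * t))) ≤ ‖Y t‖ := by
  set Q : ℝ → ℝ := fun σ => Real.exp (l + k * (1 - Real.exp (2 * C * σ + 0))) ^ 2 with hQ
  have hQd := fun x => hasDerivAt_barrier l k (2 * C) 0 x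
  have hYd : ∀ σ ∈ Icc s t, HasDerivAt (fun σ => ‖Y σ‖ ^ 2)
      (2 * inner ℝ (Y σ) (F σ (Y σ))) σ := fun σ hσ => (hY σ hσ).norm_sq
  have key := image_le_of_deriv_right_lt_deriv_boundary' (a := s) (b := t)
    (f := fun σ => -‖Y σ‖ ^ 2) (B := fun σ => -Q σ)
    (fun σ hσ => (hYd σ hσ).neg.continuousAt.continuousWithinAt)
    (fun σ hσ => (hYd σ (Ico_subset_Icc_self hσ)).neg.hasDerivWithinAt)
    (by
      simp only [hQ, add_zero]
      have := Real.exp_pos (l + k * (1 - Real.exp (2 * C * s)))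
      have := pow_le_pow_left₀ this.le h 2
      linarith)
    (fun σ _ => (hQd σ).neg.continuousAt.continuousWithinAt)
    (fun σ _ => (hQd σ).neg.hasDerivWithinAt)
    (by
      intro σ hσ heq
      set e := Real.exp (2 * C * σ + 0) with he
      set r := Real.exp (l + k * (1 - e)) with hr
      have hr0 : 0 < r := Real.exp_pos _
      have hrY : ‖Y σ‖ = r := by
        have : ‖Y σ‖ ^ 2 = r ^ 2 := by simpa [hQ, he, hr] using heq
        exact (pow_left_inj₀ (norm_nonneg _) hr0.le two_ne_zero).1 this
      have he1 : 1 ≤ e := Real.one_le_exp (by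
        have := hs.trans hσ.1
        have : 0 ≤ C := hA0.trans hC.le
        positivity)
      have hb := logMod_barrier he1 hk hkl
      rw [← hr] at hb
      have h2 := abs_inner_trajectory (Y := Y) hA σ
      rw [hrY] at h2
      have h3 := (abs_le.1 h2).1
      have hke : 0 < k * e := by positivity
      have : A * (r * logMod r) ≤ A * (k * e * r ^ 2) := by
        refine mul_le_mul_of_nonneg_left ?_ hA0
        nlinarith
      have : A * (k * e * r ^ 2) < C * (k * e * r ^ 2) := by
        gcongr
      nlinarith [mul_pos hke (pow_pos hr0 2)])
  have := key ⟨hst, le_rfl⟩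
  simp only [hQ, add_zero, neg_le_neg_iff] at this
  exact (pow_le_pow_iff_left₀ (Real.exp_pos _).le (norm_nonneg _) two_ne_zero).1 this

lemma barrier_upper (hY : IsTrajectory F s t Y) {σ₀ : ℝ} (hσ₀ : σ₀ ∈ Icc s t)
    (hA : ∀ σ y, |inner ℝ y (F σ y)| ≤ A * (‖y‖ * logMod ‖y‖)) (hA0 : 0 ≤ A) (hC : A < C)
    {l k : ℝ} (hk : 1 ≤ k) (hkl : 1 - l ≤ k)
    (h : ‖Y σ₀‖ ≤ Real.exp (l + k * (1 - Real.exp (2 * C * (t - σ₀))))) :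
    ‖Y t‖ ≤ Real.exp l := by
  have hrw : ∀ σ, 2 * C * (t - σ) = -(2 * C) * σ + 2 * C * t := fun σ => by ring
  set Q : ℝ → ℝ := fun σ => Real.exp (l + k * (1 - Real.exp (-(2 * C) * σ + 2 * C * t))) ^ 2 with hQ
  have hQd := fun x => hasDerivAt_barrier l k (-(2 * C)) (2 * C * t) x
  have hYd : ∀ σ ∈ Icc σ₀ t, HasDerivAt (fun σ => ‖Y σ‖ ^ 2)
      (2 * inner ℝ (Y σ) (F σ (Y σ))) σ := fun σ hσ => (hY σ ⟨hσ₀.1.trans hσ.1, hσ.2⟩).norm_sq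
  have key := image_le_of_deriv_right_lt_deriv_boundary' (a := σ₀) (b := t)
    (f := fun σ => ‖Y σ‖ ^ 2) (B := Q)
    (fun σ hσ => (hYd σ hσ).continuousAt.continuousWithinAt)
    (fun σ hσ => (hYd σ (Ico_subset_Icc_self hσ)).hasDerivWithinAt)
    (by
      simp only [hQ]
      rw [← hrw]
      exact pow_le_pow_left₀ (norm_nonneg _) h 2)
    (fun σ _ => (hQd σ).continuousAt.continuousWithinAt)
    (fun σ _ => (hQd σ).hasDerivWithinAt)
    (by
      intro σ hσ heq
      set e := Real.exp (-(2 * C) * σ + 2 * C * t) with he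
      set r := Real.exp (l + k * (1 - e)) with hr
      have hr0 : 0 < r := Real.exp_pos _
      have hrY : ‖Y σ‖ = r := by
        have : ‖Y σ‖ ^ 2 = r ^ 2 := by simpa [hQ, he, hr] using heq
        exact (pow_left_inj₀ (norm_nonneg _) hr0.le two_ne_zero).1 this
      have he1 : 1 ≤ e := Real.one_le_exp (by
        rw [← hrw]
        have : 0 ≤ t - σ := sub_nonneg.2 hσ.2.le
        have : 0 ≤ C := hA0.trans hC.le
        positivity)
      have hb := logMod_barrier he1 hk hkl
      rw [← hr] at hb
      have h2 := abs_inner_trajectory (Y := Y) hA σ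
      rw [hrY] at h2
      have h3 := (abs_le.1 h2).2
      have hke : 0 < k * e := by positivity
      have : A * (r * logMod r) ≤ A * (k * e * r ^ 2) := by
        refine mul_le_mul_of_nonneg_left ?_ hA0
        nlinarith
      have : A * (k * e * r ^ 2) < C * (k * e * r ^ 2) := by
        gcongr
      nlinarith [mul_pos hke (pow_pos hr0 2)])
  have := key ⟨hσ₀.2, le_rfl⟩
  simp only [hQ, ← hrw, sub_self, mul_zero, Real.exp_zero, add_zero] at this
  exact (pow_le_pow_iff_left₀ (norm_nonneg _) (Real.exp_pos _).le two_ne_zero).1 this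

end Barrier

end VortexWave
end

noncomputable section

namespace VortexWave

/-! ### Smooth approximation of Lipschitz functions -/

set_option linter.unusedSectionVars false

section Mollify

open Filter Topology ContinuousLinearMap
open scoped Convolution

variable {E : Type*} [NormedAddCommGroup E] [NormedSpace ℝ E] [FiniteDimensional ℝ E]
  [MeasurableSpace E] [BorelSpace E] (μ : Measure E) [μ.IsAddHaarMeasure]
  {ψ : E → ℝ} {C : ℝ≥0}

lemma lineDeriv_comp_sub_left (ψ : E → ℝ) (x t v : E) :
    lineDeriv ℝ (fun t => ψ (x - t)) t (-v) = lineDeriv ℝ ψ (x - t) v := by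
  have : (fun s : ℝ => ψ (x - (t + s • -v))) = fun s => ψ (x - t + s • v) := by
    ext s
    congr 1
    rw [smul_neg]; abel
  rw [lineDeriv, this, lineDeriv]

/-- The standard bump function supported in the ball of radius `1 / (n + 1)`. -/
def stdBump (E : Type*) [NormedAddCommGroup E] (n : ℕ) : ContDiffBump (0 : E) where
  rIn := (1 / (n + 1 : ℝ)) / 2
  rOut := 1 / (n + 1 : ℝ)
  rIn_pos := by positivity
  rIn_lt_rOut := half_lt_self (by positivity)

lemma tendsto_stdBump_rOut : Tendsto (fun n => (stdBump E n).rOut) atTop (𝓝 0) :=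
  tendsto_one_div_add_atTop_nhds_zero_nat

/-- The mollification of `ψ` at scale `1 / (n + 1)`. -/
def mollify (ψ : E → ℝ) (n : ℕ) : E → ℝ := (stdBump E n).normed μ ⋆[lsmul ℝ ℝ, μ] ψ

lemma contDiff_mollify (hψ : LocallyIntegrable ψ μ) (n : ℕ) :
    ContDiff ℝ ((⊤ : ℕ∞) : WithTop ℕ∞) (mollify μ ψ n) :=
  (stdBump E n).hasCompactSupport_normed.contDiff_convolution_left _
    (stdBump E n).contDiff_normed hψ

lemma mollify_apply (ψ : E → ℝ) (n : ℕ) (x : E) :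
    mollify μ ψ n x = ∫ t, (stdBump E n).normed μ t * ψ (x - t) ∂μ := by
  simp [mollify, convolution]

lemma ae_tendsto_mollify (hψ : LocallyIntegrable ψ μ) :
    ∀ᵐ x ∂μ, Tendsto (fun n => mollify μ ψ n x) atTop (𝓝 (ψ x)) :=
  ContDiffBump.ae_convolution_tendsto_right_of_locallyIntegrable (K := 2)
    (φ := fun n => stdBump E n) tendsto_stdBump_rOut
    (Eventually.of_forall fun n => by
      simp only [stdBump]; linarith) hψ

lemma integrable_normed_mul {g : E → ℝ} (n : ℕ) (x : E) (hg : LocallyIntegrable g μ) :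
    Integrable (fun t => (stdBump E n).normed μ t * g (x - t)) μ := by
  have := ((stdBump E n).hasCompactSupport_normed (μ := μ)).convolutionExists_left (lsmul ℝ ℝ)
    (stdBump E n).continuous_normed hg x
  simpa [ConvolutionExistsAt] using this

lemma abs_mollify_sub_le (hψ : LocallyIntegrable ψ μ) (n : ℕ) (x a : E) (b c : ℝ)
    (h : ∀ t, |ψ (x - t) - c * ψ (a - t)| ≤ b) :
    |mollify μ ψ n x - c * mollify μ ψ n a| ≤ b := by
  rw [mollify_apply, mollify_apply, ← integral_const_mul, ← integral_sub
    (integrable_normed_mul μ n x hψ) ((integrable_normed_mul μ n a hψ).const_mul c)]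
  have hi : Integrable (fun t => (stdBump E n).normed μ t * b) μ :=
    (stdBump E n).integrable_normed.mul_const b
  rw [← Real.norm_eq_abs]
  refine (norm_integral_le_of_norm_le hi (ae_of_all _ fun t => ?_)).trans ?_
  · rw [show (stdBump E n).normed μ t * ψ (x - t) - c * ((stdBump E n).normed μ t * ψ (a - t)) =
      (stdBump E n).normed μ t * (ψ (x - t) - c * ψ (a - t)) by ring, norm_mul,
      Real.norm_of_nonneg ((stdBump E n).nonneg_normed t)]
    exact mul_le_mul_of_nonneg_left (h t) ((stdBump E n).nonneg_normed t)
  · rw [integral_mul_const, (stdBump E n).integral_normed, one_mul]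

lemma abs_mollify_le (hψ : LocallyIntegrable ψ μ) (n : ℕ) (x : E) (b : ℝ)
    (h : ∀ t, |ψ t| ≤ b) : |mollify μ ψ n x| ≤ b := by
  simpa using abs_mollify_sub_le μ hψ n x x b 0 (by simpa using fun t => h (x - t))

lemma lipschitzWith_mollify (hψ : LipschitzWith C ψ) (n : ℕ) :
    LipschitzWith C (mollify μ ψ n) := by
  refine LipschitzWith.of_dist_le_mul fun x y => ?_
  rw [Real.dist_eq]
  have := abs_mollify_sub_le μ hψ.continuous.locallyIntegrable n x y (C * dist x y) 1 (fun t => by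
    have := hψ.dist_le_mul (x - t) (y - t)
    rwa [dist_sub_right, Real.dist_eq, ← one_mul (ψ (y - t))] at this)
  simpa using this

lemma abs_mollify_sub_self_le (hψ : LipschitzWith C ψ) (n : ℕ) (x : E) :
    |mollify μ ψ n x - ψ x| ≤ C * (1 / (n + 1)) := by
  rw [← Real.dist_eq]
  refine (stdBump E n).dist_normed_convolution_le hψ.continuous.aestronglyMeasurable
    fun y hy => (hψ.dist_le_mul y x).trans ?_
  exact mul_le_mul_of_nonneg_left (Metric.mem_ball.1 hy).le C.2

lemma mollify_eq_zero {n : ℕ} {x : E} (h : ∀ y, ‖y - x‖ ≤ 1 / (n + 1 : ℝ) → ψ y = 0) :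
    mollify μ ψ n x = 0 := by
  rw [mollify_apply]
  refine integral_eq_zero_of_ae (ae_of_all _ fun t => ?_)
  by_cases ht : ‖t‖ < 1 / (n + 1 : ℝ)
  · simp [h (x - t) (by simpa using ht.le)]
  · have : (stdBump E n).normed μ t = 0 := by
      rw [← Function.notMem_support, (stdBump E n).support_normed_eq]
      simpa [stdBump] using ht
    simp [this]

lemma fderiv_mollify (hψ : LipschitzWith C ψ) (n : ℕ) (x v : E) :
    fderiv ℝ (mollify μ ψ n) x v = mollify μ (fun y => lineDeriv ℝ ψ y v) n x := by
  have hd : DifferentiableAt ℝ (mollify μ ψ n) x :=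
    (contDiff_mollify μ hψ.continuous.locallyIntegrable n).differentiable (by simp) x
  have h1 : Tendsto (fun s : ℝ => s⁻¹ • (mollify μ ψ n (x + s • v) - mollify μ ψ n x)) (𝓝[>] 0)
      (𝓝 (fderiv ℝ (mollify μ ψ n) x v)) := by
    have := hd.hasFDerivAt.hasLineDerivAt v
    exact this.tendsto_slope_zero_right
  have hf : LipschitzWith C fun t => ψ (x - t) := by
    refine LipschitzWith.of_dist_le_mul fun a b => ?_
    rw [← dist_sub_left x a b]
    exact hψ.dist_le_mul (x - a) (x - b)
  have h2 := hf.integral_inv_smul_sub_mul_tendsto_integral_lineDeriv_mul (μ := μ)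
    (stdBump E n).integrable_normed (-v) (g := (stdBump E n).normed μ)
  refine tendsto_nhds_unique h1 ?_
  rw [mollify_apply μ (fun y => lineDeriv ℝ ψ y v) n x]
  convert h2 using 1
  · ext s
    rw [mollify_apply μ ψ n x, mollify_apply μ ψ n (x + s • v), ← integral_sub
      (integrable_normed_mul μ n _ hψ.continuous.locallyIntegrable)
      (integrable_normed_mul μ n _ hψ.continuous.locallyIntegrable), ← integral_smul]
    congr 1
    ext t
    rw [show x - (t + s • -v) = x + s • v - t by rw [smul_neg]; abel]
    simp only [smul_eq_mul]
    ring
  · congr 1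
    refine integral_congr_ae (ae_of_all _ fun t => ?_)
    simp only
    rw [lineDeriv_comp_sub_left, mul_comm]

lemma ae_tendsto_fderiv_mollify (hψ : LipschitzWith C ψ) :
    ∀ᵐ x ∂μ, ∀ v, Tendsto (fun n => fderiv ℝ (mollify μ ψ n) x v) atTop (𝓝 (fderiv ℝ ψ x v)) := by
  let b := Module.finBasis ℝ E
  have h1 : ∀ᵐ x ∂μ, ∀ i, Tendsto (fun n => mollify μ (fun y => lineDeriv ℝ ψ y (b i)) n x) atTop
      (𝓝 (lineDeriv ℝ ψ x (b i))) :=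
    ae_all_iff.2 fun i => ae_tendsto_mollify μ (hψ.locallyIntegrable_lineDeriv (b i))
  filter_upwards [h1, hψ.ae_differentiableAt (μ := μ)] with x hx hd v
  rw [← b.sum_repr v]
  simp only [map_sum, map_smul]
  refine tendsto_finsetSum _ fun i _ => Tendsto.const_smul ?_ _
  simp only [fderiv_mollify μ hψ]
  rw [← hd.lineDeriv_eq_fderiv]
  exact hx i

lemma tsupport_mollify_subset (ψ : E → ℝ) (n : ℕ) :
    tsupport (mollify μ ψ n) ⊆ Metric.cthickening 1 (tsupport ψ) := by
  refine closure_minimal (fun x hx => ?_) Metric.isClosed_cthickening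
  by_contra hcon
  refine hx (mollify_eq_zero μ fun y hy => ?_)
  by_contra hy0
  refine hcon (Metric.mem_cthickening_of_dist_le x y 1 _ (subset_tsupport _ hy0) ?_)
  rw [dist_comm, dist_eq_norm]
  exact hy.trans (by
    rw [div_le_one (by positivity)]; linarith [n.cast_nonneg (α := ℝ)])

end Mollify

end VortexWave
end

noncomputable section

namespace VortexWave

open Filter Topology

/-! ### Solutions with everywhere bounded vorticity, tested with Lipschitz functions -/

instance : (volume : Measure (ℝ × Plane)).IsAddHaarMeasure :=
  inferInstanceAs ((volume : Measure ℝ).prod (volume : Measure Plane)).IsAddHaarMeasure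

/-- The velocity field that transports the vorticity. -/
def field (ω : ℝ → Plane → ℝ) (z : ℝ → Plane) (p : ℝ × Plane) : Plane :=
  velocity (ω p.1) p.2 + biotSavart (p.2 - z p.1)

/-- An Eulerian solution whose vorticity is measurable and satisfies the bounds by `M` everywhere,
and whose trajectory is extended continuously to negative times. -/
structure IsBoundedSolution (M : ℝ) (ω₀ : Plane → ℝ) (z₀ : Plane) (ω : ℝ → Plane → ℝ)
    (z : ℝ → Plane) : Prop where
  measurable : Measurable fun p : ℝ × Plane => ω p.1 p.2
  bddInt : ∀ t, BddInt M (ω t)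
  continuous : Continuous z
  initial_integrable : Integrable ω₀
  transport : ∀ ψ : ℝ × Plane → ℝ, ContDiff ℝ ((⊤ : ℕ∞) : WithTop ℕ∞) ψ → HasCompactSupport ψ →
    -∫ x, ω₀ x * ψ (0, x) =
      ∫ t in Ici (0 : ℝ), ∫ x, ω t x * fderiv ℝ ψ (t, x) (1, field ω z (t, x))
  trajectory : ∀ t : ℝ, 0 ≤ t → z t = z₀ + ∫ s in (0 : ℝ)..t, velocity (ω s) (z s)

section

variable {M : ℝ} {ω₀ : Plane → ℝ} {z₀ : Plane} {ω : ℝ → Plane → ℝ} {z : ℝ → Plane}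

lemma measurable_vel (hω : Measurable fun p : ℝ × Plane => ω p.1 p.2) (ε : ℝ) :
    Measurable fun p : ℝ × Plane => vel ε (ω p.1) p.2 := by
  have : Measurable fun q : (ℝ × Plane) × Plane => ω q.1.1 q.2 • regKernel ε (q.1.2 - q.2) :=
    (hω.comp (measurable_fst.fst.prodMk measurable_snd)).smul
      ((measurable_regKernel ε).comp (measurable_fst.snd.sub measurable_snd))
  exact (this.stronglyMeasurable.integral_prod_right (ν := volume)).measurable

lemma measurable_field (hω : Measurable fun p : ℝ × Plane => ω p.1 p.2) (hz : Continuous z) :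
    Measurable (field ω z) := by
  refine Measurable.add ?_ ?_
  · simp_rw [velocity_eq_vel]
    exact measurable_vel hω 0
  · rw [← regKernel_zero]
    exact (measurable_regKernel 0).comp (measurable_snd.sub (hz.measurable.comp measurable_fst))

/-- The change to the frame that moves with `z` preserves the measure. -/
lemma measurePreserving_shear (hz : Continuous z) :
    MeasurePreserving (fun p : ℝ × Plane => (p.1, p.2 - z p.1)) volume volume := by
  refine MeasurePreserving.skew_product (g := fun t x => x - z t) (MeasurePreserving.id volume)
    ?_ ?_
  · exact measurable_snd.sub (hz.measurable.comp measurable_fst)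
  · exact ae_of_all _ fun t => (measurePreserving_sub_right volume (z t)).map_eq

lemma integrableOn_inv_norm_sub (hz : Continuous z) {K : Set (ℝ × Plane)} (hK : IsCompact K) :
    IntegrableOn (fun p : ℝ × Plane => ‖p.2 - z p.1‖⁻¹) K := by
  have hc : Continuous fun p : ℝ × Plane => (p.1, p.2 - z p.1) := by fun_prop
  obtain ⟨r, hr⟩ := ((hK.image hc).isBounded).subset_ball 0
  have h1 : Integrable fun q : ℝ × Plane => (Metric.ball (0 : ℝ) r).indicator (fun _ => (1 : ℝ)) q.1 *
      (Metric.ball (0 : Plane) r).indicator (fun y => ‖y‖⁻¹) q.2 := by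
    refine Integrable.mul_prod ?_ ?_
    · rw [integrable_indicator_iff measurableSet_ball]
      exact integrableOn_const measure_ball_lt_top.ne
    · rw [integrable_indicator_iff measurableSet_ball]
      exact integrableOn_inv_norm r
  have h2 := (measurePreserving_shear hz).integrable_comp_of_integrable h1
  refine (h2.integrableOn (s := K)).congr_fun_ae ?_
  filter_upwards [ae_restrict_mem hK.measurableSet] with p hp
  have := hr (mem_image_of_mem _ hp)
  rw [← ball_prod_same] at this
  have h3 : p.1 ∈ Metric.ball (0 : ℝ) r := this.1
  have h4 : p.2 - z p.1 ∈ Metric.ball (0 : Plane) r := this.2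
  simp only [Function.comp]
  rw [indicator_of_mem h3, indicator_of_mem h4, one_mul]

lemma norm_field_le (h : ∀ t, BddInt M (ω t)) (p : ℝ × Plane) :
    ‖field ω z p‖ ≤ 2 * M + ‖p.2 - z p.1‖⁻¹ := by
  refine (norm_add_le _ _).trans (add_le_add ?_ ?_)
  · rw [velocity_eq_vel]; exact (h p.1).norm_vel_le 0 p.2
  · rw [← regKernel_zero]
    refine (norm_regKernel_le _ _).trans ?_
    exact mul_le_of_le_one_left (by positivity) inv_two_pi_le_one

/-- The derivative of `ψ` along the transporting field. -/
def advect (ω : ℝ → Plane → ℝ) (z : ℝ → Plane) (ψ : ℝ × Plane → ℝ) (p : ℝ × Plane) : ℝ :=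
  fderiv ℝ ψ p (1, field ω z p)

lemma measurable_advect (hω : Measurable fun p : ℝ × Plane => ω p.1 p.2) (hz : Continuous z)
    (ψ : ℝ × Plane → ℝ) : Measurable (advect ω z ψ) :=
  isBoundedBilinearMap_apply.continuous.measurable.comp
    ((measurable_fderiv ℝ ψ).prodMk (measurable_const.prodMk (measurable_field hω hz)))

lemma abs_advect_le (h : ∀ t, BddInt M (ω t)) {ψ : ℝ × Plane → ℝ} {C : ℝ≥0}
    (hψ : LipschitzWith C ψ) (p : ℝ × Plane) :
    |advect ω z ψ p| ≤ C * (1 + 2 * M + ‖p.2 - z p.1‖⁻¹) := by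
  have h1 := (fderiv ℝ ψ p).le_opNorm (1, field ω z p)
  refine h1.trans (mul_le_mul (norm_fderiv_le_of_lipschitz ℝ hψ) ?_ (norm_nonneg _) C.2)
  have := norm_field_le (z := z) h p
  have hM := (h 0).nonneg
  have : 0 ≤ ‖p.2 - z p.1‖⁻¹ := by positivity
  simp only [Prod.norm_def, norm_one]
  exact max_le (by linarith) (by linarith)

lemma advect_eq_zero {ψ : ℝ × Plane → ℝ} {p : ℝ × Plane} (hp : p ∉ tsupport ψ) :
    advect ω z ψ p = 0 := by
  have : fderiv ℝ ψ p = 0 := by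
    by_contra hne
    exact hp (support_fderiv_subset ℝ hne)
  simp [advect, this]

/-- An integrable function that dominates `advect ω z ψ` when `ψ` is supported in `K`. -/
def advectBound (M C : ℝ) (z : ℝ → Plane) (K : Set (ℝ × Plane)) : ℝ × Plane → ℝ :=
  K.indicator fun p => C * (1 + 2 * M + ‖p.2 - z p.1‖⁻¹)

lemma integrable_advectBound (hz : Continuous z) {K : Set (ℝ × Plane)} (hK : IsCompact K)
    (M C : ℝ) : Integrable (advectBound M C z K) := by
  rw [advectBound, integrable_indicator_iff hK.measurableSet]
  exact ((integrableOn_const hK.measure_lt_top.ne).add (integrableOn_inv_norm_sub hz hK)).const_mul _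

lemma abs_advect_le_advectBound (h : ∀ t, BddInt M (ω t)) {ψ : ℝ × Plane → ℝ} {C : ℝ≥0}
    (hψ : LipschitzWith C ψ) {K : Set (ℝ × Plane)} (hK : tsupport ψ ⊆ K) (p : ℝ × Plane) :
    |advect ω z ψ p| ≤ advectBound M C z K p := by
  by_cases hp : p ∈ K
  · rw [advectBound, indicator_of_mem hp]
    exact abs_advect_le h hψ p
  · rw [advect_eq_zero fun h => hp (hK h), abs_zero, advectBound, indicator_of_notMem hp]

lemma integrable_advect (hω : Measurable fun p : ℝ × Plane => ω p.1 p.2)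
    (h : ∀ t, BddInt M (ω t)) (hz : Continuous z) {ψ : ℝ × Plane → ℝ} {C : ℝ≥0}
    (hψ : LipschitzWith C ψ) (hc : HasCompactSupport ψ) :
    Integrable (advect ω z ψ) :=
  (integrable_advectBound hz hc M C).mono' (measurable_advect hω hz ψ).aestronglyMeasurable
    (ae_of_all _ fun p => abs_advect_le_advectBound h hψ subset_rfl p)

lemma integrable_mul_advect (hω : Measurable fun p : ℝ × Plane => ω p.1 p.2)
    (h : ∀ t, BddInt M (ω t)) (hz : Continuous z) {ψ : ℝ × Plane → ℝ} {C : ℝ≥0}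
    (hψ : LipschitzWith C ψ) (hc : HasCompactSupport ψ) :
    Integrable fun p : ℝ × Plane => ω p.1 p.2 * advect ω z ψ p :=
  (integrable_advect hω h hz hψ hc).bdd_mul (c := M) hω.aestronglyMeasurable
    (ae_of_all _ fun p => (h p.1).bound p.2)

lemma IsBoundedSolution.transport_lipschitz (h : IsBoundedSolution M ω₀ z₀ ω z)
    {ψ : ℝ × Plane → ℝ} {C : ℝ≥0} (hψ : LipschitzWith C ψ) (hc : HasCompactSupport ψ) :
    -∫ x, ω₀ x * ψ (0, x) =
      ∫ p in Ici (0 : ℝ) ×ˢ (univ : Set Plane), ω p.1 p.2 * advect ω z ψ p := by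
  set K := Metric.cthickening 1 (tsupport ψ)
  have hK : IsCompact K := IsCompact.cthickening hc
  set g : ℕ → ℝ × Plane → ℝ := mollify volume ψ
  have hgK : ∀ n, tsupport (g n) ⊆ K := tsupport_mollify_subset volume ψ
  have hgc : ∀ n, HasCompactSupport (g n) := fun n => hK.of_isClosed_subset isClosed_closure (hgK n)
  have hgl : ∀ n, LipschitzWith C (g n) := lipschitzWith_mollify volume hψ
  have hgt : ∀ p, Tendsto (fun n => g n p) atTop (𝓝 (ψ p)) := by
    intro p
    rw [tendsto_iff_dist_tendsto_zero]
    have h0 : Tendsto (fun n : ℕ => (C : ℝ) * (1 / (n + 1))) atTop (𝓝 0) := by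
      simpa using tendsto_one_div_add_atTop_nhds_zero_nat.const_mul (C : ℝ)
    exact squeeze_zero (fun _ => dist_nonneg)
      (fun n => (Real.dist_eq _ _).le.trans (abs_mollify_sub_self_le volume hψ n p)) h0
  have hbd : ∃ B, ∀ p, |ψ p| ≤ B := by
    obtain ⟨B, hB⟩ := hc.exists_bound_of_continuous hψ.continuous
    exact ⟨B, hB⟩
  obtain ⟨B, hB⟩ := hbd
  have h1 : ∀ n, -∫ x, ω₀ x * g n (0, x) =
      ∫ p in Ici (0 : ℝ) ×ˢ (univ : Set Plane), ω p.1 p.2 * advect ω z (g n) p := by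
    intro n
    rw [h.transport (g n) (contDiff_mollify volume hψ.continuous.locallyIntegrable n) (hgc n),
      Measure.volume_eq_prod, setIntegral_prod]
    · simp only [Measure.restrict_univ, advect]
    · rw [← Measure.volume_eq_prod]
      exact (integrable_mul_advect h.measurable h.bddInt h.continuous (hgl n) (hgc n)).integrableOn
  have hL : Tendsto (fun n => -∫ x, ω₀ x * g n (0, x)) atTop (𝓝 (-∫ x, ω₀ x * ψ (0, x))) := by
    refine (tendsto_integral_of_dominated_convergence (fun x => |ω₀ x| * B) (fun n => ?_)
      (h.initial_integrable.abs.mul_const B) (fun n => ae_of_all _ fun x => ?_)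
      (ae_of_all _ fun x => (hgt (0, x)).const_mul _)).neg
    · exact h.initial_integrable.aestronglyMeasurable.mul
        ((hgl n).continuous.comp (by fun_prop)).aestronglyMeasurable
    · rw [norm_mul, Real.norm_eq_abs, Real.norm_eq_abs]
      exact mul_le_mul_of_nonneg_left
        (abs_mollify_le volume hψ.continuous.locallyIntegrable n _ B hB) (abs_nonneg _)
  have hR : Tendsto (fun n => ∫ p in Ici (0 : ℝ) ×ˢ (univ : Set Plane),
      ω p.1 p.2 * advect ω z (g n) p) atTop
      (𝓝 (∫ p in Ici (0 : ℝ) ×ˢ (univ : Set Plane), ω p.1 p.2 * advect ω z ψ p)) := by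
    refine tendsto_integral_of_dominated_convergence (fun p => M * advectBound M C z K p)
      (fun n => ?_) ((integrable_advectBound h.continuous hK M C).const_mul M).integrableOn
      (fun n => ae_of_all _ fun p => ?_) (ae_restrict_of_ae ?_)
    · exact (h.measurable.mul (measurable_advect h.measurable h.continuous _)).aestronglyMeasurable
    · rw [norm_mul]
      exact mul_le_mul ((h.bddInt p.1).bound p.2)
        (abs_advect_le_advectBound h.bddInt (hgl n) (hgK n) p) (abs_nonneg _) (h.bddInt 0).nonneg
    · filter_upwards [ae_tendsto_fderiv_mollify volume hψ] with p hp
      exact (hp _).const_mul _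
  refine tendsto_nhds_unique hL ?_
  simp_rw [h1]
  exact hR

end

/-! ### The weak formulation at a given time -/

/-- A bounded Lipschitz test function on space-time supported in a cylinder. -/
structure IsTest (C : ℝ≥0) (ρ : ℝ) (ψ : ℝ × Plane → ℝ) : Prop where
  lipschitz : LipschitzWith C ψ
  zero : ∀ σ x, ρ ≤ ‖x‖ → ψ (σ, x) = 0
  bounded : ∃ B, ∀ p, |ψ p| ≤ B

/-- A Lipschitz cut-off in time: `1` on `[0, t]` and `0` after `t + 1 / (n + 1)`. -/
def timeCutoff (t : ℝ) (n : ℕ) (σ : ℝ) : ℝ :=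
  max 0 (min (min 1 (σ + 2)) (1 - (n + 1) * (σ - t)))

lemma timeCutoff_nonneg (t : ℝ) (n : ℕ) (σ : ℝ) : 0 ≤ timeCutoff t n σ := le_max_left _ _

lemma timeCutoff_le_one (t : ℝ) (n : ℕ) (σ : ℝ) : timeCutoff t n σ ≤ 1 :=
  max_le zero_le_one ((min_le_left _ _).trans (min_le_left _ _))

lemma timeCutoff_of_le {t : ℝ} {n : ℕ} {σ : ℝ} (h0 : -1 ≤ σ) (h : σ ≤ t) :
    timeCutoff t n σ = 1 := by
  have : (n + 1 : ℝ) * (σ - t) ≤ 0 := mul_nonpos_of_nonneg_of_nonpos (by positivity) (by linarith)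
  rw [timeCutoff, min_eq_left (by linarith : (1 : ℝ) ≤ σ + 2), min_eq_left (by linarith),
    max_eq_right zero_le_one]

lemma timeCutoff_of_mem {t : ℝ} {n : ℕ} {σ : ℝ} (h0 : -1 ≤ σ)
    (h : σ ∈ Icc t (t + 1 / (n + 1))) : timeCutoff t n σ = 1 - (n + 1) * (σ - t) := by
  have hn : (0 : ℝ) < n + 1 := by positivity
  have h1 : 0 ≤ (n + 1 : ℝ) * (σ - t) := mul_nonneg hn.le (by linarith [h.1])
  have h2 : (n + 1 : ℝ) * (σ - t) ≤ 1 := by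
    rw [mul_comm, ← le_div_iff₀ hn]; linarith [h.2]
  rw [timeCutoff, min_eq_left (by linarith : (1 : ℝ) ≤ σ + 2), min_eq_right (by linarith),
    max_eq_right (by linarith)]

lemma timeCutoff_of_ge {t : ℝ} {n : ℕ} {σ : ℝ} (h : t + 1 / (n + 1) ≤ σ) :
    timeCutoff t n σ = 0 := by
  have hn : (0 : ℝ) < n + 1 := by positivity
  have h2 : 1 ≤ (n + 1 : ℝ) * (σ - t) := by
    rw [mul_comm, ← div_le_iff₀ hn]; linarith
  exact max_eq_left ((min_le_right _ _).trans (by linarith))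

lemma timeCutoff_of_le_neg_two {t : ℝ} {n : ℕ} {σ : ℝ} (h : σ ≤ -2) :
    timeCutoff t n σ = 0 :=
  max_eq_left ((min_le_left _ _).trans ((min_le_right _ _).trans (by linarith)))

lemma lipschitzWith_timeCutoff (t : ℝ) (n : ℕ) :
    LipschitzWith (n + 1 : ℝ≥0) (timeCutoff t n) := by
  have h1 : LipschitzWith (1 : ℝ≥0) fun σ : ℝ => min 1 (σ + 2) := by
    refine LipschitzWith.const_min (LipschitzWith.of_dist_le_mul fun x y => ?_) _
    simp
  have h2 : LipschitzWith (n + 1 : ℝ≥0) fun σ : ℝ => 1 - (n + 1 : ℝ) * (σ - t) := by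
    refine LipschitzWith.of_dist_le_mul fun x y => ?_
    rw [dist_sub_left, Real.dist_eq, ← mul_sub, sub_sub_sub_cancel_right, abs_mul, Real.dist_eq]
    rw [abs_of_nonneg (by positivity : (0 : ℝ) ≤ n + 1)]
    simp
  have := (h1.min h2).const_max 0
  rwa [max_eq_right (by simp)] at this

lemma hasDerivAt_timeCutoff {t : ℝ} (ht : 0 ≤ t) {n : ℕ} {σ : ℝ} (h0 : 0 ≤ σ) (h1 : σ ≠ t)
    (h2 : σ ≠ t + 1 / (n + 1)) :
    HasDerivAt (timeCutoff t n)
      ((Ioo t (t + 1 / (n + 1))).indicator (fun _ => -(n + 1 : ℝ)) σ) σ := by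
  rcases lt_or_gt_of_ne h1 with h | h
  · rw [indicator_of_notMem fun hm => hm.1.not_gt h]
    refine (hasDerivAt_const σ (1 : ℝ)).congr_of_eventuallyEq ?_
    filter_upwards [Ioo_mem_nhds (by linarith : (-1 : ℝ) < σ) h] with τ hτ
    exact timeCutoff_of_le hτ.1.le hτ.2.le
  rcases lt_or_gt_of_ne h2 with h' | h'
  · have hm : σ ∈ Ioo t (t + 1 / (n + 1 : ℝ)) := ⟨h, h'⟩
    rw [indicator_of_mem hm]
    have : HasDerivAt (fun σ : ℝ => 1 - (n + 1 : ℝ) * (σ - t)) (-(n + 1 : ℝ)) σ := by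
      simpa using (((hasDerivAt_id σ).sub_const t).const_mul (n + 1 : ℝ)).const_sub 1
    refine this.congr_of_eventuallyEq ?_
    filter_upwards [Ioo_mem_nhds h h'] with τ hτ
    exact timeCutoff_of_mem (by linarith [hτ.1]) ⟨hτ.1.le, hτ.2.le⟩
  · rw [indicator_of_notMem fun hm => hm.2.not_gt h']
    refine (hasDerivAt_const σ (0 : ℝ)).congr_of_eventuallyEq ?_
    filter_upwards [Ioi_mem_nhds h'] with τ hτ
    exact timeCutoff_of_ge (le_of_lt hτ)

section

variable {M : ℝ} {ω₀ : Plane → ℝ} {z₀ : Plane} {ω : ℝ → Plane → ℝ} {z : ℝ → Plane}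
  {C : ℝ≥0} {ρ : ℝ} {ψ : ℝ × Plane → ℝ}

lemma IsTest.lipschitz_slice (h : IsTest C ρ ψ) (σ : ℝ) : LipschitzWith C fun x => ψ (σ, x) := by
  refine LipschitzWith.of_dist_le_mul fun x y => ?_
  have := h.lipschitz.dist_le_mul (σ, x) (σ, y)
  rwa [dist_prod_same_left] at this

lemma IsTest.hasCompactSupport_slice (h : IsTest C ρ ψ) (σ : ℝ) :
    HasCompactSupport fun x => ψ (σ, x) :=
  HasCompactSupport.intro (isCompact_closedBall (0 : Plane) ρ) fun x hx =>
    h.zero σ x (by simpa using (not_le.1 (by simpa using hx)).le)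

lemma IsTest.tsupport_subset (h : IsTest C ρ ψ) : tsupport ψ ⊆ univ ×ˢ Metric.closedBall 0 ρ := by
  refine closure_minimal (fun p hp => ⟨mem_univ _, ?_⟩) (isClosed_univ.prod Metric.isClosed_closedBall)
  by_contra hcon
  exact hp (h.zero p.1 p.2 (by simpa using (not_le.1 (by simpa using hcon)).le))

lemma abs_advect_le_of_isTest (hb : ∀ t, BddInt M (ω t)) (h : IsTest C ρ ψ) {a b : ℝ}
    {p : ℝ × Plane} (hp : p.1 ∈ Icc a b) :
    |advect ω z ψ p| ≤ advectBound M C z (Icc a b ×ˢ Metric.closedBall 0 ρ) p := by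
  by_cases hx : p.2 ∈ Metric.closedBall (0 : Plane) ρ
  · have hm : p ∈ Icc a b ×ˢ Metric.closedBall (0 : Plane) ρ := ⟨hp, hx⟩
    rw [advectBound, indicator_of_mem hm]
    exact abs_advect_le hb h.lipschitz p
  · rw [advect_eq_zero fun h' => hx (h.tsupport_subset h').2, abs_zero, advectBound,
      indicator_of_notMem fun h' => hx h'.2]

lemma integrableOn_mul_of_isTest (hω : Measurable fun p : ℝ × Plane => ω p.1 p.2)
    (hb : ∀ t, BddInt M (ω t)) (h : IsTest C ρ ψ) (a b : ℝ) :
    IntegrableOn (fun p : ℝ × Plane => ω p.1 p.2 * ψ p) (Icc a b ×ˢ univ) := by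
  obtain ⟨B, hB⟩ := h.bounded
  have hK : IsCompact (Icc a b ×ˢ Metric.closedBall (0 : Plane) ρ) :=
    isCompact_Icc.prod (isCompact_closedBall _ _)
  have : Integrable ((Icc a b ×ˢ Metric.closedBall (0 : Plane) ρ).indicator fun _ => M * B) := by
    rw [integrable_indicator_iff hK.measurableSet]
    exact integrableOn_const hK.measure_lt_top.ne
  refine this.integrableOn.mono' (hω.mul h.lipschitz.continuous.measurable).aestronglyMeasurable ?_
  filter_upwards [ae_restrict_mem (measurableSet_Icc.prod MeasurableSet.univ)] with p hp
  by_cases hx : p.2 ∈ Metric.closedBall (0 : Plane) ρ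
  · have hm : p ∈ Icc a b ×ˢ Metric.closedBall (0 : Plane) ρ := ⟨hp.1, hx⟩
    rw [indicator_of_mem hm, norm_mul]
    exact mul_le_mul ((hb p.1).bound p.2) (hB p) (abs_nonneg _) (hb 0).nonneg
  · have : ψ p = 0 := h.zero p.1 p.2 (by simpa using (not_le.1 (by simpa using hx)).le)
    rw [indicator_of_notMem fun h' => hx h'.2, this, mul_zero, norm_zero]

lemma integrableOn_advect_of_isTest (hω : Measurable fun p : ℝ × Plane => ω p.1 p.2)
    (hb : ∀ t, BddInt M (ω t)) (hz : Continuous z) (h : IsTest C ρ ψ) (a b : ℝ) :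
    IntegrableOn (advect ω z ψ) (Icc a b ×ˢ univ) := by
  have hK : IsCompact (Icc a b ×ˢ Metric.closedBall (0 : Plane) ρ) :=
    isCompact_Icc.prod (isCompact_closedBall _ _)
  refine (integrable_advectBound hz hK M C).integrableOn.mono'
    (measurable_advect hω hz ψ).aestronglyMeasurable ?_
  filter_upwards [ae_restrict_mem (measurableSet_Icc.prod MeasurableSet.univ)] with p hp
  exact abs_advect_le_of_isTest hb h hp.1

lemma integrableOn_mul_advect_of_isTest (hω : Measurable fun p : ℝ × Plane => ω p.1 p.2)
    (hb : ∀ t, BddInt M (ω t)) (hz : Continuous z) (h : IsTest C ρ ψ) (a b : ℝ) :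
    IntegrableOn (fun p : ℝ × Plane => ω p.1 p.2 * advect ω z ψ p) (Icc a b ×ˢ univ) :=
  (integrableOn_advect_of_isTest hω hb hz h a b).bdd_mul (c := M) hω.aestronglyMeasurable
    (ae_of_all _ fun p => (hb p.1).bound p.2)

lemma IsTest.exists_lipschitz_cutoff (h : IsTest C ρ ψ) (t : ℝ) (n : ℕ) :
    ∃ D, LipschitzWith D fun p : ℝ × Plane => timeCutoff t n p.1 * ψ p := by
  obtain ⟨B, hB⟩ := h.bounded
  have hB0 : 0 ≤ B := (abs_nonneg _).trans (hB 0)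
  refine ⟨C + (n + 1) * B.toNNReal, LipschitzWith.of_dist_le_mul fun p q => ?_⟩
  have e : timeCutoff t n p.1 * ψ p - timeCutoff t n q.1 * ψ q =
      timeCutoff t n p.1 * (ψ p - ψ q) + (timeCutoff t n p.1 - timeCutoff t n q.1) * ψ q := by ring
  rw [Real.dist_eq, e]
  have h1 : |timeCutoff t n p.1 * (ψ p - ψ q)| ≤ 1 * (C * dist p q) := by
    rw [abs_mul, abs_of_nonneg (timeCutoff_nonneg _ _ _)]
    exact mul_le_mul (timeCutoff_le_one _ _ _) (h.lipschitz.dist_le_mul p q) (abs_nonneg _)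
      zero_le_one
  have h2 : |(timeCutoff t n p.1 - timeCutoff t n q.1) * ψ q| ≤ (n + 1) * dist p q * B := by
    rw [abs_mul]
    refine mul_le_mul ?_ (hB q) (abs_nonneg _) (by positivity)
    refine ((lipschitzWith_timeCutoff t n).dist_le_mul p.1 q.1).trans ?_
    push_cast
    gcongr
    exact le_max_left _ _
  refine (abs_add_le _ _).trans ((add_le_add h1 h2).trans (le_of_eq ?_))
  push_cast
  rw [Real.coe_toNNReal _ hB0]
  ring

lemma IsTest.hasCompactSupport_cutoff (h : IsTest C ρ ψ) {t : ℝ} (n : ℕ) :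
    HasCompactSupport fun p : ℝ × Plane => timeCutoff t n p.1 * ψ p := by
  refine HasCompactSupport.intro
    (isCompact_Icc.prod (isCompact_closedBall 0 ρ) :
      IsCompact (Icc (-2) (t + 1 / (n + 1 : ℝ)) ×ˢ Metric.closedBall (0 : Plane) ρ)) fun p hp => ?_
  by_cases hx : p.2 ∈ Metric.closedBall (0 : Plane) ρ
  · have : ¬ (p.1 ∈ Icc (-2) (t + 1 / (n + 1 : ℝ))) := fun h' => hp ⟨h', hx⟩
    rw [mem_Icc, not_and_or, not_le, not_le] at this
    rcases this with h' | h'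
    · rw [timeCutoff_of_le_neg_two h'.le, zero_mul]
    · rw [timeCutoff_of_ge h'.le, zero_mul]
  · have : ψ p = 0 := h.zero p.1 p.2 (by simpa using (not_le.1 (by simpa using hx)).le)
    rw [this, mul_zero]

lemma ae_fst_ne (a : ℝ) : ∀ᵐ p : ℝ × Plane, p.1 ≠ a := by
  have : ∀ᵐ t : ℝ, t ≠ a := by simp [ae_iff]
  exact Measure.quasiMeasurePreserving_fst.ae this

lemma advect_cutoff {t : ℝ} (ht : 0 ≤ t) (n : ℕ) {p : ℝ × Plane} (h0 : 0 ≤ p.1) (h1 : p.1 ≠ t)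
    (h2 : p.1 ≠ t + 1 / (n + 1)) (hd : DifferentiableAt ℝ ψ p) :
    advect ω z (fun p : ℝ × Plane => timeCutoff t n p.1 * ψ p) p =
      -(n + 1) * (Ioo t (t + 1 / (n + 1 : ℝ)) ×ˢ univ).indicator ψ p +
        timeCutoff t n p.1 * advect ω z ψ p := by
  have e1 := (hasDerivAt_timeCutoff ht (n := n) h0 h1 h2).comp_hasFDerivAt p
    (hasFDerivAt_fst (𝕜 := ℝ) (p := p))
  have e2 := (e1.mul hd.hasFDerivAt).fderiv
  have e3 : (fun p : ℝ × Plane => timeCutoff t n p.1 * ψ p) =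
      (timeCutoff t n ∘ Prod.fst) * ψ := rfl
  rw [advect, e3, e2, advect]
  by_cases hp : p.1 ∈ Ioo t (t + 1 / (n + 1 : ℝ))
  · have hp' : p ∈ Ioo t (t + 1 / (n + 1 : ℝ)) ×ˢ (univ : Set Plane) := ⟨hp, mem_univ _⟩
    rw [indicator_of_mem hp, indicator_of_mem hp']
    simp
    ring
  · have hp' : p ∉ Ioo t (t + 1 / (n + 1 : ℝ)) ×ˢ (univ : Set Plane) := fun h => hp h.1
    rw [indicator_of_notMem hp, indicator_of_notMem hp']
    simp

lemma IsBoundedSolution.tendsto_average (h : IsBoundedSolution M ω₀ z₀ ω z) (hψ : IsTest C ρ ψ)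
    {t : ℝ} (ht : 0 ≤ t) :
    Tendsto (fun n : ℕ => (n + 1 : ℝ) *
        ∫ p in Ioo t (t + 1 / (n + 1 : ℝ)) ×ˢ univ, ω p.1 p.2 * ψ p) atTop
      (𝓝 ((∫ x, ω₀ x * ψ (0, x)) + ∫ p in Icc 0 t ×ˢ univ, ω p.1 p.2 * advect ω z ψ p)) := by
  have hmeas : MeasurableSet (Ici (0 : ℝ) ×ˢ (univ : Set Plane)) :=
    measurableSet_Ici.prod MeasurableSet.univ
  have hsub : ∀ n : ℕ, (1 : ℝ) / (n + 1) ≤ 1 := fun n => by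
    rw [div_le_one (by positivity)]; linarith [n.cast_nonneg (α := ℝ)]
  have hioo : ∀ n : ℕ, Ioo t (t + 1 / (n + 1 : ℝ)) ×ˢ (univ : Set Plane) ⊆ Icc 0 (t + 1) ×ˢ univ :=
    fun n p hp => ⟨⟨ht.trans hp.1.1.le, hp.1.2.le.trans (by linarith [hsub n])⟩, hp.2⟩
  have hI1 : ∀ n : ℕ, IntegrableOn (fun p : ℝ × Plane => ω p.1 p.2 * ψ p)
      (Ioo t (t + 1 / (n + 1 : ℝ)) ×ˢ univ) := fun n =>
    (integrableOn_mul_of_isTest h.measurable h.bddInt hψ 0 (t + 1)).mono_set (hioo n)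
  have hmIcc : MeasurableSet (Icc (0 : ℝ) (t + 1) ×ˢ (univ : Set Plane)) :=
    measurableSet_Icc.prod MeasurableSet.univ
  have hmIoo : ∀ n : ℕ, MeasurableSet (Ioo t (t + 1 / (n + 1 : ℝ)) ×ˢ (univ : Set Plane)) :=
    fun n => measurableSet_Ioo.prod MeasurableSet.univ
  have hI2 := integrableOn_mul_advect_of_isTest h.measurable h.bddInt h.continuous hψ 0 (t + 1)
  set bd : ℝ × Plane → ℝ := (Icc (0 : ℝ) (t + 1) ×ˢ (univ : Set Plane)).indicator
    fun p => |ω p.1 p.2 * advect ω z ψ p| with hbd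
  have hbdi : Integrable bd := by
    rw [hbd, integrable_indicator_iff hmIcc]; exact hI2.abs
  set θ : ℕ → ℝ × Plane → ℝ := fun n p =>
    timeCutoff t n p.1 * (ω p.1 p.2 * advect ω z ψ p) with hθ
  have hθm : ∀ n, Measurable (θ n) := fun n =>
    ((lipschitzWith_timeCutoff t n).continuous.measurable.comp measurable_fst).mul
      (h.measurable.mul (measurable_advect h.measurable h.continuous ψ))
  have hθb : ∀ n p, p ∈ Ici (0 : ℝ) ×ˢ (univ : Set Plane) → ‖θ n p‖ ≤ bd p := by
    intro n p hp
    by_cases hpt : p.1 ≤ t + 1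
    · have hm : p ∈ Icc (0 : ℝ) (t + 1) ×ˢ (univ : Set Plane) := ⟨⟨hp.1, hpt⟩, mem_univ _⟩
      rw [hbd, indicator_of_mem hm, hθ, norm_mul,
        Real.norm_of_nonneg (timeCutoff_nonneg _ _ _)]
      exact mul_le_of_le_one_left (abs_nonneg _) (timeCutoff_le_one _ _ _)
    · have : timeCutoff t n p.1 = 0 := timeCutoff_of_ge (by linarith [hsub n])
      simp only [hθ, this, zero_mul, norm_zero]
      exact indicator_nonneg (fun _ _ => abs_nonneg _) _
  have hθi : ∀ n, IntegrableOn (θ n) (Ici (0 : ℝ) ×ˢ univ) := fun n =>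
    hbdi.integrableOn.mono' (hθm n).aestronglyMeasurable
      ((ae_restrict_mem hmeas).mono fun p hp => hθb n p hp)
  have key : ∀ n : ℕ, (n + 1 : ℝ) *
        ∫ p in Ioo t (t + 1 / (n + 1 : ℝ)) ×ˢ univ, ω p.1 p.2 * ψ p =
      (∫ x, ω₀ x * ψ (0, x)) + ∫ p in Ici (0 : ℝ) ×ˢ univ, θ n p := by
    intro n
    obtain ⟨D, hD⟩ := hψ.exists_lipschitz_cutoff t n
    have e := h.transport_lipschitz hD (hψ.hasCompactSupport_cutoff n)
    simp only [timeCutoff_of_le (by norm_num : (-1 : ℝ) ≤ 0) ht, one_mul] at e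
    have e2 : ∫ p in Ici (0 : ℝ) ×ˢ (univ : Set Plane), ω p.1 p.2 *
          advect ω z (fun p : ℝ × Plane => timeCutoff t n p.1 * ψ p) p =
        ∫ p in Ici (0 : ℝ) ×ˢ (univ : Set Plane), (-(n + 1 : ℝ) *
          (Ioo t (t + 1 / (n + 1 : ℝ)) ×ˢ univ).indicator (fun p => ω p.1 p.2 * ψ p) p +
          θ n p) := by
      refine setIntegral_congr_ae hmeas ?_
      filter_upwards [ae_fst_ne t, ae_fst_ne (t + 1 / (n + 1)),
        hψ.lipschitz.ae_differentiableAt (μ := volume)] with p h1 h2 hd hp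
      rw [advect_cutoff ht n hp.1 h1 h2 hd]
      simp only [hθ, indicator_mul_right]
      ring
    rw [e2, integral_add, integral_const_mul, setIntegral_indicator (hmIoo n)] at e
    · have hinter : Ici (0 : ℝ) ×ˢ (univ : Set Plane) ∩ Ioo t (t + 1 / (n + 1 : ℝ)) ×ˢ univ =
          Ioo t (t + 1 / (n + 1 : ℝ)) ×ˢ univ :=
        inter_eq_right.2 fun p hp => ⟨(hioo n hp).1.1, mem_univ _⟩
      rw [hinter] at e
      linarith
    · refine Integrable.const_mul ?_ _
      exact (((integrable_indicator_iff (hmIoo n)).2 (hI1 n))).integrableOn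
    · exact hθi n
  simp_rw [key]
  refine Tendsto.const_add _ ?_
  have hlim : ∫ p in Icc 0 t ×ˢ univ, ω p.1 p.2 * advect ω z ψ p =
      ∫ p in Ici (0 : ℝ) ×ˢ (univ : Set Plane), (Icc (0 : ℝ) t ×ˢ univ).indicator
        (fun p => ω p.1 p.2 * advect ω z ψ p) p := by
    rw [setIntegral_indicator (measurableSet_Icc.prod MeasurableSet.univ)]
    have hinter : Ici (0 : ℝ) ×ˢ (univ : Set Plane) ∩ Icc 0 t ×ˢ univ = Icc 0 t ×ˢ univ :=
      inter_eq_right.2 fun p hp => ⟨hp.1.1, mem_univ _⟩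
    rw [hinter]
  rw [hlim]
  refine tendsto_integral_of_dominated_convergence bd
    (fun n => (hθm n).aestronglyMeasurable) hbdi.integrableOn
    (fun n => (ae_restrict_mem hmeas).mono fun p hp => hθb n p hp) ?_
  filter_upwards [ae_restrict_mem hmeas] with p hp
  rcases le_or_gt p.1 t with hpt | hpt
  · have hm : p ∈ Icc (0 : ℝ) t ×ˢ (univ : Set Plane) := ⟨⟨hp.1, hpt⟩, mem_univ _⟩
    rw [indicator_of_mem hm]
    simp only [hθ, timeCutoff_of_le ((by norm_num : (-1 : ℝ) ≤ 0).trans hp.1) hpt, one_mul]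
    exact tendsto_const_nhds
  · rw [indicator_of_notMem fun h' => h'.1.2.not_gt hpt]
    refine tendsto_const_nhds.congr' ?_
    have : ∀ᶠ n : ℕ in atTop, 1 / ((n : ℝ) + 1) < p.1 - t :=
      tendsto_one_div_add_atTop_nhds_zero_nat.eventually_lt_const (sub_pos.2 hpt)
    filter_upwards [this] with n hn
    simp only [hθ]
    rw [timeCutoff_of_ge (by linarith), zero_mul]

end

section

variable {M : ℝ} {ω₀ : Plane → ℝ} {z₀ : Plane} {ω ω' : ℝ → Plane → ℝ} {z : ℝ → Plane}
  {C : ℝ≥0} {ρ : ℝ} {ψ : ℝ × Plane → ℝ}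

/-- The value at time `t` of `∫ ω ψ` prescribed by the weak formulation. -/
def weakValue (ω₀ : Plane → ℝ) (ω : ℝ → Plane → ℝ) (z : ℝ → Plane) (ψ : ℝ × Plane → ℝ)
    (t : ℝ) : ℝ :=
  (∫ x, ω₀ x * ψ (0, x)) + ∫ p in Icc 0 t ×ˢ univ, ω p.1 p.2 * advect ω z ψ p

lemma tendsto_average_of_ae_close {h : ℝ → ℝ} {t c : ℝ} (hi : IntegrableOn h (Icc t (t + 1)))
    (hc : ∀ ε > 0, ∃ δ > 0, ∀ᵐ σ, σ ∈ Ioo t (t + δ) → |h σ - c| ≤ ε) :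
    Tendsto (fun n : ℕ => (n + 1 : ℝ) * ∫ σ in Ioo t (t + 1 / (n + 1 : ℝ)), h σ) atTop (𝓝 c) := by
  rw [Metric.tendsto_nhds]
  intro ε hε
  obtain ⟨δ, hδ, hd⟩ := hc (ε / 2) (half_pos hε)
  have : ∀ᶠ n : ℕ in atTop, 1 / ((n : ℝ) + 1) < δ :=
    tendsto_one_div_add_atTop_nhds_zero_nat.eventually_lt_const hδ
  filter_upwards [this] with n hn
  have hn0 : (0 : ℝ) < n + 1 := by positivity
  have hsub : (1 : ℝ) / (n + 1) ≤ 1 := by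
    rw [div_le_one (by positivity)]; linarith [n.cast_nonneg (α := ℝ)]
  have hi' : IntegrableOn h (Ioo t (t + 1 / (n + 1 : ℝ))) :=
    hi.mono_set fun σ hσ => ⟨hσ.1.le, hσ.2.le.trans (by linarith)⟩
  have hvol : volume.real (Ioo t (t + 1 / (n + 1 : ℝ))) = 1 / (n + 1 : ℝ) := by
    rw [Real.volume_real_Ioo_of_le (by linarith [one_div_pos.2 hn0])]; ring
  have e : (n + 1 : ℝ) * ∫ σ in Ioo t (t + 1 / (n + 1 : ℝ)), h σ =
      c + (n + 1 : ℝ) * ∫ σ in Ioo t (t + 1 / (n + 1 : ℝ)), (h σ - c) := by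
    rw [integral_sub hi' (integrableOn_const (by simp)), setIntegral_const, hvol,
      smul_eq_mul]
    field_simp
    ring
  have hb : ‖∫ σ in Ioo t (t + 1 / (n + 1 : ℝ)), (h σ - c)‖ ≤ ε / 2 * (1 / (n + 1 : ℝ)) := by
    have hfin : volume (Ioo t (t + 1 / (n + 1 : ℝ))) < ∞ := measure_Ioo_lt_top
    have := norm_setIntegral_le_of_norm_le_const_ae' (f := fun σ => h σ - c) (C := ε / 2) hfin (by
      filter_upwards [hd] with σ hσ hm
      exact hσ ⟨hm.1, hm.2.trans (by linarith)⟩)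
    rwa [hvol] at this
  rw [e, dist_eq_norm, add_sub_cancel_left, norm_mul, Real.norm_of_nonneg hn0.le]
  calc (n + 1 : ℝ) * _ ≤ (n + 1) * (ε / 2 * (1 / (n + 1))) := by gcongr
    _ = ε / 2 := by field_simp
    _ < ε := half_lt_self hε

lemma setIntegral_prod_univ {F : ℝ × Plane → ℝ} {s : Set ℝ} (h : IntegrableOn F (s ×ˢ univ)) :
    ∫ p in s ×ˢ univ, F p = ∫ σ in s, ∫ x, F (σ, x) := by
  rw [Measure.volume_eq_prod] at h ⊢
  rw [setIntegral_prod _ h, Measure.restrict_univ]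

lemma integrableOn_integral_slice {F : ℝ × Plane → ℝ} {s : Set ℝ}
    (h : IntegrableOn F (s ×ˢ univ)) : IntegrableOn (fun σ => ∫ x, F (σ, x)) s := by
  rw [IntegrableOn, Measure.volume_eq_prod, ← Measure.prod_restrict, Measure.restrict_univ] at h
  exact h.integral_prod_left

lemma BddInt.abs_integral_mul_le {f g : Plane → ℝ} (h : BddInt M f) {b : ℝ}
    (hg : ∀ x, |g x| ≤ b) : |∫ x, f x * g x| ≤ M * b := by
  have hb : 0 ≤ b := (abs_nonneg _).trans (hg 0)
  rw [← Real.norm_eq_abs]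
  refine (norm_integral_le_of_norm_le (h.integrable.abs.mul_const b)
    (ae_of_all _ fun x => ?_)).trans ?_
  · rw [norm_mul]
    exact mul_le_mul_of_nonneg_left (hg x) (abs_nonneg _)
  · rw [integral_mul_const]
    exact mul_le_mul_of_nonneg_right h.integral_le hb

lemma BddInt.integrable_mul {f g : Plane → ℝ} (h : BddInt M f) {b : ℝ} (hm : Measurable g)
    (hg : ∀ x, |g x| ≤ b) : Integrable fun x => f x * g x :=
  h.integrable.mul_bdd (c := b) hm.aestronglyMeasurable (ae_of_all _ fun x => hg x)

lemma BddInt.abs_integral_slice_sub_le {f : Plane → ℝ} (h : BddInt M f) (hψ : IsTest C ρ ψ)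
    (σ t : ℝ) : |(∫ x, f x * ψ (σ, x)) - ∫ x, f x * ψ (t, x)| ≤ M * (C * |σ - t|) := by
  obtain ⟨B, hB⟩ := hψ.bounded
  rw [← integral_sub
    (h.integrable_mul (hψ.lipschitz_slice σ).continuous.measurable fun x => hB (σ, x))
    (h.integrable_mul (hψ.lipschitz_slice t).continuous.measurable fun x => hB (t, x))]
  simp_rw [← mul_sub]
  refine h.abs_integral_mul_le fun x => ?_
  have := hψ.lipschitz.dist_le_mul (σ, x) (t, x)
  rwa [dist_prod_same_right] at this

lemma IsTest.memLp_slice (h : IsTest C ρ ψ) (σ : ℝ) : MemLp (fun x => ψ (σ, x)) 2 volume :=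
  (h.lipschitz_slice σ).continuous.memLp_of_hasCompactSupport (h.hasCompactSupport_slice σ)

lemma IsBoundedSolution.tendsto_average_integral (h : IsBoundedSolution M ω₀ z₀ ω z)
    (hψ : IsTest C ρ ψ) {t : ℝ} (ht : 0 ≤ t) :
    Tendsto (fun n : ℕ => (n + 1 : ℝ) *
        ∫ σ in Ioo t (t + 1 / (n + 1 : ℝ)), ∫ x, ω σ x * ψ (σ, x)) atTop
      (𝓝 (weakValue ω₀ ω z ψ t)) := by
  refine (h.tendsto_average hψ ht).congr fun n => ?_
  congr 1
  refine setIntegral_prod_univ ?_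
  exact (integrableOn_mul_of_isTest h.measurable h.bddInt hψ t (t + 1 / (n + 1 : ℝ))).mono_set
    (prod_mono_left Ioo_subset_Icc_self)

/-- Every weakly continuous representative satisfies the weak formulation at all times. -/
lemma IsBoundedSolution.integral_representative (h : IsBoundedSolution M ω₀ z₀ ω z)
    (h' : IsContinuousRepresentative ω ω') (hψ : IsTest C ρ ψ) {t : ℝ} (ht : 0 ≤ t) :
    ∫ x, ω' t x * ψ (t, x) = weakValue ω₀ ω z ψ t := by
  refine tendsto_nhds_unique (tendsto_average_of_ae_close ?_ fun ε hε => ?_)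
    (h.tendsto_average_integral hψ ht)
  · exact integrableOn_integral_slice (integrableOn_mul_of_isTest h.measurable h.bddInt hψ t (t + 1))
  have hcont := h'.2.2 _ (hψ.memLp_slice t) (hψ.hasCompactSupport_slice t) t ht
  obtain ⟨δ, hδ, hd⟩ := Metric.continuousWithinAt_iff.1 hcont (ε / 2) (half_pos hε)
  have hM := (h.bddInt 0).nonneg
  refine ⟨min δ (ε / 2 / (M * C + 1)), by positivity, ?_⟩
  have hae := (ae_restrict_iff' measurableSet_Ici).1 h'.1
  filter_upwards [hae] with σ hσ hm
  have hσ0 : 0 ≤ σ := ht.trans hm.1.le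
  have hσt : |σ - t| = σ - t := abs_of_nonneg (sub_nonneg.2 hm.1.le)
  have h1 := hd (x := σ) hσ0 (by
    rw [Real.dist_eq, hσt]; linarith [hm.2, min_le_left δ (ε / 2 / (M * C + 1))])
  have h2 := (h.bddInt σ).abs_integral_slice_sub_le hψ σ t
  have h3 : ∫ x, ω' σ x * ψ (t, x) = ∫ x, ω σ x * ψ (t, x) := by
    refine integral_congr_ae ?_
    filter_upwards [hσ hσ0] with x hx
    rw [hx]
  rw [h3, Real.dist_eq] at h1
  have h4 : M * (C * |σ - t|) ≤ ε / 2 := by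
    have : |σ - t| ≤ ε / 2 / (M * C + 1) := by
      rw [hσt]; linarith [hm.2, min_le_right δ (ε / 2 / (M * C + 1))]
    have hp : 0 ≤ M * C := mul_nonneg hM C.2
    calc M * (C * |σ - t|) = (M * C) * |σ - t| := by ring
      _ ≤ (M * C + 1) * (ε / 2 / (M * C + 1)) := by gcongr; linarith
      _ = ε / 2 := by field_simp
  rw [abs_le] at h2 ⊢
  rw [abs_lt] at h1
  constructor <;> linarith [h1.1, h1.2, h2.1, h2.2]

/-! ### Existence of a weakly continuous representative -/

lemma BddInt.memLp_two {f : Plane → ℝ} (h : BddInt M f) : MemLp f 2 volume := by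
  rw [memLp_two_iff_integrable_sq h.measurable.aestronglyMeasurable]
  simp_rw [pow_two]
  exact h.integrable_mul h.measurable h.bound

lemma BddInt.norm_toLp_le {f : Plane → ℝ} (h : BddInt M f) : ‖h.memLp_two.toLp f‖ ≤ M := by
  have h1 : ‖h.memLp_two.toLp f‖ ^ 2 ≤ M ^ 2 := by
    rw [← real_inner_self_eq_norm_sq, L2.inner_def]
    have : ∫ x, inner ℝ (h.memLp_two.toLp f x) (h.memLp_two.toLp f x) = ∫ x, f x * f x := by
      refine integral_congr_ae ?_
      filter_upwards [h.memLp_two.coeFn_toLp] with x hx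
      rw [hx]; simp [pow_two]
    rw [this, pow_two]
    exact (le_abs_self _).trans (h.abs_integral_mul_le h.bound)
  exact (pow_le_pow_iff_left₀ (norm_nonneg _) h.nonneg two_ne_zero).1 h1

lemma inner_toLp {f g : Plane → ℝ} (hf : MemLp f 2 volume) (hg : MemLp g 2 volume) :
    inner ℝ (hf.toLp f) (hg.toLp g) = ∫ x, f x * g x := by
  rw [L2.inner_def]
  refine integral_congr_ae ?_
  filter_upwards [hf.coeFn_toLp, hg.coeFn_toLp] with x h1 h2
  rw [h1, h2]
  simp [mul_comm]

lemma exists_weak_limit {H : Type*} [NormedAddCommGroup H] [InnerProductSpace ℝ H]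
    [CompleteSpace H] {w : ℕ → H} (hw : ∀ n, ‖w n‖ ≤ M) :
    ∃ u : H, ‖u‖ ≤ M ∧ ∀ v c, Tendsto (fun n => inner ℝ (w n) v) atTop (𝓝 c) → inner ℝ u v = c := by
  have hK := WeakDual.isCompact_closedBall (𝕜 := ℝ) (E := H) 0 M
  let Λ : ℕ → WeakDual ℝ H := fun n =>
    StrongDual.toWeakDual (InnerProductSpace.toDual ℝ H (w n))
  have hmem : ∀ n, Λ n ∈ WeakDual.toStrongDual ⁻¹' Metric.closedBall (0 : StrongDual ℝ H) M := by
    intro n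
    simpa [Λ] using hw n
  obtain ⟨ℓ, hℓ, hlim⟩ := hK.ultrafilter_le_nhds ((hyperfilter ℕ : Ultrafilter ℕ).map Λ)
    (by simp only [le_principal_iff]
        exact Eventually.of_forall (f := (hyperfilter ℕ : Filter ℕ)) hmem)
  refine ⟨(InnerProductSpace.toDual ℝ H).symm (WeakDual.toStrongDual ℓ), ?_, fun v c hc => ?_⟩
  · simpa using hℓ
  · rw [InnerProductSpace.toDual_symm_apply]
    have h1 : Tendsto (fun n => Λ n v) (hyperfilter ℕ : Filter ℕ) (𝓝 (ℓ v)) :=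
      ((WeakDual.eval_continuous v).tendsto ℓ).comp hlim
    have h2 : Tendsto (fun n => Λ n v) (hyperfilter ℕ : Filter ℕ) (𝓝 c) := by
      have := hc.mono_left (Nat.hyperfilter_le_atTop)
      refine this.congr fun n => ?_
      simp [Λ]
    exact tendsto_nhds_unique h1 h2

end

section

variable {M : ℝ} {ω₀ : Plane → ℝ} {z₀ : Plane} {ω ω' : ℝ → Plane → ℝ} {z : ℝ → Plane}
  {C : ℝ≥0} {ρ : ℝ} {ψ : ℝ × Plane → ℝ}

/-- The average of the vorticity over the time interval `[t, t + 1 / (n + 1)]`. -/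
def avgVorticity (ω : ℝ → Plane → ℝ) (t : ℝ) (n : ℕ) (x : Plane) : ℝ :=
  (n + 1 : ℝ) * ∫ σ in Ioo t (t + 1 / (n + 1 : ℝ)), ω σ x

lemma integrable_restrict_prod (hω : Measurable fun p : ℝ × Plane => ω p.1 p.2)
    (hb : ∀ t, BddInt M (ω t)) {s : Set ℝ} (hs : volume s < ∞) :
    Integrable (fun p : ℝ × Plane => ω p.1 p.2) ((volume.restrict s).prod volume) := by
  have : IsFiniteMeasure (volume.restrict s) := ⟨by simpa using hs⟩
  rw [integrable_prod_iff hω.aestronglyMeasurable]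
  refine ⟨ae_of_all _ fun t => (hb t).integrable, ?_⟩
  refine Integrable.of_bound (hω.norm.stronglyMeasurable.integral_prod_right'
    (f := fun p : ℝ × Plane => ‖ω p.1 p.2‖)).aestronglyMeasurable M (ae_of_all _ fun t => ?_)
  rw [Real.norm_of_nonneg (integral_nonneg fun _ => norm_nonneg _)]
  exact (hb t).integral_le

lemma volume_real_Ioo_mul (t : ℝ) (n : ℕ) :
    (n + 1 : ℝ) * volume.real (Ioo t (t + 1 / (n + 1 : ℝ))) = 1 := by
  have hn0 : (0 : ℝ) < n + 1 := by positivity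
  rw [Real.volume_real_Ioo_of_le (by linarith [one_div_pos.2 hn0])]
  field_simp
  ring

lemma integral_avgVorticity_mul (hω : Measurable fun p : ℝ × Plane => ω p.1 p.2)
    (hb : ∀ t, BddInt M (ω t)) (t : ℝ) (n : ℕ) {φ : Plane → ℝ} (hφ : Measurable φ) {B : ℝ}
    (hB : ∀ x, |φ x| ≤ B) :
    ∫ x, avgVorticity ω t n x * φ x =
      (n + 1 : ℝ) * ∫ σ in Ioo t (t + 1 / (n + 1 : ℝ)), ∫ x, ω σ x * φ x := by
  have hi := (integrable_restrict_prod hω hb (s := Ioo t (t + 1 / (n + 1 : ℝ)))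
    measure_Ioo_lt_top).mul_bdd (c := B) (g := fun p : ℝ × Plane => φ p.2)
    (hφ.comp measurable_snd).aestronglyMeasurable (ae_of_all _ fun p => hB p.2)
  rw [integral_integral_swap hi]
  simp_rw [avgVorticity, mul_assoc]
  rw [integral_const_mul]
  simp_rw [integral_mul_const]

lemma bddInt_avgVorticity (hω : Measurable fun p : ℝ × Plane => ω p.1 p.2)
    (hb : ∀ t, BddInt M (ω t)) (t : ℝ) (n : ℕ) : BddInt M (avgVorticity ω t n) := by
  have hi := integrable_restrict_prod hω hb (s := Ioo t (t + 1 / (n + 1 : ℝ)))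
    measure_Ioo_lt_top
  have hn : (0 : ℝ) ≤ n + 1 := by positivity
  have hle : ∀ x, |avgVorticity ω t n x| ≤
      (n + 1 : ℝ) * ∫ σ in Ioo t (t + 1 / (n + 1 : ℝ)), |ω σ x| := fun x => by
    rw [avgVorticity, abs_mul, abs_of_nonneg hn]
    simp_rw [← Real.norm_eq_abs]
    exact mul_le_mul_of_nonneg_left (norm_integral_le_integral_norm _) hn
  have hint : Integrable fun x => ∫ σ in Ioo t (t + 1 / (n + 1 : ℝ)), |ω σ x| :=
    hi.abs.integral_prod_right
  have hmeas : Measurable (avgVorticity ω t n) :=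
    (hω.stronglyMeasurable.integral_prod_left' (μ := volume.restrict
      (Ioo t (t + 1 / (n + 1 : ℝ))))).measurable.const_mul _
  refine ⟨hmeas, fun x => ?_, (hint.const_mul _).mono' hmeas.aestronglyMeasurable
    (ae_of_all _ hle), ?_⟩
  · have hfin : volume (Ioo t (t + 1 / (n + 1 : ℝ))) < ∞ := measure_Ioo_lt_top
    have := norm_setIntegral_le_of_norm_le_const hfin (f := fun σ => ω σ x)
      fun σ _ => (hb σ).bound x
    rw [avgVorticity, abs_mul, abs_of_nonneg hn]
    calc _ ≤ (n + 1 : ℝ) * (M * volume.real (Ioo t (t + 1 / (n + 1 : ℝ)))) :=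
          mul_le_mul_of_nonneg_left this hn
      _ = M * ((n + 1 : ℝ) * volume.real (Ioo t (t + 1 / (n + 1 : ℝ)))) := by ring
      _ = M := by rw [volume_real_Ioo_mul, mul_one]
  · refine (integral_mono_of_nonneg (ae_of_all _ fun x => abs_nonneg _) (hint.const_mul _)
      (ae_of_all _ hle)).trans ?_
    rw [integral_const_mul, ← integral_integral_swap hi.abs]
    have hfin : volume (Ioo t (t + 1 / (n + 1 : ℝ))) < ∞ := measure_Ioo_lt_top
    have := norm_setIntegral_le_of_norm_le_const hfin (f := fun σ => ∫ x, |ω σ x|) (C := M)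
      fun σ _ => by
        rw [Real.norm_of_nonneg (integral_nonneg fun _ => abs_nonneg _)]; exact (hb σ).integral_le
    calc _ ≤ (n + 1 : ℝ) * (M * volume.real (Ioo t (t + 1 / (n + 1 : ℝ)))) :=
          mul_le_mul_of_nonneg_left ((le_abs_self _).trans this) hn
      _ = M * ((n + 1 : ℝ) * volume.real (Ioo t (t + 1 / (n + 1 : ℝ)))) := by ring
      _ = M := by rw [volume_real_Ioo_mul, mul_one]

lemma exists_isTest_of_smooth {φ : Plane → ℝ} (hφ : ContDiff ℝ ((⊤ : ℕ∞) : WithTop ℕ∞) φ)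
    (hc : HasCompactSupport φ) : ∃ C ρ, IsTest C ρ fun p : ℝ × Plane => φ p.2 := by
  obtain ⟨C, hC⟩ := hφ.lipschitzWith_of_hasCompactSupport hc (by simp)
  obtain ⟨B, hB⟩ := hc.exists_bound_of_continuous hφ.continuous
  obtain ⟨ρ, hρ⟩ := hc.isBounded.subset_ball 0
  refine ⟨C, ρ, ⟨?_, fun σ x hx => ?_, B, fun p => hB p.2⟩⟩
  · have := hC.comp (LipschitzWith.prod_snd (α := ℝ) (β := Plane))
    rwa [mul_one] at this
  · refine image_eq_zero_of_notMem_tsupport fun h => ?_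
    have := hρ h
    rw [mem_ball_zero_iff] at this
    exact this.not_ge hx

lemma IsBoundedSolution.exists_weak_value (h : IsBoundedSolution M ω₀ z₀ ω z) {t : ℝ}
    (ht : 0 ≤ t) : ∃ u : Lp ℝ 2 (volume : Measure Plane), ‖u‖ ≤ M ∧
      ∀ (φ : Plane → ℝ) (hφ : MemLp φ 2 volume) (C : ℝ≥0) (ρ : ℝ),
        IsTest C ρ (fun p : ℝ × Plane => φ p.2) →
        inner ℝ u (hφ.toLp φ) = weakValue ω₀ ω z (fun p => φ p.2) t := by
  have hb := bddInt_avgVorticity h.measurable h.bddInt t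
  obtain ⟨u, hu, hu'⟩ := exists_weak_limit (M := M) (w := fun n => (hb n).memLp_two.toLp _)
    fun n => (hb n).norm_toLp_le
  refine ⟨u, hu, fun φ hφ C ρ hT => hu' _ _ ?_⟩
  obtain ⟨B, hB⟩ := hT.bounded
  refine (h.tendsto_average_integral hT ht).congr fun n => ?_
  rw [inner_toLp]
  exact (integral_avgVorticity_mul h.measurable h.bddInt t n
    (hT.lipschitz_slice 0).continuous.measurable fun x => hB (0, x)).symm

lemma IsBoundedSolution.continuousOn_weakValue (h : IsBoundedSolution M ω₀ z₀ ω z)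
    (hψ : IsTest C ρ ψ) : ContinuousOn (weakValue ω₀ ω z ψ) (Ici 0) := by
  have hI := fun a b => integrableOn_mul_advect_of_isTest h.measurable h.bddInt h.continuous hψ a b
  have hg : ∀ a b, IntervalIntegrable (fun σ => ∫ x, ω σ x * advect ω z ψ (σ, x)) volume a b := by
    intro a b
    rw [intervalIntegrable_iff']
    exact integrableOn_integral_slice (hI _ _)
  have hc := (intervalIntegral.continuous_primitive hg 0).const_add (∫ x, ω₀ x * ψ (0, x))
  refine hc.continuousOn.congr fun t ht => ?_
  simp only
  rw [weakValue, setIntegral_prod_univ (hI 0 t), integral_Icc_eq_integral_Ioc,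
    intervalIntegral.integral_of_le ht]

lemma IsBoundedSolution.ae_integral_eq_weakValue (h : IsBoundedSolution M ω₀ z₀ ω z)
    (hψ : IsTest C ρ ψ) :
    ∀ᵐ t, 0 ≤ t → ∫ x, ω t x * ψ (t, x) = weakValue ω₀ ω z ψ t := by
  set g : ℝ → ℝ := fun σ => ∫ x, ω σ x * ψ (σ, x)
  have hg : LocallyIntegrable g := by
    rw [locallyIntegrable_iff]
    intro k hk
    obtain ⟨r, hr⟩ := hk.isBounded.subset_closedBall 0
    rw [Real.closedBall_eq_Icc] at hr
    exact (integrableOn_integral_slice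
      (integrableOn_mul_of_isTest h.measurable h.bddInt hψ _ _)).mono_set hr
  filter_upwards [LocallyIntegrable.ae_hasDerivAt_integral hg] with t htd ht
  refine tendsto_nhds_unique ?_ (h.tendsto_average_integral hψ ht)
  have h1 := (htd t).tendsto_slope_zero_right
  have h2 : Tendsto (fun n : ℕ => (1 : ℝ) / (n + 1)) atTop (𝓝[>] 0) :=
    tendsto_nhdsWithin_iff.2 ⟨tendsto_one_div_add_atTop_nhds_zero_nat,
      Eventually.of_forall fun n => mem_Ioi.2 (one_div_pos.2 (by positivity))⟩
  refine (h1.comp h2).congr fun n => ?_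
  have hn0 : (0 : ℝ) < n + 1 := by positivity
  simp only [Function.comp, intervalIntegral.integral_same, sub_zero, smul_eq_mul]
  have hle : t ≤ t + 1 / (n + 1 : ℝ) := by linarith [one_div_pos.2 hn0]
  rw [intervalIntegral.integral_of_le hle, integral_Ioc_eq_integral_Ioo, one_div, inv_inv]

theorem IsBoundedSolution.exists_representative (h : IsBoundedSolution M ω₀ z₀ ω z) :
    ∃ ω', IsContinuousRepresentative ω ω' := by
  classical
  have hex : ∀ t : ℝ, ∃ u : Lp ℝ 2 (volume : Measure Plane), ‖u‖ ≤ M ∧ (0 ≤ t →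
      ∀ (φ : Plane → ℝ) (hφ : MemLp φ 2 volume) (C : ℝ≥0) (ρ : ℝ),
        IsTest C ρ (fun p : ℝ × Plane => φ p.2) →
        inner ℝ u (hφ.toLp φ) = weakValue ω₀ ω z (fun p => φ p.2) t) := by
    intro t
    by_cases ht : 0 ≤ t
    · obtain ⟨u, hu⟩ := h.exists_weak_value ht
      exact ⟨u, hu.1, fun _ => hu.2⟩
    · exact ⟨0, by simpa using (h.bddInt 0).nonneg, fun h' => absurd h' ht⟩
  choose u huM hu using hex
  have hinner : ∀ t (φ : Plane → ℝ) (hφ : MemLp φ 2 volume),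
      ∫ x, u t x * φ x = inner ℝ (u t) (hφ.toLp φ) := by
    intro t φ hφ
    rw [← inner_toLp (Lp.memLp (u t)) hφ, Lp.toLp_coeFn]
  refine ⟨fun t => u t, ?_, fun t _ S _ => (Lp.memLp (u t)).restrict S, fun φ hφ _ => ?_⟩
  · have : Fact ((2 : ℝ≥0∞) ≠ ∞) := ⟨by simp⟩
    obtain ⟨S, hSD, hSc, hSd⟩ := (MeasureTheory.Lp.dense_hasCompactSupport_contDiff (F := ℝ)
      (μ := (volume : Measure Plane)) (p := 2) (by simp)).exists_countable_dense_subset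
    have hae : ∀ᵐ t : ℝ, ∀ f ∈ S, 0 ≤ t → inner ℝ (u t) f =
        inner ℝ ((h.bddInt t).memLp_two.toLp (ω t)) f := by
      refine (ae_ball_iff hSc).2 fun f hf => ?_
      obtain ⟨g, hfg, hgc, hgs⟩ := hSD hf
      obtain ⟨C, ρ, hT⟩ := exists_isTest_of_smooth hgs hgc
      have hg2 : MemLp g 2 volume := hgs.continuous.memLp_of_hasCompactSupport hgc
      have hf' : f = hg2.toLp g := by
        rw [← Lp.toLp_coeFn f (Lp.memLp f)]
        exact (MemLp.toLp_eq_toLp_iff _ _).2 hfg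
      filter_upwards [h.ae_integral_eq_weakValue hT] with t ht h0
      rw [hf', hu t h0 g hg2 C ρ hT, inner_toLp, ← ht h0]
    refine (ae_restrict_iff' measurableSet_Ici).2 ?_
    filter_upwards [hae] with t ht h0
    have heq : u t = (h.bddInt t).memLp_two.toLp (ω t) := by
      have : (fun f => inner ℝ (u t) f) = fun f =>
          inner ℝ ((h.bddInt t).memLp_two.toLp (ω t)) f :=
        Continuous.ext_on hSd (by fun_prop) (by fun_prop) fun f hf => ht f hf h0
      exact ext_inner_right ℝ fun f => congrFun this f
    rw [heq]
    exact MemLp.coeFn_toLp _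
  · simp_rw [hinner _ φ hφ]
    refine continuousOn_of_uniform_approx_of_continuousOn fun V hV => ?_
    obtain ⟨ε, hε, hV⟩ := Metric.mem_uniformity_dist.1 hV
    have hM := (h.bddInt 0).nonneg
    obtain ⟨f, hf, hd⟩ := Metric.dense_iff.1 (MeasureTheory.Lp.dense_hasCompactSupport_contDiff
      (F := ℝ) (μ := (volume : Measure Plane)) (p := 2) (by simp)) (hφ.toLp φ) (ε / (M + 1))
      (by positivity)
    obtain ⟨g, hfg, hgc, hgs⟩ := hd
    obtain ⟨C, ρ, hT⟩ := exists_isTest_of_smooth hgs hgc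
    have hg2 : MemLp g 2 volume := hgs.continuous.memLp_of_hasCompactSupport hgc
    have hf' : f = hg2.toLp g := by
      rw [← Lp.toLp_coeFn f (Lp.memLp f)]
      exact (MemLp.toLp_eq_toLp_iff _ _).2 hfg
    refine ⟨_, h.continuousOn_weakValue hT, fun t ht => hV ?_⟩
    rw [← hu t ht g hg2 C ρ hT, ← hf', dist_eq_norm, ← inner_sub_right]
    rw [mem_ball_iff_norm] at hf
    rw [norm_sub_rev] at hf
    calc _ ≤ ‖u t‖ * ‖hφ.toLp φ - f‖ := norm_inner_le_norm _ _
      _ ≤ M * (ε / (M + 1)) := mul_le_mul (huM t) hf.le (norm_nonneg _) hM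
      _ < (M + 1) * (ε / (M + 1)) := by gcongr; linarith
      _ = ε := by field_simp

end

section

variable {ω₀ : Plane → ℝ} {z₀ : Plane} {ω : ℝ → Plane → ℝ} {z : ℝ → Plane}

lemma abs_clip_le {M a : ℝ} (hM : 0 ≤ M) : |max (-M) (min M a)| ≤ M :=
  abs_le.2 ⟨le_max_left _ _, max_le (by linarith) (min_le_left _ _)⟩

lemma abs_clip_le_abs {M a : ℝ} (hM : 0 ≤ M) : |max (-M) (min M a)| ≤ |a| := by
  rcases le_total 0 a with h | h
  · rw [max_eq_right ((neg_nonpos.2 hM).trans (le_min hM h)), abs_of_nonneg (le_min hM h),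
      abs_of_nonneg h]
    exact min_le_right _ _
  · rw [min_eq_right (h.trans hM), abs_of_nonpos (max_le (by linarith) h), abs_of_nonpos h]
    linarith [le_max_right (-M) a]

lemma clip_eq_self {M a : ℝ} (h : |a| ≤ M) : max (-M) (min M a) = a := by
  rw [min_eq_right (abs_le.1 h).2, max_eq_right (abs_le.1 h).1]

lemma bddInt_zero {M : ℝ} (hM : 0 ≤ M) : BddInt M (fun _ => 0) :=
  ⟨measurable_const, fun _ => by simpa using hM, integrable_zero _ _ _, by simpa using hM⟩

lemma bddInt_clip {M : ℝ} (hM : 0 ≤ M) {g : Plane → ℝ} (hg : Measurable g)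
    (h : ∫⁻ x, ‖g x‖ₑ ≤ ENNReal.ofReal M) : BddInt M fun x => max (-M) (min M (g x)) := by
  have hm : Measurable fun x => max (-M) (min M (g x)) := by fun_prop
  have hgi : Integrable g := ⟨hg.aestronglyMeasurable, h.trans_lt ENNReal.ofReal_lt_top⟩
  refine ⟨hm, fun x => abs_clip_le hM, hgi.abs.mono' hm.aestronglyMeasurable
    (ae_of_all _ fun x => abs_clip_le_abs hM), ?_⟩
  refine (integral_mono_of_nonneg (ae_of_all _ fun _ => abs_nonneg _) hgi.abs
    (ae_of_all _ fun x => abs_clip_le_abs hM)).trans ?_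
  have : ∫ x, |g x| = (∫⁻ x, ‖g x‖ₑ).toReal := integral_norm_eq_lintegral_enorm hgi.1
  rw [this]
  exact ENNReal.toReal_le_of_le_ofReal hM h

theorem IsEulerianSolution.exists_isBoundedSolution (h : IsEulerianSolution ω₀ z₀ ω z) {M : ℝ}
    (hM : 0 ≤ M) (hb : ∀ᵐ t ∂(volume.restrict (Ici (0 : ℝ))),
      eLpNorm (ω t) 1 volume ≤ ENNReal.ofReal M ∧ eLpNorm (ω t) ∞ volume ≤ ENNReal.ofReal M) :
    ∃ (ω' : ℝ → Plane → ℝ) (z' : ℝ → Plane), IsBoundedSolution M ω₀ z₀ ω' z' ∧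
      (∀ᵐ t ∂(volume.restrict (Ici (0 : ℝ))), ω' t =ᵐ[volume] ω t) ∧ ∀ t, 0 ≤ t → z' t = z t := by
  classical
  have hsm := h.vorticity_mem.1
  set g := hsm.mk _ with hg
  have hgm : Measurable g := hsm.stronglyMeasurable_mk.measurable
  have hgω : ∀ᵐ t ∂(volume.restrict (Ici (0 : ℝ))), ∀ᵐ x, ω t x = g (t, x) :=
    Measure.ae_ae_of_ae_prod hsm.ae_eq_mk
  set G : Set ℝ := {t | 0 ≤ t ∧ ∫⁻ x, ‖g (t, x)‖ₑ ≤ ENNReal.ofReal M} with hG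
  have hGm : MeasurableSet G := by
    have : Measurable fun t => ∫⁻ x, ‖g (t, x)‖ₑ := hgm.enorm.lintegral_prod_right'
    exact measurableSet_Ici.inter (measurableSet_le this measurable_const)
  set ω' : ℝ → Plane → ℝ := fun t x => if t ∈ G then max (-M) (min M (g (t, x))) else 0 with hω'
  have hω'm : Measurable fun p : ℝ × Plane => ω' p.1 p.2 :=
    Measurable.ite (measurable_fst hGm) (by fun_prop) measurable_const
  have hω'b : ∀ t, BddInt M (ω' t) := by
    intro t
    by_cases ht : t ∈ G
    · simp only [hω', if_pos ht]
      exact bddInt_clip hM (hgm.comp measurable_prodMk_left) ht.2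
    · simp only [hω', if_neg ht]
      exact bddInt_zero hM
  have hae : ∀ᵐ t ∂(volume.restrict (Ici (0 : ℝ))), ω' t =ᵐ[volume] ω t := by
    filter_upwards [hgω, hb, ae_restrict_mem measurableSet_Ici] with t h1 h2 h3
    have ht : t ∈ G := by
      refine ⟨h3, ?_⟩
      rw [← lintegral_congr_ae (h1.mono fun x hx => by simp only [hx] : (fun x => ‖ω t x‖ₑ) =ᵐ[volume]
        fun x => ‖g (t, x)‖ₑ), ← eLpNorm_one_eq_lintegral_enorm]
      exact h2.1
    have h4 : ∀ᵐ x, ‖ω t x‖ₑ ≤ ENNReal.ofReal M := by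
      filter_upwards [ae_le_eLpNormEssSup (f := ω t) (μ := volume)] with x hx
      exact hx.trans (by simpa [eLpNorm_exponent_top] using h2.2)
    filter_upwards [h1, h4] with x hx hx'
    simp only [hω', if_pos ht]
    rw [← hx, clip_eq_self]
    rwa [Real.enorm_eq_ofReal_abs, ENNReal.ofReal_le_ofReal_iff hM] at hx'
  have hvel : ∀ᵐ t ∂(volume.restrict (Ici (0 : ℝ))), velocity (ω' t) = velocity (ω t) := by
    filter_upwards [hae] with t ht
    ext1 x
    refine integral_congr_ae ?_
    filter_upwards [ht] with y hy
    rw [hy]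
  refine ⟨ω', fun t => z (max t 0), ⟨hω'm, hω'b, ?_, ?_, ?_, ?_⟩, hae, fun t ht => by
    simp only [max_eq_left ht]⟩
  · rw [← continuousOn_univ]
    exact h.trajectory_continuous.comp (by fun_prop) fun t _ => le_max_right t 0
  · exact (memLp_one_iff_integrable.1 h.initial_memL1)
  · intro ψ hψ hc
    rw [h.transport ψ hψ hc]
    refine integral_congr_ae ?_
    filter_upwards [hae, hvel, ae_restrict_mem measurableSet_Ici] with t h1 h2 h3
    refine integral_congr_ae ?_
    filter_upwards [h1] with x hx
    have h3' : max t 0 = t := max_eq_left h3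
    simp only [field, hx, h2, h3']
    rw [← map_add]
    simp
  · intro t ht
    rw [max_eq_left ht, h.trajectory t ht]
    congr 1
    rw [intervalIntegral.integral_of_le ht, intervalIntegral.integral_of_le ht]
    refine setIntegral_congr_ae measurableSet_Ioc ?_
    filter_upwards [(ae_restrict_iff' measurableSet_Ici).1 hvel] with s hs hst
    rw [hs hst.1.le, max_eq_left hst.1.le]

end

/-! ### The velocity field is divergence free -/

section DivFree

lemma regKernel_apply_zero (ε : ℝ) (y : Plane) :
    regKernel ε y 0 = -((2 * Real.pi * (max ‖y‖ ε) ^ 2)⁻¹ * y 1) := by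
  simp [regKernel, perp]

lemma regKernel_apply_one (ε : ℝ) (y : Plane) :
    regKernel ε y 1 = (2 * Real.pi * (max ‖y‖ ε) ^ 2)⁻¹ * y 0 := by
  simp [regKernel, perp]

lemma norm_sq_add_smul_zero (y : Plane) (s : ℝ) :
    ‖y + s • EuclideanSpace.single (0 : Fin 2) (1 : ℝ)‖ ^ 2 = (y 0 + s) ^ 2 + (y 1) ^ 2 := by
  simp [EuclideanSpace.norm_sq_eq, Fin.sum_univ_two]

lemma norm_sq_add_smul_one (y : Plane) (s : ℝ) :
    ‖y + s • EuclideanSpace.single (1 : Fin 2) (1 : ℝ)‖ ^ 2 = (y 0) ^ 2 + (y 1 + s) ^ 2 := by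
  simp [EuclideanSpace.norm_sq_eq, Fin.sum_univ_two]

/-- Away from the circle of radius `ε`, the truncated kernel has zero divergence. -/
lemma div_regKernel {ε : ℝ} (hε : 0 < ε) {y : Plane} (hy : ‖y‖ ≠ ε) :
    lineDeriv ℝ (fun y => regKernel ε y 0) y (EuclideanSpace.single (0 : Fin 2) (1 : ℝ)) +
      lineDeriv ℝ (fun y => regKernel ε y 1) y (EuclideanSpace.single (1 : Fin 2) (1 : ℝ)) = 0 := by
  have hc : ∀ v : Plane, Tendsto (fun s : ℝ => ‖y + s • v‖) (𝓝 0) (𝓝 ‖y‖) := fun v => by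
    have : Continuous fun s : ℝ => ‖y + s • v‖ := by fun_prop
    simpa using this.tendsto 0
  rcases lt_or_gt_of_ne hy with h | h
  · have e0 : lineDeriv ℝ (fun y => regKernel ε y 0) y
        (EuclideanSpace.single (0 : Fin 2) (1 : ℝ)) = 0 := by
      refine HasDerivAt.deriv ((hasDerivAt_const (0 : ℝ)
        (-((2 * Real.pi * ε ^ 2)⁻¹ * y 1))).congr_of_eventuallyEq ?_)
      filter_upwards [(hc (EuclideanSpace.single (0 : Fin 2) (1 : ℝ))).eventually_lt_const h]
        with s hs
      rw [regKernel_apply_zero, max_eq_right hs.le]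
      simp
    have e1 : lineDeriv ℝ (fun y => regKernel ε y 1) y
        (EuclideanSpace.single (1 : Fin 2) (1 : ℝ)) = 0 := by
      refine HasDerivAt.deriv ((hasDerivAt_const (0 : ℝ)
        ((2 * Real.pi * ε ^ 2)⁻¹ * y 0)).congr_of_eventuallyEq ?_)
      filter_upwards [(hc (EuclideanSpace.single (1 : Fin 2) (1 : ℝ))).eventually_lt_const h]
        with s hs
      rw [regKernel_apply_one, max_eq_right hs.le]
      simp
    rw [e0, e1, add_zero]
  · have hr : (y 0) ^ 2 + (y 1) ^ 2 ≠ 0 := by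
      have h1 := norm_sq_add_smul_zero y 0
      simp only [zero_smul, add_zero] at h1
      rw [← h1]
      have := hε.trans h
      positivity
    have hπ := Real.pi_pos.ne'
    have e0 : lineDeriv ℝ (fun y => regKernel ε y 0) y
        (EuclideanSpace.single (0 : Fin 2) (1 : ℝ)) =
        2 * (y 0) * (y 1) / (2 * Real.pi * ((y 0) ^ 2 + (y 1) ^ 2) ^ 2) := by
      have hd : HasDerivAt (fun s : ℝ => -((2 * Real.pi * ((y 0 + s) ^ 2 + (y 1) ^ 2))⁻¹ * y 1))
          (2 * (y 0) * (y 1) / (2 * Real.pi * ((y 0) ^ 2 + (y 1) ^ 2) ^ 2)) 0 := by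
        have h1 : HasDerivAt (fun s : ℝ => 2 * Real.pi * ((y 0 + s) ^ 2 + (y 1) ^ 2))
            (2 * Real.pi * (2 * y 0)) 0 := by
          have := ((((hasDerivAt_id (0 : ℝ)).const_add (y 0)).pow 2).add_const
            ((y 1) ^ 2)).const_mul (2 * Real.pi)
          simpa using this
        have h2 := ((h1.inv (by simpa using hr)).mul_const (y 1)).neg
        refine h2.congr_deriv ?_
        simp only [add_zero]
        field_simp
      refine HasDerivAt.deriv (hd.congr_of_eventuallyEq ?_)
      filter_upwards [(hc (EuclideanSpace.single (0 : Fin 2) (1 : ℝ))).eventually_const_lt h]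
        with s hs
      rw [regKernel_apply_zero, max_eq_left hs.le, norm_sq_add_smul_zero]
      simp
    have e1 : lineDeriv ℝ (fun y => regKernel ε y 1) y
        (EuclideanSpace.single (1 : Fin 2) (1 : ℝ)) =
        -(2 * (y 0) * (y 1) / (2 * Real.pi * ((y 0) ^ 2 + (y 1) ^ 2) ^ 2)) := by
      have hd : HasDerivAt (fun s : ℝ => (2 * Real.pi * ((y 0) ^ 2 + (y 1 + s) ^ 2))⁻¹ * y 0)
          (-(2 * (y 0) * (y 1) / (2 * Real.pi * ((y 0) ^ 2 + (y 1) ^ 2) ^ 2))) 0 := by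
        have h1 : HasDerivAt (fun s : ℝ => 2 * Real.pi * ((y 0) ^ 2 + (y 1 + s) ^ 2))
            (2 * Real.pi * (2 * y 1)) 0 := by
          have := ((((hasDerivAt_id (0 : ℝ)).const_add (y 1)).pow 2).const_add
            ((y 0) ^ 2)).const_mul (2 * Real.pi)
          simpa using this
        have h2 := (h1.inv (by simpa using hr)).mul_const (y 0)
        refine h2.congr_deriv ?_
        simp only [add_zero]
        field_simp
      refine HasDerivAt.deriv (hd.congr_of_eventuallyEq ?_)
      filter_upwards [(hc (EuclideanSpace.single (1 : Fin 2) (1 : ℝ))).eventually_const_lt h]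
        with s hs
      rw [regKernel_apply_one, max_eq_left hs.le, norm_sq_add_smul_one]
      simp
    rw [e0, e1, add_neg_cancel]

variable {φ : Plane → ℝ} {C : ℝ≥0}

lemma lipschitzWith_regKernel_apply {ε : ℝ} (hε : 0 < ε) (w : Plane) (i : Fin 2) :
    LipschitzWith (Real.toNNReal (3 * (2 * Real.pi)⁻¹ * (ε ^ 2)⁻¹))
      fun x => regKernel ε (x - w) i := by
  refine LipschitzWith.of_dist_le_mul fun x y => ?_
  have h1 := (lipschitzWith_regKernel hε).dist_le_mul (x - w) (y - w)
  rw [dist_sub_right] at h1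
  refine le_trans ?_ h1
  rw [dist_eq_norm, dist_eq_norm]
  exact PiLp.norm_apply_le (regKernel ε (x - w) - regKernel ε (y - w)) i

lemma integrable_fderiv_apply (hφ : LipschitzWith C φ) (hc : HasCompactSupport φ)
    {V : Plane → Plane} (hV : Measurable V) (hVi : LocallyIntegrable V) :
    Integrable fun x => fderiv ℝ φ x (V x) := by
  have hm : Measurable fun x => fderiv ℝ φ x (V x) :=
    isBoundedBilinearMap_apply.continuous.measurable.comp ((measurable_fderiv ℝ φ).prodMk hV)
  have hi : Integrable ((tsupport φ).indicator fun x => C * ‖V x‖) := by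
    rw [integrable_indicator_iff (isClosed_tsupport φ).measurableSet]
    exact ((hVi.integrableOn_isCompact hc).norm).const_mul _
  refine hi.mono' hm.aestronglyMeasurable (ae_of_all _ fun x => ?_)
  by_cases hx : x ∈ tsupport φ
  · rw [indicator_of_mem hx]
    exact ((fderiv ℝ φ x).le_opNorm _).trans
      (mul_le_mul_of_nonneg_right (norm_fderiv_le_of_lipschitz ℝ hφ) (norm_nonneg _))
  · have : fderiv ℝ φ x = 0 := by
      by_contra hne
      exact hx (support_fderiv_subset ℝ hne)
    simp [this, indicator_of_notMem hx]

lemma locallyIntegrable_regKernel (ε : ℝ) : LocallyIntegrable (regKernel ε) := by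
  rw [locallyIntegrable_iff]
  intro k hk
  obtain ⟨r, hr⟩ := hk.isBounded.subset_ball 0
  have h : IntegrableOn (fun x : Plane => (2 * Real.pi)⁻¹ * ‖x‖⁻¹) (Metric.ball 0 r) :=
    (integrableOn_inv_norm r).const_mul _
  exact (h.mono_set hr).mono' (measurable_regKernel ε).aestronglyMeasurable
    (ae_of_all _ fun x => norm_regKernel_le ε x)

lemma locallyIntegrable_regKernel_sub (ε : ℝ) (w : Plane) :
    LocallyIntegrable fun x => regKernel ε (x - w) := by
  rw [locallyIntegrable_iff]
  intro k hk
  have h1 := (locallyIntegrable_regKernel ε).integrableOn_isCompact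
    (hk.image (by fun_prop : Continuous fun x => x - w))
  have h2 := (measurePreserving_sub_right volume w).integrableOn_comp_preimage
    (MeasurableEquiv.subRight w).measurableEmbedding (f := regKernel ε)
    (s := (fun x => x - w) '' k)
  exact (h2.2 h1).mono_set (subset_preimage_image _ _)

lemma integral_fderiv_regKernel_of_pos (hφ : LipschitzWith C φ) (hc : HasCompactSupport φ)
    {ε : ℝ} (hε : 0 < ε) (w : Plane) : ∫ x, fderiv ℝ φ x (regKernel ε (x - w)) = 0 := by
  set e : Fin 2 → Plane := fun i => EuclideanSpace.single i (1 : ℝ) with he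
  have hL := fun i => lipschitzWith_regKernel_apply hε w i
  have hlin : ∀ i, ∫ x, lineDeriv ℝ φ x (e i) * regKernel ε (x - w) i =
      -∫ x, lineDeriv ℝ (fun x => regKernel ε (x - w) i) x (e i) * φ x := by
    intro i
    rw [(hL i).integral_lineDeriv_mul_eq hφ hc (e i), ← integral_neg]
    simp_rw [lineDeriv_neg, neg_mul, neg_neg]
  have hint1 : ∀ i, Integrable fun x => lineDeriv ℝ φ x (e i) * regKernel ε (x - w) i := by
    intro i
    have h1 := integrable_fderiv_apply hφ hc (V := fun x => regKernel ε (x - w) i • e i)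
      (((hL i).continuous.smul continuous_const).measurable)
      (((hL i).continuous.smul continuous_const).locallyIntegrable)
    refine h1.congr ?_
    filter_upwards [hφ.ae_differentiableAt (μ := volume)] with x hx
    rw [map_smul, smul_eq_mul, hx.lineDeriv_eq_fderiv, mul_comm]
  have hint2 : ∀ i, Integrable fun x =>
      lineDeriv ℝ (fun x => regKernel ε (x - w) i) x (e i) * φ x := fun i =>
    (hφ.continuous.integrable_of_hasCompactSupport hc).bdd_mul
      (c := Real.toNNReal (3 * (2 * Real.pi)⁻¹ * (ε ^ 2)⁻¹) * ‖e i‖)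
      (aestronglyMeasurable_lineDeriv (hL i).continuous _)
      (ae_of_all _ fun x => norm_lineDeriv_le_of_lipschitz ℝ (hL i))
  have h1 : ∫ x, fderiv ℝ φ x (regKernel ε (x - w)) =
      ∑ i, ∫ x, lineDeriv ℝ φ x (e i) * regKernel ε (x - w) i := by
    rw [← integral_finsetSum _ fun i _ => hint1 i]
    refine integral_congr_ae ?_
    filter_upwards [hφ.ae_differentiableAt (μ := volume)] with x hx
    have : regKernel ε (x - w) = ∑ i, regKernel ε (x - w) i • e i := by
      ext j
      fin_cases j <;> simp [he, Fin.sum_univ_two]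
    conv_lhs => rw [this]
    simp only [map_sum, map_smul, smul_eq_mul]
    exact Finset.sum_congr rfl fun i _ => by rw [hx.lineDeriv_eq_fderiv, mul_comm]
  rw [h1]
  simp_rw [hlin]
  rw [Finset.sum_neg_distrib, ← integral_finsetSum _ fun i _ => hint2 i, neg_eq_zero]
  refine integral_eq_zero_of_ae ?_
  have hsph : ∀ᵐ x : Plane, ‖x - w‖ ≠ ε := by
    have : volume (Metric.sphere w ε) = 0 := Measure.addHaar_sphere volume w ε
    have h2 := measure_eq_zero_iff_ae_notMem.1 this
    filter_upwards [h2] with x hx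
    simpa [dist_eq_norm] using hx
  filter_upwards [hsph] with x hx
  have hsh : ∀ i, lineDeriv ℝ (fun x => regKernel ε (x - w) i) x (e i) =
      lineDeriv ℝ (fun y => regKernel ε y i) (x - w) (e i) := by
    intro i
    have : (fun s : ℝ => regKernel ε (x + s • e i - w) i) =
        fun s => regKernel ε (x - w + s • e i) i := by
      ext s
      rw [add_sub_right_comm]
    rw [lineDeriv, this, lineDeriv]
  have := div_regKernel hε hx
  simp only [Fin.sum_univ_two, hsh, Pi.zero_apply]
  rw [← add_mul, this, zero_mul]

lemma integral_fderiv_regKernel_zero (hφ : LipschitzWith C φ) (hc : HasCompactSupport φ)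
    (w : Plane) : ∫ x, fderiv ℝ φ x (regKernel 0 (x - w)) = 0 := by
  have hi : ∀ ε, Integrable fun x => fderiv ℝ φ x (regKernel ε (x - w)) := fun ε =>
    integrable_fderiv_apply hφ hc
    ((measurable_regKernel ε).comp (measurable_id.sub measurable_const))
    (locallyIntegrable_regKernel_sub ε w)
  rw [← norm_le_zero_iff]
  refine le_of_forall_pos_le_add fun η hη => ?_
  set ε := η / (C + 1) with hεd
  have hε : 0 < ε := by positivity
  set b : Plane → ℝ :=
    (Metric.ball (0 : Plane) ε).indicator (fun x => (2 * Real.pi)⁻¹ * ‖x‖⁻¹) with hb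
  have hbi : Integrable b := by
    rw [hb, integrable_indicator_iff measurableSet_ball]
    exact (integrableOn_inv_norm ε).const_mul _
  have h1 : ∫ x, fderiv ℝ φ x (regKernel 0 (x - w)) =
      ∫ x, (fderiv ℝ φ x (regKernel 0 (x - w)) - fderiv ℝ φ x (regKernel ε (x - w))) := by
    rw [integral_sub (hi 0) (hi ε), integral_fderiv_regKernel_of_pos hφ hc hε w, sub_zero]
  rw [h1, zero_add]
  refine (norm_integral_le_of_norm_le ((hbi.comp_sub_right w).const_mul (C : ℝ))
    (ae_of_all _ fun x => ?_)).trans ?_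
  · rw [← map_sub]
    exact ((fderiv ℝ φ x).le_opNorm _).trans (mul_le_mul (norm_fderiv_le_of_lipschitz ℝ hφ)
      (norm_regKernel_sub_regKernel_le hε.le _) (norm_nonneg _) C.2)
  · rw [integral_const_mul, integral_sub_right_eq_self b w, hb,
      integral_indicator measurableSet_ball, integral_const_mul, integral_inv_norm_ball hε.le,
      inv_two_pi_mul_two_pi, hεd]
    calc (C : ℝ) * (η / (C + 1)) ≤ (C + 1) * (η / (C + 1)) := by gcongr; linarith
      _ = η := by field_simp

lemma integral_fderiv_vel_zero {M : ℝ} {f : Plane → ℝ} (h : BddInt M f) (hφ : LipschitzWith C φ)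
    (hc : HasCompactSupport φ) : ∫ x, fderiv ℝ φ x (vel 0 f x) = 0 := by
  have hsupp : ∀ x, x ∉ tsupport φ → fderiv ℝ φ x = 0 := fun x hx => by
    by_contra hne
    exact hx (support_fderiv_subset ℝ hne)
  have hFm : Measurable fun q : Plane × Plane => f q.2 * fderiv ℝ φ q.1 (regKernel 0 (q.1 - q.2)) :=
    (h.measurable.comp measurable_snd).mul (isBoundedBilinearMap_apply.continuous.measurable.comp
      (((measurable_fderiv ℝ φ).comp measurable_fst).prodMk
        ((measurable_regKernel 0).comp (measurable_fst.sub measurable_snd))))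
  have hbound : ∀ x y, ‖f y * fderiv ℝ φ x (regKernel 0 (x - y))‖ ≤
      C * (|f y| * ((2 * Real.pi)⁻¹ * ‖x - y‖⁻¹)) := by
    intro x y
    rw [norm_mul, mul_left_comm]
    refine mul_le_mul_of_nonneg_left ?_ (abs_nonneg _)
    exact ((fderiv ℝ φ x).le_opNorm _).trans (mul_le_mul (norm_fderiv_le_of_lipschitz ℝ hφ)
      (norm_regKernel_le 0 _) (norm_nonneg _) C.2)
  have hslice : ∀ x, Integrable fun y => f y * fderiv ℝ φ x (regKernel 0 (x - y)) := fun x =>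
    ((h.integral_inv_norm x).1.const_mul (C : ℝ)).mono'
      (hFm.comp measurable_prodMk_left).aestronglyMeasurable (ae_of_all _ (hbound x))
  have hint : Integrable (fun q : Plane × Plane =>
      f q.2 * fderiv ℝ φ q.1 (regKernel 0 (q.1 - q.2))) (volume.prod volume) := by
    rw [integrable_prod_iff hFm.aestronglyMeasurable]
    refine ⟨ae_of_all _ hslice, ?_⟩
    have hi : Integrable ((tsupport φ).indicator fun _ : Plane => C * (2 * M)) := by
      rw [integrable_indicator_iff (isClosed_tsupport φ).measurableSet]
      exact integrableOn_const hc.measure_lt_top.ne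
    refine hi.mono' (hFm.norm.stronglyMeasurable.integral_prod_right').aestronglyMeasurable
      (ae_of_all _ fun x => ?_)
    rw [Real.norm_of_nonneg (integral_nonneg fun _ => norm_nonneg _)]
    by_cases hx : x ∈ tsupport φ
    · rw [indicator_of_mem hx]
      refine (integral_mono (hslice x).norm ((h.integral_inv_norm x).1.const_mul (C : ℝ))
        (hbound x)).trans ?_
      rw [integral_const_mul]
      exact mul_le_mul_of_nonneg_left (h.integral_inv_norm x).2 C.2
    · simp [hsupp x hx, indicator_of_notMem hx]
  have h1 : ∀ x, fderiv ℝ φ x (vel 0 f x) = ∫ y, f y * fderiv ℝ φ x (regKernel 0 (x - y)) := by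
    intro x
    rw [vel, ← ContinuousLinearMap.integral_comp_comm _ (h.integrable_smul_regKernel 0 x)]
    simp_rw [map_smul, smul_eq_mul]
  simp_rw [h1]
  rw [integral_integral_swap hint]
  refine integral_eq_zero_of_ae (ae_of_all _ fun y => ?_)
  simp only [Pi.zero_apply]
  rw [integral_const_mul, integral_fderiv_regKernel_zero hφ hc y, mul_zero]

end DivFree

section

variable {M : ℝ} {ω₀ : Plane → ℝ} {z₀ : Plane} {ω ω' : ℝ → Plane → ℝ} {z : ℝ → Plane}
  {C : ℝ≥0} {ρ : ℝ} {ψ : ℝ × Plane → ℝ} {s t : ℝ}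

lemma ae_slice_differentiableAt (hψ : LipschitzWith C ψ) :
    (∀ᵐ σ : ℝ, ∀ᵐ x : Plane, DifferentiableAt ℝ ψ (σ, x)) ∧
      ∀ᵐ x : Plane, ∀ᵐ σ : ℝ, DifferentiableAt ℝ ψ (σ, x) := by
  have h := hψ.ae_differentiableAt (μ := (volume : Measure (ℝ × Plane)))
  have hm : MeasurableSet {p : ℝ × Plane | DifferentiableAt ℝ ψ (p.1, p.2)} :=
    measurableSet_of_differentiableAt ℝ ψ
  rw [Measure.volume_eq_prod] at h
  have h1 : ∀ᵐ σ : ℝ, ∀ᵐ x : Plane, DifferentiableAt ℝ ψ (σ, x) := Measure.ae_ae_of_ae_prod h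
  exact ⟨h1, (Measure.ae_ae_comm hm).1 h1⟩

lemma IsTest.integrableOn_fderiv_time (h : IsTest C ρ ψ) (s t : ℝ) :
    IntegrableOn (fun p => fderiv ℝ ψ p (1, 0)) (Icc s t ×ˢ univ) := by
  have hK : IsCompact (Icc s t ×ˢ Metric.closedBall (0 : Plane) ρ) :=
    isCompact_Icc.prod (isCompact_closedBall _ _)
  have : Integrable ((Icc s t ×ˢ Metric.closedBall (0 : Plane) ρ).indicator
      fun _ => (C : ℝ) * ‖((1 : ℝ), (0 : Plane))‖) := by
    rw [integrable_indicator_iff hK.measurableSet]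
    exact integrableOn_const hK.measure_lt_top.ne
  refine this.integrableOn.mono' (measurable_fderiv_apply_const ℝ ψ _).aestronglyMeasurable ?_
  filter_upwards [ae_restrict_mem (measurableSet_Icc.prod MeasurableSet.univ)] with p hp
  by_cases hx : p.2 ∈ Metric.closedBall (0 : Plane) ρ
  · have hm : p ∈ Icc s t ×ˢ Metric.closedBall (0 : Plane) ρ := ⟨hp.1, hx⟩
    rw [indicator_of_mem hm]
    exact ((fderiv ℝ ψ p).le_opNorm _).trans
      (mul_le_mul_of_nonneg_right (norm_fderiv_le_of_lipschitz ℝ h.lipschitz) (norm_nonneg _))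
  · have : fderiv ℝ ψ p = 0 := by
      by_contra hne
      exact hx (h.tsupport_subset (support_fderiv_subset ℝ hne)).2
    rw [indicator_of_notMem fun h' => hx h'.2, this]
    simp

lemma IsTest.integral_fderiv_time (h : IsTest C ρ ψ) (hst : s ≤ t) :
    ∫ p in Icc s t ×ˢ univ, fderiv ℝ ψ p (1, 0) = (∫ x, ψ (t, x)) - ∫ x, ψ (s, x) := by
  have hi := h.integrableOn_fderiv_time s t
  have hi' : Integrable (fun p : ℝ × Plane => fderiv ℝ ψ (p.1, p.2) (1, 0))
      ((volume.restrict (Icc s t)).prod volume) := by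
    rwa [IntegrableOn, Measure.volume_eq_prod, ← Measure.prod_restrict,
      Measure.restrict_univ] at hi
  rw [setIntegral_prod_univ hi, integral_integral_swap hi', ← integral_sub
    ((h.lipschitz_slice t).continuous.integrable_of_hasCompactSupport
      (h.hasCompactSupport_slice t))
    ((h.lipschitz_slice s).continuous.integrable_of_hasCompactSupport
      (h.hasCompactSupport_slice s))]
  refine integral_congr_ae ?_
  filter_upwards [(ae_slice_differentiableAt h.lipschitz).2] with x hx
  have hL : LipschitzWith C fun σ => ψ (σ, x) := by
    refine LipschitzWith.of_dist_le_mul fun a b => ?_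
    have := h.lipschitz.dist_le_mul (a, x) (b, x)
    rwa [dist_prod_same_right] at this
  have hac := (hL.lipschitzOnWith (s := uIcc s t)).absolutelyContinuousOnInterval
  rw [← hac.integral_deriv_eq_sub, intervalIntegral.integral_of_le hst,
    integral_Icc_eq_integral_Ioc]
  refine integral_congr_ae (ae_restrict_of_ae ?_)
  filter_upwards [hx] with σ hσ
  have e : HasDerivAt (fun σ : ℝ => (σ, x)) ((1 : ℝ), (0 : Plane)) σ :=
    (hasDerivAt_id σ).prodMk (hasDerivAt_const σ x)
  exact (hσ.hasFDerivAt.comp_hasDerivAt σ e).deriv.symm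

lemma measurable_vel_slice (hω : Measurable fun p : ℝ × Plane => ω p.1 p.2) (ε σ : ℝ) :
    Measurable (vel ε (ω σ)) :=
  (measurable_vel hω ε).comp measurable_prodMk_left

lemma IsTest.integral_advect (hψ : IsTest C ρ ψ)
    (hω : Measurable fun p : ℝ × Plane => ω p.1 p.2) (hb : ∀ t, BddInt M (ω t))
    (hz : Continuous z) (hst : s ≤ t) :
    ∫ p in Icc s t ×ˢ univ, advect ω z ψ p = (∫ x, ψ (t, x)) - ∫ x, ψ (s, x) := by
  have hsplit : ∀ p, advect ω z ψ p - fderiv ℝ ψ p (1, 0) = fderiv ℝ ψ p (0, field ω z p) := by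
    intro p
    rw [advect, ← map_sub]
    simp
  have hi1 := integrableOn_advect_of_isTest hω hb hz hψ s t
  have hi2 := hψ.integrableOn_fderiv_time s t
  rw [← hψ.integral_fderiv_time hst, ← sub_eq_zero, ← integral_sub hi1 hi2]
  have hi3 : IntegrableOn (fun p => advect ω z ψ p - fderiv ℝ ψ p (1, 0)) (Icc s t ×ˢ univ) :=
    hi1.sub hi2
  rw [setIntegral_prod_univ hi3]
  refine integral_eq_zero_of_ae (ae_restrict_of_ae ?_)
  filter_upwards [(ae_slice_differentiableAt hψ.lipschitz).1] with σ hσ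
  have hL := hψ.lipschitz_slice σ
  have hc := hψ.hasCompactSupport_slice σ
  have hli : LocallyIntegrable (vel 0 (ω σ)) := by
    refine (locallyIntegrable_const (2 * M)).mono
      (measurable_vel_slice hω 0 σ).aestronglyMeasurable (ae_of_all _ fun x => ?_)
    rw [Real.norm_of_nonneg (by linarith [(hb 0).nonneg])]
    exact (hb σ).norm_vel_le 0 x
  have e : ∫ x, (advect ω z ψ (σ, x) - fderiv ℝ ψ (σ, x) (1, 0)) =
      ∫ x, (fderiv ℝ (fun x => ψ (σ, x)) x (vel 0 (ω σ) x) +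
        fderiv ℝ (fun x => ψ (σ, x)) x (regKernel 0 (x - z σ))) := by
    refine integral_congr_ae ?_
    filter_upwards [hσ] with x hx
    have e1 : HasFDerivAt (fun x : Plane => (σ, x)) (ContinuousLinearMap.inr ℝ ℝ Plane) x :=
      hasFDerivAt_prodMk_right σ x
    have e2 := (hx.hasFDerivAt.comp x e1).fderiv
    have e3 : (fun x => ψ (σ, x)) = ψ ∘ fun x => (σ, x) := rfl
    rw [hsplit, ← map_add, e3, e2]
    simp [field, velocity_eq_vel, regKernel_zero]
  have hk : Integrable fun x => fderiv ℝ (fun x => ψ (σ, x)) x (regKernel 0 (x - z σ)) :=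
    integrable_fderiv_apply hL hc
      ((measurable_regKernel 0).comp (measurable_id.sub measurable_const))
      (locallyIntegrable_regKernel_sub 0 (z σ))
  rw [e, integral_add (integrable_fderiv_apply hL hc (measurable_vel_slice hω 0 σ) hli) hk,
    integral_fderiv_vel_zero (hb σ) hL hc, integral_fderiv_regKernel_zero hL hc, add_zero]
  rfl

lemma WeaklyContinuousL2loc.integrable_mul (h : WeaklyContinuousL2loc ω') (ht : 0 ≤ t)
    {φ : Plane → ℝ} (hφ : Continuous φ) (hc : HasCompactSupport φ) :
    Integrable fun x => ω' t x * φ x := by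
  have h1 := h.1 t ht _ hc
  have h2 : MemLp φ 2 (volume.restrict (tsupport φ)) :=
    (hφ.memLp_of_hasCompactSupport hc).restrict _
  have h3 : IntegrableOn (fun x => ω' t x * φ x) (tsupport φ) := h1.integrable_mul h2
  refine h3.integrable_of_forall_notMem_eq_zero fun x hx => ?_
  rw [image_eq_zero_of_notMem_tsupport hx, mul_zero]

/-- The weak formulation between two times, for the vorticity up to a constant. -/
lemma IsBoundedSolution.integral_sub_eq (h : IsBoundedSolution M ω₀ z₀ ω z)
    (h' : IsContinuousRepresentative ω ω') (hψ : IsTest C ρ ψ) (hs : 0 ≤ s) (hst : s ≤ t)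
    (κ : ℝ) :
    (∫ x, (ω' t x - κ) * ψ (t, x)) - ∫ x, (ω' s x - κ) * ψ (s, x) =
      ∫ p in Icc s t ×ˢ univ, (ω p.1 p.2 - κ) * advect ω z ψ p := by
  have hsl : ∀ σ, 0 ≤ σ → ∫ x, (ω' σ x - κ) * ψ (σ, x) =
      weakValue ω₀ ω z ψ σ - κ * ∫ x, ψ (σ, x) := by
    intro σ hσ
    have hc := (hψ.lipschitz_slice σ).continuous
    rw [← h.integral_representative h' hψ hσ, ← integral_const_mul, ← integral_sub
      (h'.2.integrable_mul hσ hc (hψ.hasCompactSupport_slice σ))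
      ((hc.integrable_of_hasCompactSupport (hψ.hasCompactSupport_slice σ)).const_mul κ)]
    simp_rw [sub_mul]
  have hI := integrableOn_mul_advect_of_isTest h.measurable h.bddInt h.continuous hψ
  have hA := integrableOn_advect_of_isTest h.measurable h.bddInt h.continuous hψ
  have hW : weakValue ω₀ ω z ψ t - weakValue ω₀ ω z ψ s =
      ∫ p in Icc s t ×ˢ univ, ω p.1 p.2 * advect ω z ψ p := by
    have hG : ∀ a b, IntervalIntegrable (fun σ => ∫ x, ω σ x * advect ω z ψ (σ, x)) volume a b := by
      intro a b
      rw [intervalIntegrable_iff]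
      exact (integrableOn_integral_slice (hI (min a b) (max a b))).mono_set Ioc_subset_Icc_self
    have e : ∀ a b, a ≤ b → ∫ p in Icc a b ×ˢ univ, ω p.1 p.2 * advect ω z ψ p =
        ∫ σ in a..b, ∫ x, ω σ x * advect ω z ψ (σ, x) := by
      intro a b hab
      rw [setIntegral_prod_univ (hI a b), integral_Icc_eq_integral_Ioc,
        intervalIntegral.integral_of_le hab]
    rw [weakValue, weakValue, e 0 t (hs.trans hst), e 0 s hs, e s t hst,
      ← intervalIntegral.integral_interval_sub_left (hG 0 t) (hG 0 s)]
    ring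
  have hD := hψ.integral_advect h.measurable h.bddInt h.continuous hst
  rw [hsl t (hs.trans hst), hsl s hs]
  have e : ∫ p in Icc s t ×ˢ univ, (ω p.1 p.2 - κ) * advect ω z ψ p =
      (∫ p in Icc s t ×ˢ univ, ω p.1 p.2 * advect ω z ψ p) -
        κ * ∫ p in Icc s t ×ˢ univ, advect ω z ψ p := by
    rw [← integral_const_mul, ← integral_sub (hI s t) ((hA s t).const_mul κ)]
    simp_rw [sub_mul]
  rw [e, hD, ← hW]
  ring

end

/-! ### Averaging a vector field in time -/

section Average

/-- The average of `c` over the time interval `[σ, σ + δ]`. -/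
def avgField (c : ℝ → Plane → Plane) (δ σ : ℝ) (y : Plane) : Plane :=
  δ⁻¹ • ∫ u in σ..σ + δ, c u y

variable {c : ℝ → Plane → Plane} {B : ℝ} {L : ℝ≥0} {δ : ℝ}

lemma locallyIntegrable_of_bounded_time (hc : Measurable fun p : ℝ × Plane => c p.1 p.2)
    (hB : ∀ σ y, ‖c σ y‖ ≤ B) (y : Plane) : LocallyIntegrable fun σ => c σ y := by
  refine (locallyIntegrable_const B).mono
    (hc.comp measurable_prodMk_right).aestronglyMeasurable (ae_of_all _ fun σ => ?_)
  rw [Real.norm_of_nonneg ((norm_nonneg _).trans (hB σ y))]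
  exact hB σ y

lemma intervalIntegrable_of_bounded_time (hc : Measurable fun p : ℝ × Plane => c p.1 p.2)
    (hB : ∀ σ y, ‖c σ y‖ ≤ B) (y : Plane) (a b : ℝ) :
    IntervalIntegrable (fun σ => c σ y) volume a b :=
  ((locallyIntegrable_of_bounded_time hc hB y).integrableOn_isCompact
    isCompact_uIcc).intervalIntegrable

lemma norm_avgField_le (hδ : 0 < δ) {b : ℝ} {y : Plane} (hb : ∀ σ, ‖c σ y‖ ≤ b) (σ : ℝ) :
    ‖avgField c δ σ y‖ ≤ b := by
  rw [avgField, norm_smul, norm_inv, Real.norm_of_nonneg hδ.le, inv_mul_le_iff₀ hδ, mul_comm]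
  refine (intervalIntegral.norm_integral_le_of_norm_le_const fun u _ => hb u).trans (le_of_eq ?_)
  rw [add_sub_cancel_left, abs_of_pos hδ]

lemma lipschitzWith_avgField (hδ : 0 < δ) (hc : Measurable fun p : ℝ × Plane => c p.1 p.2)
    (hB : ∀ σ y, ‖c σ y‖ ≤ B) (hL : ∀ σ, LipschitzWith L (c σ)) (σ : ℝ) :
    LipschitzWith L (avgField c δ σ) := by
  refine LipschitzWith.of_dist_le_mul fun x y => ?_
  have hi := fun y => intervalIntegrable_of_bounded_time hc hB y σ (σ + δ)
  have e : avgField c δ σ x - avgField c δ σ y =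
      avgField (fun u _ => c u x - c u y) δ σ 0 := by
    simp only [avgField]
    rw [intervalIntegral.integral_sub (hi x) (hi y), smul_sub]
  rw [dist_eq_norm, e]
  refine norm_avgField_le hδ (fun u => ?_) σ
  rw [← dist_eq_norm]
  exact (hL u).dist_le_mul x y

lemma continuous_avgField (hc : Measurable fun p : ℝ × Plane => c p.1 p.2)
    (hB : ∀ σ y, ‖c σ y‖ ≤ B) (δ : ℝ) (y : Plane) : Continuous fun σ => avgField c δ σ y := by
  have hi := intervalIntegrable_of_bounded_time hc hB y
  have h0 := intervalIntegral.continuous_primitive hi 0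
  have : (fun σ => avgField c δ σ y) = fun σ =>
      δ⁻¹ • ((∫ u in (0 : ℝ)..σ + δ, c u y) - ∫ u in (0 : ℝ)..σ, c u y) := by
    ext1 σ
    rw [avgField, intervalIntegral.integral_interval_sub_left (hi _ _) (hi _ _)]
  rw [this]
  exact (((h0.comp (by fun_prop : Continuous fun σ : ℝ => σ + δ)).sub h0).const_smul δ⁻¹)

lemma continuous_avgField_uncurry (hδ : 0 < δ) (hc : Measurable fun p : ℝ × Plane => c p.1 p.2)
    (hB : ∀ σ y, ‖c σ y‖ ≤ B) (hL : ∀ σ, LipschitzWith L (c σ)) :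
    Continuous fun p : ℝ × Plane => avgField c δ p.1 p.2 :=
  continuous_prod_of_continuous_lipschitzWith' _ L
    (fun σ => lipschitzWith_avgField hδ hc hB hL σ) (continuous_avgField hc hB δ)

lemma tendsto_avgField {σ : ℝ} {y : Plane} {δ : ℕ → ℝ} (h0 : ∀ n, 0 < δ n)
    (hlim : Tendsto δ atTop (𝓝 0))
    (hd : HasDerivAt (fun τ => ∫ u in σ..τ, c u y) (c σ y) σ) :
    Tendsto (fun n => avgField c (δ n) σ y) atTop (𝓝 (c σ y)) := by
  have h1 := hasDerivAt_iff_tendsto_slope_zero.1 hd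
  have h2 : Tendsto δ atTop (𝓝[≠] 0) :=
    tendsto_nhdsWithin_iff.2 ⟨hlim, Eventually.of_forall fun n => (h0 n).ne'⟩
  refine (h1.comp h2).congr fun n => ?_
  simp [avgField]

lemma ae_tendsto_avgField (hc : Measurable fun p : ℝ × Plane => c p.1 p.2)
    (hB : ∀ σ y, ‖c σ y‖ ≤ B) (hL : ∀ σ, LipschitzWith L (c σ)) {δ : ℕ → ℝ} (h0 : ∀ n, 0 < δ n)
    (hlim : Tendsto δ atTop (𝓝 0)) :
    ∀ᵐ p : ℝ × Plane, Tendsto (fun n => avgField c (δ n) p.1 p.2) atTop (𝓝 (c p.1 p.2)) := by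
  have hm : MeasurableSet {p : ℝ × Plane |
      Tendsto (fun n => avgField c (δ n) p.1 p.2) atTop (𝓝 (c p.1 p.2))} :=
    measurableSet_tendsto_fun
      (fun n => (continuous_avgField_uncurry (h0 n) hc hB hL).measurable) hc
  rw [Measure.volume_eq_prod]
  refine (Measure.ae_prod_iff_ae_ae hm).2 ((Measure.ae_ae_comm hm).2 (ae_of_all _ fun y => ?_))
  filter_upwards [LocallyIntegrable.ae_hasDerivAt_integral
    (locallyIntegrable_of_bounded_time hc hB y)] with σ hσ
  exact tendsto_avgField h0 hlim (hσ σ)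

end Average

/-! ### Transport of test functions by the regularised flow -/

section Trajectory

variable {M : ℝ} {ω₀ : Plane → ℝ} {z₀ : Plane} {ω : ℝ → Plane → ℝ} {z : ℝ → Plane}

lemma IsBoundedSolution.locallyIntegrable_velocity (h : IsBoundedSolution M ω₀ z₀ ω z) :
    LocallyIntegrable fun σ => velocity (ω σ) (z σ) := by
  simp_rw [velocity_eq_vel]
  refine (locallyIntegrable_const (2 * M)).mono ((measurable_vel h.measurable 0).comp
    (measurable_id.prodMk h.continuous.measurable)).aestronglyMeasurable (ae_of_all _ fun σ => ?_)
  rw [Real.norm_of_nonneg (by linarith [(h.bddInt 0).nonneg])]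
  exact (h.bddInt σ).norm_vel_le 0 (z σ)

lemma IsBoundedSolution.intervalIntegrable_velocity (h : IsBoundedSolution M ω₀ z₀ ω z)
    (a b : ℝ) : IntervalIntegrable (fun σ => velocity (ω σ) (z σ)) volume a b :=
  (h.locallyIntegrable_velocity.integrableOn_isCompact isCompact_uIcc).intervalIntegrable

lemma IsBoundedSolution.norm_trajectory_sub_le (h : IsBoundedSolution M ω₀ z₀ ω z) {a b : ℝ}
    (ha : 0 ≤ a) (hb : 0 ≤ b) : ‖z a - z b‖ ≤ 2 * M * |a - b| := by
  rw [h.trajectory a ha, h.trajectory b hb, add_sub_add_left_eq_sub,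
    intervalIntegral.integral_interval_sub_left (h.intervalIntegrable_velocity _ _)
      (h.intervalIntegrable_velocity _ _)]
  refine intervalIntegral.norm_integral_le_of_norm_le_const fun σ _ => ?_
  rw [velocity_eq_vel]
  exact (h.bddInt σ).norm_vel_le 0 (z σ)

lemma IsBoundedSolution.ae_hasDerivAt_trajectory (h : IsBoundedSolution M ω₀ z₀ ω z) :
    ∀ᵐ σ : ℝ, 0 < σ → HasDerivAt z (velocity (ω σ) (z σ)) σ := by
  filter_upwards [LocallyIntegrable.ae_hasDerivAt_integral h.locallyIntegrable_velocity]
    with σ hσ h0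
  refine ((hσ 0).const_add z₀).congr_of_eventuallyEq ?_
  filter_upwards [lt_mem_nhds h0] with τ hτ
  exact h.trajectory τ (le_of_lt hτ)

end Trajectory

section BackTest

/-- The nearest point of `[s, t]`. -/
def clamp (s t σ : ℝ) : ℝ := max s (min σ t)

lemma clamp_mem {s t : ℝ} (hst : s ≤ t) (σ : ℝ) : clamp s t σ ∈ Icc s t :=
  ⟨le_max_left _ _, max_le hst (min_le_right _ _)⟩

lemma clamp_of_mem {s t σ : ℝ} (h : σ ∈ Icc s t) : clamp s t σ = σ := by
  rw [clamp, min_eq_left h.2, max_eq_right h.1]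

lemma abs_clamp_sub_le (s t σ σ' : ℝ) : |clamp s t σ - clamp s t σ'| ≤ |σ - σ'| := by
  have h : LipschitzWith 1 (clamp s t) := (LipschitzWith.id.min_const t).const_max s
  have := h.dist_le_mul σ σ'
  rwa [NNReal.coe_one, one_mul, Real.dist_eq, Real.dist_eq] at this

/-- The function that takes the value `φ (Φ σ (x - z σ))` at `(σ, x)`. -/
def backTest (φ : Plane → ℝ) (Φ : ℝ → Plane → Plane) (z : ℝ → Plane) (s t : ℝ)
    (p : ℝ × Plane) : ℝ :=
  φ (Φ (clamp s t p.1) (p.2 - z (clamp s t p.1)))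

lemma backTest_of_mem {φ : Plane → ℝ} {Φ : ℝ → Plane → Plane} {z : ℝ → Plane} {s t σ : ℝ}
    (h : σ ∈ Icc s t) (x : Plane) : backTest φ Φ z s t (σ, x) = φ (Φ σ (x - z σ)) := by
  simp only [backTest, clamp_of_mem h]

variable {φ : Plane → ℝ} {Φ : ℝ → Plane → Plane} {z : ℝ → Plane} {s t : ℝ} {D Λ N B : ℝ≥0}
  {ρ Z : ℝ}

lemma isTest_backTest (hst : s ≤ t) (hφ : LipschitzWith D φ) (hρ : ∀ y, ρ ≤ ‖y‖ → φ y = 0)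
    (hΦ : ∀ σ ∈ Icc s t, ∀ σ' ∈ Icc s t, ∀ y y', dist (Φ σ y) (Φ σ' y') ≤
      Λ * (dist y y' + B * |σ - σ'|))
    (hΦ' : ∀ σ ∈ Icc s t, ∀ y, ‖Φ σ y - y‖ ≤ B * (t - s))
    (hz : ∀ σ ∈ Icc s t, ∀ σ' ∈ Icc s t, ‖z σ - z σ'‖ ≤ N * |σ - σ'|)
    (hZ : ∀ σ ∈ Icc s t, ‖z σ‖ ≤ Z) :
    IsTest (D * (Λ * (1 + N + B))) (ρ + B * (t - s) + Z) (backTest φ Φ z s t) where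
  lipschitz := by
    refine LipschitzWith.of_dist_le_mul fun p q => ?_
    have hp := clamp_mem hst p.1
    have hq := clamp_mem hst q.1
    have h1 : |clamp s t p.1 - clamp s t q.1| ≤ dist p q :=
      (abs_clamp_sub_le s t p.1 q.1).trans ((Real.dist_eq _ _).symm.le.trans (le_max_left _ _))
    have h2 : dist (p.2 - z (clamp s t p.1)) (q.2 - z (clamp s t q.1)) ≤
        dist p q + N * dist p q := by
      refine (dist_sub_sub_le _ _ _ _).trans (add_le_add (le_max_right _ _) ?_)
      rw [dist_eq_norm]
      exact (hz _ hp _ hq).trans (by gcongr)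
    refine (hφ.dist_le_mul _ _).trans ?_
    push_cast
    rw [mul_assoc, mul_assoc]
    refine mul_le_mul_of_nonneg_left ((hΦ _ hp _ hq _ _).trans ?_) D.2
    refine mul_le_mul_of_nonneg_left ?_ Λ.2
    calc _ ≤ (dist p q + N * dist p q) + B * dist p q := by gcongr
      _ = _ := by ring
  zero := by
    intro σ x hx
    have hσ := clamp_mem hst σ
    refine hρ _ ?_
    have h1 := hΦ' _ hσ (x - z (clamp s t σ))
    have h2 := hZ _ hσ
    have h3 := norm_sub_norm_le (x - z (clamp s t σ)) (Φ (clamp s t σ) (x - z (clamp s t σ)))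
    have h4 := norm_sub_norm_le x (z (clamp s t σ))
    rw [norm_sub_rev] at h1
    linarith
  bounded := by
    obtain ⟨b, hb⟩ := (HasCompactSupport.intro (isCompact_closedBall (0 : Plane) ρ) fun x hx =>
      hρ x (by simpa using (not_le.1 (by simpa using hx)).le)).exists_bound_of_continuous
        hφ.continuous
    exact ⟨b, fun p => hb _⟩

variable {c : ℝ → Plane → Plane} {r₀ : ℝ} {ω : ℝ → Plane → ℝ} {L : ℝ≥0}

/-- Along the solution, a function transported by the flow of `c + regKernel r₀` varies only
because `c` is not exactly the velocity relative to the vortex. -/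
lemma abs_advect_backTest_le (hL : LipschitzWith L (backTest φ Φ z s t))
    (hΦ : ∀ σ ∈ Icc s t, ∀ y, ∃ Y : ℝ → Plane, Y σ = y ∧
      IsTrajectory (fun σ y => c σ y + regKernel r₀ y) s t Y ∧ ∀ τ ∈ Icc s t, Φ τ (Y τ) = Y t)
    (h0 : ∀ σ ∈ Icc s t, ∀ y, ‖y‖ ≤ r₀ → φ (Φ σ y) = 0)
    (hz : Continuous z) {p : ℝ × Plane} (hp : p.1 ∈ Ioo s t)
    (hd : DifferentiableAt ℝ (backTest φ Φ z s t) p)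
    (hz' : HasDerivAt z (velocity (ω p.1) (z p.1)) p.1) :
    |advect ω z (backTest φ Φ z s t) p| ≤
      L * ‖velocity (ω p.1) p.2 - velocity (ω p.1) (z p.1) - c p.1 (p.2 - z p.1)‖ := by
  obtain ⟨σ, x⟩ := p
  simp only at hp hz' ⊢
  have hσ := Ioo_subset_Icc_self hp
  rcases lt_or_ge ‖x - z σ‖ r₀ with h | h
  · have : fderiv ℝ (backTest φ Φ z s t) (σ, x) = 0 := by
      have hcont : Continuous fun p : ℝ × Plane => ‖p.2 - z p.1‖ := by fun_prop
      have e : backTest φ Φ z s t =ᶠ[𝓝 (σ, x)] fun _ => 0 := by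
        filter_upwards [(hcont.tendsto (σ, x)).eventually_lt_const h,
          (continuous_fst.tendsto (σ, x)).eventually (Icc_mem_nhds hp.1 hp.2)] with q h1 h2
        have := backTest_of_mem (φ := φ) (Φ := Φ) (z := z) h2 q.2
        rw [this]
        exact h0 _ h2 _ (le_of_lt h1)
      rw [e.fderiv_eq]
      simp
    rw [advect, this]
    simp only [zero_apply, abs_zero]
    positivity
  · obtain ⟨Y, hY0, hY, hYt⟩ := hΦ σ hσ (x - z σ)
    have hγ : HasDerivAt (fun τ => (τ, z τ + Y τ))
        ((1 : ℝ), velocity (ω σ) (z σ) + (c σ (Y σ) + regKernel r₀ (Y σ))) σ :=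
      (hasDerivAt_id σ).prodMk (hz'.add (hY σ hσ))
    have hγσ : (σ, z σ + Y σ) = (σ, x) := by rw [hY0, add_sub_cancel]
    have h1 := HasFDerivAt.comp_hasDerivAt σ (l := backTest φ Φ z s t)
      (f := fun τ => (τ, z τ + Y τ)) (by rw [hγσ]; exact hd.hasFDerivAt) hγ
    have h2 : (backTest φ Φ z s t ∘ fun τ => (τ, z τ + Y τ)) =ᶠ[𝓝 σ] fun _ => φ (Y t) := by
      filter_upwards [Icc_mem_nhds hp.1 hp.2] with τ hτ
      simp only [Function.comp]
      rw [backTest_of_mem hτ, add_sub_cancel_left, hYt τ hτ]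
    have h3 := h1.unique ((hasDerivAt_const σ (φ (Y t))).congr_of_eventuallyEq h2)
    have h4 : advect ω z (backTest φ Φ z s t) (σ, x) =
        fderiv ℝ (backTest φ Φ z s t) (σ, x)
          (0, velocity (ω σ) x - velocity (ω σ) (z σ) - c σ (x - z σ)) := by
      have e : ((0 : ℝ), velocity (ω σ) x - velocity (ω σ) (z σ) - c σ (x - z σ)) =
          ((1 : ℝ), field ω z (σ, x)) -
            ((1 : ℝ), velocity (ω σ) (z σ) + (c σ (Y σ) + regKernel r₀ (Y σ))) := by
        rw [Prod.mk_sub_mk, sub_self, hY0, field,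
          regKernel_eq_of_le (ε' := 0) h (norm_nonneg _), regKernel_zero]
        congr 1
        change _ = velocity (ω σ) x + biotSavart (x - z σ) - _
        abel
      rw [advect, e, map_sub, h3, sub_zero]
    rw [h4]
    refine ((fderiv ℝ (backTest φ Φ z s t) (σ, x)).le_opNorm _).trans ?_
    refine mul_le_mul (norm_fderiv_le_of_lipschitz ℝ hL) ?_ (norm_nonneg _) L.2
    simp [Prod.norm_def]

end BackTest

/-! ### Approximate duality over a short time interval -/

section RelVel

variable {M : ℝ} {ω : ℝ → Plane → ℝ} {z : ℝ → Plane} {ε : ℝ}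

/-- The regularised velocity relative to the vortex, in the frame that moves with it. -/
def relVel (ε : ℝ) (ω : ℝ → Plane → ℝ) (z : ℝ → Plane) (σ : ℝ) (y : Plane) : Plane :=
  vel ε (ω σ) (z σ + y) - vel ε (ω σ) (z σ)

lemma measurable_relVel (hω : Measurable fun p : ℝ × Plane => ω p.1 p.2) (hz : Continuous z) :
    Measurable fun p : ℝ × Plane => relVel ε ω z p.1 p.2 := by
  have hz' : Measurable fun p : ℝ × Plane => z p.1 := hz.measurable.comp measurable_fst
  exact ((measurable_vel hω ε).comp (measurable_fst.prodMk (hz'.add measurable_snd))).sub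
    ((measurable_vel hω ε).comp (measurable_fst.prodMk hz'))

lemma norm_relVel_le (hb : ∀ t, BddInt M (ω t)) (σ : ℝ) (y : Plane) :
    ‖relVel ε ω z σ y‖ ≤ 4 * M :=
  (norm_sub_le _ _).trans
    (by linarith [(hb σ).norm_vel_le ε (z σ + y), (hb σ).norm_vel_le ε (z σ)])

lemma norm_relVel_le_logMod (hb : ∀ t, BddInt M (ω t)) (hε : 0 ≤ ε) (h1 : ε ≤ 1) (σ : ℝ)
    (y : Plane) : ‖relVel ε ω z σ y‖ ≤ 5 * M * logMod ‖y‖ := by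
  simpa [relVel] using (hb σ).norm_vel_sub_le_logMod hε h1 (z σ + y) (z σ)

lemma lipschitzWith_relVel (hb : ∀ t, BddInt M (ω t)) (hε : 0 < ε) (h1 : ε ≤ 1) (σ : ℝ) :
    LipschitzWith (Real.toNNReal (3 * M * (1 + Real.log (1 / ε)))) (relVel ε ω z σ) := by
  refine LipschitzWith.of_dist_le_mul fun x y => ?_
  have := (hb σ).norm_vel_sub_le hε h1 (z σ + x) (z σ + y)
  rw [add_sub_add_left_eq_sub] at this
  rw [dist_eq_norm, dist_eq_norm, relVel, relVel, sub_sub_sub_cancel_right]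
  exact this.trans (mul_le_mul_of_nonneg_right (Real.le_coe_toNNReal _) (norm_nonneg _))

lemma norm_velocity_sub_relVel_le (hb : ∀ t, BddInt M (ω t)) (hε : 0 ≤ ε) (σ : ℝ) (x : Plane) :
    ‖velocity (ω σ) x - velocity (ω σ) (z σ) - relVel ε ω z σ (x - z σ)‖ ≤ 2 * M * ε := by
  rw [relVel, add_sub_cancel, velocity_eq_vel]
  have e : vel 0 (ω σ) x - vel 0 (ω σ) (z σ) - (vel ε (ω σ) x - vel ε (ω σ) (z σ)) =
      (vel 0 (ω σ) x - vel ε (ω σ) x) - (vel 0 (ω σ) (z σ) - vel ε (ω σ) (z σ)) := by abel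
  rw [e]
  have h1 := (hb σ).norm_vel_sub_vel_le (le_refl 0) hε x
  have h2 := (hb σ).norm_vel_sub_vel_le (le_refl 0) hε (z σ)
  exact (norm_sub_le _ _).trans (by linarith)

lemma tendsto_integral_relVel_sub_avgField (hω : Measurable fun p : ℝ × Plane => ω p.1 p.2)
    (hb : ∀ t, BddInt M (ω t)) (hz : Continuous z) (hε : 0 < ε) (h1 : ε ≤ 1)
    {K : Set (ℝ × Plane)} (hK : IsCompact K) :
    Tendsto (fun n : ℕ => ∫ p in K, ‖relVel ε ω z p.1 (p.2 - z p.1) -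
      avgField (relVel ε ω z) (1 / (n + 1 : ℝ)) p.1 (p.2 - z p.1)‖) atTop (𝓝 0) := by
  have hδ : ∀ n : ℕ, (0 : ℝ) < 1 / (n + 1 : ℝ) := fun n => by positivity
  have hm := measurable_relVel (ε := ε) hω hz
  have hB := norm_relVel_le (ε := ε) (z := z) hb
  have hL := lipschitzWith_relVel (z := z) hb hε h1
  have hshear := measurePreserving_shear hz
  have h0 : Tendsto (fun n : ℕ => ∫ p in K, ‖relVel ε ω z p.1 (p.2 - z p.1) -
      avgField (relVel ε ω z) (1 / (n + 1 : ℝ)) p.1 (p.2 - z p.1)‖) atTop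
      (𝓝 (∫ p in K, (0 : ℝ))) := by
    refine tendsto_integral_of_dominated_convergence (fun _ => 4 * M + 4 * M) (fun n => ?_)
      (integrableOn_const hK.measure_lt_top.ne) (fun n => ae_of_all _ fun p => ?_)
      (ae_restrict_of_ae ?_)
    · exact ((hm.sub (continuous_avgField_uncurry (hδ n) hm hB hL).measurable).norm.comp
        hshear.measurable).aestronglyMeasurable
    · rw [norm_norm]
      exact (norm_sub_le _ _).trans
        (add_le_add (hB _ _) (norm_avgField_le (hδ n) (fun σ => hB σ _) _))
    · filter_upwards [hshear.quasiMeasurePreserving.ae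
        (ae_tendsto_avgField hm hB hL hδ tendsto_one_div_add_atTop_nhds_zero_nat)] with p hp
      have := (hp.const_sub (relVel ε ω z p.1 (p.2 - z p.1))).norm
      simpa using this
  simpa using h0

end RelVel

/-- `Y` moves points away from the origin at least as fast as the barrier between the times `s`
and `t`. -/
def Expands (A s t : ℝ) (Y : Plane → Plane) : Prop :=
  ∀ l k : ℝ, 1 ≤ k → 1 - l ≤ k → ∀ y, Real.exp (l + k * (1 - Real.exp (2 * A * s))) ≤ ‖y‖ →
    Real.exp (l + k * (1 - Real.exp (2 * A * t))) ≤ ‖Y y‖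

/-- Lipschitz functions with compact support in the complement of the origin. -/
structure IsAdmissible (φ : Plane → ℝ) : Prop where
  lipschitz : ∃ D, LipschitzWith D φ
  far : ∃ ρ, ∀ y, ρ ≤ ‖y‖ → φ y = 0
  near : ∃ a > 0, ∀ y, ‖y‖ ≤ a → φ y = 0

section Duality

variable {M : ℝ} {ω₀ : Plane → ℝ} {z₀ : Plane} {ω ω' : ℝ → Plane → ℝ} {z : ℝ → Plane} {s t : ℝ}

/-- The transport of an admissible function by the regularised flow with parameters `ε`, `δ`. -/
lemma IsBoundedSolution.exists_backTest (h : IsBoundedSolution M ω₀ z₀ ω z) (hs : 0 ≤ s)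
    (hst : s ≤ t) {φ : Plane → ℝ} {D B G : ℝ≥0} (hφ : LipschitzWith D φ) {ρ : ℝ}
    (hρ : ∀ y, ρ ≤ ‖y‖ → φ y = 0) {l k r₀ : ℝ} (hk : 1 ≤ k) (hkl : 1 - l ≤ k)
    (ha : ∀ y, ‖y‖ ≤ Real.exp l → φ y = 0)
    (hr₀ : r₀ = Real.exp (l + k * (1 - Real.exp (2 * (5 * M + 1) * (t - s)))))
    (hB : 4 * M + (2 * Real.pi)⁻¹ * r₀⁻¹ ≤ B) (hG : LipschitzWith G (regKernel r₀))
    {ε δ : ℝ} (hε : 0 < ε) (h1 : ε ≤ 1) (hδ : 0 < δ) :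
    ∃ (ψ : ℝ × Plane → ℝ) (Y : Plane → Plane),
      IsTest (D * (Real.toNNReal (Real.exp ((3 * M * (1 + Real.log (1 / ε)) + G) * (t - s))) *
        (1 + Real.toNNReal (2 * M) + B))) (ρ + B * (t - s) + (‖z s‖ + 2 * M * (t - s))) ψ ∧
      (∀ x, ψ (t, x) = φ (x - z t)) ∧ (∀ x, ψ (s, x) = φ (Y (x - z s))) ∧
      IsAdmissible (φ ∘ Y) ∧ Expands (5 * M + 1) s t Y ∧
      ∀ᵐ p : ℝ × Plane, p.1 ∈ Ioo s t → |advect ω z ψ p| ≤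
        (D * (Real.toNNReal (Real.exp ((3 * M * (1 + Real.log (1 / ε)) + G) * (t - s))) *
          (1 + Real.toNNReal (2 * M) + B)) : ℝ≥0) *
        (2 * M * ε + ‖relVel ε ω z p.1 (p.2 - z p.1) -
          avgField (relVel ε ω z) δ p.1 (p.2 - z p.1)‖) := by
  have hM := (h.bddInt 0).nonneg
  have hm := measurable_relVel (ε := ε) h.measurable h.continuous
  have hcB := norm_relVel_le (ε := ε) (z := z) h.bddInt
  have hcL := lipschitzWith_relVel (z := z) h.bddInt hε h1
  have hlog : 0 ≤ 3 * M * (1 + Real.log (1 / ε)) := by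
    have := Real.log_nonneg (x := 1 / ε) (by rw [le_div_iff₀ hε]; linarith)
    positivity
  have hr₀pos : 0 < r₀ := hr₀ ▸ Real.exp_pos _
  set c := avgField (relVel ε ω z) δ with hc
  set F : ℝ → Plane → Plane := fun σ y => c σ y + regKernel r₀ y with hF
  have hFL : ∀ σ, LipschitzWith (Real.toNNReal (3 * M * (1 + Real.log (1 / ε))) + G) (F σ) :=
    fun σ => (lipschitzWith_avgField hδ hm hcB hcL σ).add hG
  have hFc : ∀ y, Continuous fun σ => F σ y := fun y =>
    (continuous_avgField hm hcB δ y).add continuous_const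
  have hFB : ∀ σ y, ‖F σ y‖ ≤ B := fun σ y => (norm_add_le _ _).trans
    ((add_le_add (norm_avgField_le hδ (fun u => hcB u y) σ)
      (norm_regKernel_le_inv hr₀pos y)).trans hB)
  have hFA : ∀ σ y, |inner ℝ y (F σ y)| ≤ 5 * M * (‖y‖ * logMod ‖y‖) := by
    intro σ y
    rw [hF, inner_add_right, inner_regKernel_self, add_zero]
    refine (abs_real_inner_le_norm _ _).trans ?_
    rw [mul_left_comm]
    exact mul_le_mul_of_nonneg_left
      (norm_avgField_le hδ (fun u => norm_relVel_le_logMod h.bddInt hε.le h1 u y) σ)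
      (norm_nonneg _)
  obtain ⟨Φ, hΦt, hΦL, hΦ⟩ := exists_terminalFlow (s := s) (t := t) hFL hFc hFB
  have hcoe : ((Real.toNNReal (3 * M * (1 + Real.log (1 / ε))) + G : ℝ≥0) : ℝ) =
      3 * M * (1 + Real.log (1 / ε)) + G := by
    rw [NNReal.coe_add, Real.coe_toNNReal _ hlog]
  set Λ := Real.toNNReal (Real.exp ((3 * M * (1 + Real.log (1 / ε)) + G) * (t - s))) with hΛ
  rw [hcoe, ← Real.coe_toNNReal _ (Real.exp_pos _).le, ← hΛ] at hΦL
  have hs' : s ∈ Icc s t := ⟨le_rfl, hst⟩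
  have ht' : t ∈ Icc s t := ⟨hst, le_rfl⟩
  have hdisp : ∀ σ ∈ Icc s t, ∀ y, ‖Φ σ y - y‖ ≤ B * (t - s) := by
    intro σ hσ y
    obtain ⟨Y, hY0, hY, hYt⟩ := hΦ σ hσ y
    have e := hYt σ hσ
    rw [hY0] at e
    rw [e]
    conv_lhs => rw [← hY0]
    refine (hY.norm_sub_le hFB hσ ht').trans (mul_le_mul_of_nonneg_left ?_ B.2)
    rw [abs_of_nonneg (sub_nonneg.2 hσ.2)]
    linarith [hσ.1]
  have hzL : ∀ σ ∈ Icc s t, ∀ σ' ∈ Icc s t,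
      ‖z σ - z σ'‖ ≤ (Real.toNNReal (2 * M) : ℝ≥0) * |σ - σ'| := by
    intro σ hσ σ' hσ'
    rw [Real.coe_toNNReal _ (by positivity)]
    exact h.norm_trajectory_sub_le (hs.trans hσ.1) (hs.trans hσ'.1)
  have hZ : ∀ σ ∈ Icc s t, ‖z σ‖ ≤ ‖z s‖ + 2 * M * (t - s) := by
    intro σ hσ
    have h2 := h.norm_trajectory_sub_le (hs.trans hσ.1) hs
    rw [abs_of_nonneg (sub_nonneg.2 hσ.1)] at h2
    have h3 := norm_sub_norm_le (z σ) (z s)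
    have : 2 * M * (σ - s) ≤ 2 * M * (t - s) := by
      have := hσ.2
      gcongr
    linarith
  have hnear : ∀ σ ∈ Icc s t, ∀ y, ‖y‖ ≤ r₀ → φ (Φ σ y) = 0 := by
    intro σ hσ y hy
    obtain ⟨Y, hY0, hY, hYt⟩ := hΦ σ hσ y
    have e := hYt σ hσ
    rw [hY0] at e
    rw [e]
    refine ha _ (barrier_upper hY hσ hFA (by positivity) (lt_add_one _) hk hkl ?_)
    rw [hY0]
    refine hy.trans (hr₀.le.trans ?_)
    have := hσ.1
    gcongr
  have htest := isTest_backTest hst hφ hρ hΦL hdisp hzL hZ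
  refine ⟨backTest φ Φ z s t, Φ s, htest, fun x => ?_, fun x => ?_, ⟨?_, ?_, ?_⟩, ?_, ?_⟩
  · rw [backTest_of_mem ht', hΦt]
  · rw [backTest_of_mem hs']
  · refine ⟨D * Λ, LipschitzWith.of_dist_le_mul fun x y => ?_⟩
    refine (hφ.dist_le_mul _ _).trans ?_
    rw [NNReal.coe_mul, mul_assoc]
    refine mul_le_mul_of_nonneg_left ((hΦL s hs' s hs' x y).trans ?_) D.2
    rw [sub_self, abs_zero, mul_zero, add_zero]
  · refine ⟨ρ + B * (t - s), fun y hy => hρ _ ?_⟩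
    have h2 := hdisp s hs' y
    rw [norm_sub_rev] at h2
    linarith [norm_sub_norm_le y (Φ s y)]
  · exact ⟨r₀, hr₀pos, fun y hy => hnear s hs' y hy⟩
  · intro l' k' hk' hkl' y hy
    obtain ⟨Y, hY0, hY, hYt⟩ := hΦ s hs' y
    have e := hYt s hs'
    rw [hY0] at e
    rw [e]
    refine barrier_lower hY hst hs hFA (by positivity) (lt_add_one _) hk' hkl' ?_
    rwa [hY0]
  · filter_upwards [htest.lipschitz.ae_differentiableAt (μ := volume),
      Measure.quasiMeasurePreserving_fst.ae h.ae_hasDerivAt_trajectory] with p hd hz' hp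
    refine (abs_advect_backTest_le htest.lipschitz hΦ hnear h.continuous hp hd
      (hz' (hs.trans_lt hp.1))).trans (mul_le_mul_of_nonneg_left ?_ (NNReal.coe_nonneg _))
    have e : velocity (ω p.1) p.2 - velocity (ω p.1) (z p.1) - c p.1 (p.2 - z p.1) =
        (velocity (ω p.1) p.2 - velocity (ω p.1) (z p.1) - relVel ε ω z p.1 (p.2 - z p.1)) +
          (relVel ε ω z p.1 (p.2 - z p.1) - c p.1 (p.2 - z p.1)) := by abel
    rw [e]
    exact (norm_add_le _ _).trans
      (add_le_add_left (norm_velocity_sub_relVel_le h.bddInt hε.le _ _) _)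

/-- Testing the vorticity at time `t` amounts, up to a small error, to testing it at a slightly
earlier time with the transported function. -/
theorem IsBoundedSolution.exists_transport (h : IsBoundedSolution M ω₀ z₀ ω z)
    (h' : IsContinuousRepresentative ω ω') (hs : 0 ≤ s) (hst : s ≤ t)
    (hτ : 6 * M * (t - s) ≤ 1) (κ : ℝ) {φ : Plane → ℝ} (hφ : IsAdmissible φ) {η : ℝ}
    (hη : 0 < η) :
    ∃ Y : Plane → Plane, IsAdmissible (φ ∘ Y) ∧ Expands (5 * M + 1) s t Y ∧
      |(∫ x, (ω' t x - κ) * φ (x - z t)) - ∫ x, (ω' s x - κ) * φ (Y (x - z s))| ≤ η := by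
  obtain ⟨⟨D, hD⟩, ⟨ρ, hρ⟩, a, ha0, ha⟩ := hφ
  have hM := (h.bddInt 0).nonneg
  have hts := sub_nonneg.2 hst
  set l := Real.log a with hl
  set k := max 1 (1 - l) with hk
  set r₀ := Real.exp (l + k * (1 - Real.exp (2 * (5 * M + 1) * (t - s)))) with hr₀
  have hr₀pos : 0 < r₀ := Real.exp_pos _
  obtain ⟨B, hB⟩ : ∃ B : ℝ≥0, 4 * M + (2 * Real.pi)⁻¹ * r₀⁻¹ ≤ B := ⟨_, Real.le_coe_toNNReal _⟩
  set G := Real.toNNReal (3 * (2 * Real.pi)⁻¹ * (r₀ ^ 2)⁻¹)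
  have hG : LipschitzWith G (regKernel r₀) := lipschitzWith_regKernel hr₀pos
  set ρ' := ρ + B * (t - s) + (‖z s‖ + 2 * M * (t - s))
  set K : Set (ℝ × Plane) := Icc s t ×ˢ Metric.closedBall 0 ρ' with hKdef
  have hK : IsCompact K := isCompact_Icc.prod (isCompact_closedBall _ _)
  set W := volume.real K
  set q : ℝ := (M + |κ|) * (D * (1 + Real.toNNReal (2 * M) + B))
  have hq : 0 ≤ q := by positivity
  -- the choice of the two regularisation parameters
  obtain ⟨m, hm⟩ : ∃ m : ℕ, q * Real.exp (1 / 2 + G * (t - s)) * (2 * M * W) *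
      Real.exp (-(m : ℝ)) ≤ η / 2 := by
    have h0 : Tendsto (fun m : ℕ => q * Real.exp (1 / 2 + G * (t - s)) * (2 * M * W) *
        Real.exp (-(m : ℝ))) atTop (𝓝 0) := by
      simpa using (Real.tendsto_exp_neg_atTop_nhds_zero.comp
        tendsto_natCast_atTop_atTop).const_mul
          (q * Real.exp (1 / 2 + G * (t - s)) * (2 * M * W))
    exact (h0.eventually_le_const (half_pos hη)).exists
  set ε := Real.exp (-(2 * m : ℝ)) with hε
  have hε0 : 0 < ε := Real.exp_pos _
  have hε1 : ε ≤ 1 := Real.exp_le_one_iff.2 (by simp)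
  have hlog : Real.log (1 / ε) = 2 * m := by
    rw [one_div, Real.log_inv, hε, Real.log_exp, neg_neg]
  set Λ := Real.exp ((3 * M * (1 + Real.log (1 / ε)) + G) * (t - s)) with hΛ
  have hΛε : Λ * ε ≤ Real.exp (1 / 2 + G * (t - s)) * Real.exp (-(m : ℝ)) := by
    rw [hΛ, hε, ← Real.exp_add, ← Real.exp_add, Real.exp_le_exp, hlog]
    nlinarith [m.cast_nonneg (α := ℝ)]
  obtain ⟨n, hn⟩ : ∃ n : ℕ, q * Λ * ∫ p in K, ‖relVel ε ω z p.1 (p.2 - z p.1) -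
      avgField (relVel ε ω z) (1 / (n + 1 : ℝ)) p.1 (p.2 - z p.1)‖ ≤ η / 2 := by
    have h0 := (tendsto_integral_relVel_sub_avgField h.measurable h.bddInt h.continuous hε0 hε1
      hK).const_mul (q * Λ)
    rw [mul_zero] at h0
    exact (h0.eventually_le_const (half_pos hη)).exists
  have hδ : (0 : ℝ) < 1 / (n + 1 : ℝ) := by positivity
  obtain ⟨ψ, Y, htest, hψt, hψs, hadm, hexp, hadv⟩ := h.exists_backTest hs hst hD hρ
    (le_max_left _ _) (le_max_right _ _) (by rwa [hl, Real.exp_log ha0]) hr₀ hB hG hε0 hε1 hδ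
  refine ⟨Y, hadm, hexp, ?_⟩
  have key := h.integral_sub_eq h' htest hs hst κ
  simp_rw [hψt, hψs] at key
  rw [key]
  set g : ℝ × Plane → ℝ := fun p => ‖relVel ε ω z p.1 (p.2 - z p.1) -
      avgField (relVel ε ω z) (1 / (n + 1 : ℝ)) p.1 (p.2 - z p.1)‖ with hg
  have hgi : IntegrableOn g K := by
    have hm := measurable_relVel (ε := ε) h.measurable h.continuous
    have hcB := norm_relVel_le (ε := ε) (z := z) h.bddInt
    have hcL := lipschitzWith_relVel (z := z) h.bddInt hε0 hε1
    refine Measure.integrableOn_of_bounded (M := 4 * M + 4 * M) hK.measure_lt_top.ne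
      (((hm.sub (continuous_avgField_uncurry hδ hm hcB hcL).measurable).norm.comp
        (measurePreserving_shear h.continuous).measurable)).aestronglyMeasurable
      (ae_of_all _ fun p => ?_)
    rw [hg, norm_norm]
    exact (norm_sub_le _ _).trans
      (add_le_add (hcB _ _) (norm_avgField_le hδ (fun σ => hcB σ _) _))
  have hbi : IntegrableOn (fun p => q * Λ * (2 * M * ε + g p)) K :=
    ((integrableOn_const hK.measure_lt_top.ne).add hgi).const_mul _
  have hmeas : MeasurableSet (Icc s t ×ˢ (univ : Set Plane)) :=
    measurableSet_Icc.prod MeasurableSet.univ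
  have hle : |∫ p in Icc s t ×ˢ univ, (ω p.1 p.2 - κ) * advect ω z ψ p| ≤
      ∫ p in Icc s t ×ˢ univ, K.indicator (fun p => q * Λ * (2 * M * ε + g p)) p := by
    rw [← Real.norm_eq_abs]
    refine norm_integral_le_of_norm_le
      ((integrable_indicator_iff hK.measurableSet).2 hbi).integrableOn ?_
    filter_upwards [ae_restrict_mem hmeas, ae_restrict_of_ae hadv,
      ae_restrict_of_ae (ae_fst_ne s), ae_restrict_of_ae (ae_fst_ne t)] with p hp hpa h1 h2
    have hpI : p.1 ∈ Ioo s t := ⟨lt_of_le_of_ne hp.1.1 (Ne.symm h1), lt_of_le_of_ne hp.1.2 h2⟩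
    by_cases hx : p.2 ∈ Metric.closedBall (0 : Plane) ρ'
    · have hm : p ∈ K := ⟨hp.1, hx⟩
      rw [indicator_of_mem hm, norm_mul]
      have h3 : ‖ω p.1 p.2 - κ‖ ≤ M + |κ| :=
        (norm_sub_le _ _).trans (add_le_add ((h.bddInt _).bound _) le_rfl)
      refine (mul_le_mul h3 (hpa hpI) (abs_nonneg _) (by positivity)).trans (le_of_eq ?_)
      push_cast
      rw [Real.coe_toNNReal Λ (Real.exp_pos _).le]
      ring
    · rw [indicator_of_notMem fun h' => hx h'.2,
        advect_eq_zero fun h' => hx (htest.tsupport_subset h').2, mul_zero, norm_zero]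
  refine hle.trans ?_
  have hinter : Icc s t ×ˢ (univ : Set Plane) ∩ K = K :=
    inter_eq_right.2 fun p hp => ⟨hp.1, mem_univ _⟩
  have hci : IntegrableOn (fun _ : ℝ × Plane => 2 * M * ε) K :=
    integrableOn_const hK.measure_lt_top.ne
  rw [setIntegral_indicator hK.measurableSet, hinter, integral_const_mul, integral_add hci hgi, setIntegral_const, smul_eq_mul,
    mul_add]
  have h1 : q * Λ * (W * (2 * M * ε)) ≤ η / 2 := by
    refine le_trans ?_ hm
    calc q * Λ * (W * (2 * M * ε)) = q * (2 * M * W) * (Λ * ε) := by ring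
      _ ≤ q * (2 * M * W) * (Real.exp (1 / 2 + G * (t - s)) * Real.exp (-(m : ℝ))) := by gcongr
      _ = _ := by ring
  linarith

end Duality

/-! ### Properties propagated from the initial time -/

lemma time_induction {M : ℝ} {P : ℝ → Prop} (h0 : P 0)
    (hstep : ∀ s t, 0 ≤ s → s ≤ t → M * (t - s) ≤ 1 → P s → P t) {t : ℝ} (ht : 0 ≤ t) : P t := by
  obtain ⟨n, hn⟩ := exists_nat_ge (M * t)
  have hn0 : (0 : ℝ) < n + 1 := by positivity
  have key : ∀ j : ℕ, P (j * (t / (n + 1))) := by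
    intro j
    induction j with
    | zero => simpa using h0
    | succ j ih =>
      have e : ((j + 1 : ℕ) : ℝ) * (t / (n + 1)) - j * (t / (n + 1)) = t / (n + 1) := by
        push_cast; ring
      have hp : 0 ≤ t / (n + 1 : ℝ) := by positivity
      refine hstep _ _ (by positivity) (by linarith) ?_ ih
      rw [e, ← mul_div_assoc, div_le_one hn0]
      linarith
  have := key (n + 1)
  push_cast at this
  rwa [mul_div_cancel₀ _ hn0.ne'] at this

section

variable {M : ℝ} {ω₀ : Plane → ℝ} {z₀ : Plane} {ω ω' : ℝ → Plane → ℝ} {z : ℝ → Plane} {t : ℝ}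

lemma IsAdmissible.hasCompactSupport {φ : Plane → ℝ} (hφ : IsAdmissible φ) (w : Plane) :
    HasCompactSupport fun x => φ (x - w) := by
  obtain ⟨ρ, hρ⟩ := hφ.far
  refine HasCompactSupport.intro (isCompact_closedBall w ρ) fun x hx => hρ _ ?_
  rw [Metric.mem_closedBall, not_le, dist_eq_norm] at hx
  exact hx.le

lemma IsAdmissible.lipschitz_sub {φ : Plane → ℝ} (hφ : IsAdmissible φ) (w : Plane) :
    ∃ D, LipschitzWith D fun x => φ (x - w) := by
  obtain ⟨D, hD⟩ := hφ.lipschitz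
  refine ⟨D, LipschitzWith.of_dist_le_mul fun x y => ?_⟩
  have := hD.dist_le_mul (x - w) (y - w)
  rwa [dist_sub_right] at this

lemma IsAdmissible.neg {φ : Plane → ℝ} (hφ : IsAdmissible φ) : IsAdmissible fun y => -φ y := by
  obtain ⟨⟨D, hD⟩, ⟨ρ, hρ⟩, a, ha, hφa⟩ := hφ
  exact ⟨⟨D, hD.neg⟩, ⟨ρ, fun y hy => by rw [hρ y hy, neg_zero]⟩, a, ha,
    fun y hy => by rw [hφa y hy, neg_zero]⟩

lemma IsBoundedSolution.trajectory_zero (h : IsBoundedSolution M ω₀ z₀ ω z) : z 0 = z₀ := by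
  simpa using h.trajectory 0 le_rfl

lemma IsBoundedSolution.integral_representative_zero (h : IsBoundedSolution M ω₀ z₀ ω z)
    (h' : IsContinuousRepresentative ω ω') (κ : ℝ) {φ : Plane → ℝ} (hφ : IsAdmissible φ) :
    ∫ x, (ω' 0 x - κ) * φ (x - z 0) = ∫ x, (ω₀ x - κ) * φ (x - z₀) := by
  obtain ⟨D, hD⟩ := hφ.lipschitz_sub z₀
  have hc := hφ.hasCompactSupport z₀
  obtain ⟨ρ, hρ⟩ := hc.isBounded.subset_ball 0
  obtain ⟨B, hB⟩ := hc.exists_bound_of_continuous hD.continuous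
  have hT : IsTest D ρ fun p : ℝ × Plane => φ (p.2 - z₀) := by
    refine ⟨?_, fun σ x hx => ?_, B, fun p => hB p.2⟩
    · have := hD.comp (LipschitzWith.prod_snd (α := ℝ) (β := Plane))
      rwa [mul_one] at this
    · by_contra hne
      have := hρ (subset_tsupport _ hne)
      rw [mem_ball_zero_iff] at this
      exact this.not_ge hx
  have h1 := h.integral_representative h' hT le_rfl
  have hnull : (volume : Measure (ℝ × Plane)) (Icc (0 : ℝ) 0 ×ˢ univ) = 0 := by
    rw [Measure.volume_eq_prod, Measure.prod_prod]
    simp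
  rw [weakValue, setIntegral_measure_zero _ hnull, add_zero] at h1
  have hi := hD.continuous.integrable_of_hasCompactSupport (μ := volume) hc
  rw [h.trajectory_zero]
  simp_rw [sub_mul]
  rw [integral_sub (h'.2.integrable_mul le_rfl hD.continuous hc) (hi.const_mul κ), h1,
    integral_sub (h.initial_integrable.mul_bdd (c := B) hD.continuous.aestronglyMeasurable
      (ae_of_all _ hB)) (hi.const_mul κ)]

/-- An upper bound on the integrals of the vorticity against a class of functions that is stable
under transport persists for all times. -/
theorem IsBoundedSolution.integral_le_of_initial (h : IsBoundedSolution M ω₀ z₀ ω z)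
    (h' : IsContinuousRepresentative ω ω') {κ b : ℝ} {𝒟 : ℝ → (Plane → ℝ) → Prop}
    (hD : ∀ s t φ Y, Expands (5 * M + 1) s t Y → 𝒟 t φ → 𝒟 s (φ ∘ Y))
    (h0 : ∀ φ, IsAdmissible φ → 𝒟 0 φ → ∫ x, (ω₀ x - κ) * φ (x - z₀) ≤ b)
    (ht : 0 ≤ t) {φ : Plane → ℝ} (hφ : IsAdmissible φ) (hφD : 𝒟 t φ) :
    ∫ x, (ω' t x - κ) * φ (x - z t) ≤ b := by
  refine time_induction (M := 6 * M) (P := fun t => ∀ φ, IsAdmissible φ → 𝒟 t φ →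
    ∫ x, (ω' t x - κ) * φ (x - z t) ≤ b) (fun φ hφ hd => ?_) ?_ ht φ hφ hφD
  · rw [h.integral_representative_zero h' κ hφ]
    exact h0 φ hφ hd
  · intro s t hs hst hτ ih φ hφ hd
    refine le_of_forall_pos_le_add fun η hη => ?_
    obtain ⟨Y, hadm, hexp, hle⟩ := h.exists_transport h' hs hst hτ κ hφ hη
    have h1 := ih _ hadm (hD s t φ Y hexp hd)
    have h2 := (abs_le.1 hle).2
    simp only [Function.comp] at h1
    linarith

end

/-! ### Recovering pointwise information from admissible functions -/

section Recover

variable {f : Plane → ℝ} {w : Plane}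

lemma ae_nonpos_of_integral_admissible (hf : LocallyIntegrable f) {U : Set Plane}
    (hU : IsOpen U) (h : ∀ φ, IsAdmissible φ → (∀ y, 0 ≤ φ y) → (∀ y, y ∉ U → φ y = 0) →
      ∫ x, f x * φ (x - w) ≤ 0) : ∀ᵐ x, x - w ∈ U → f x ≤ 0 := by
  have hne : ∀ᵐ x : Plane, x ≠ w := by simp [ae_iff]
  filter_upwards [ae_tendsto_mollify volume hf, hne] with x hx hxw hxU
  obtain ⟨e, he, hball⟩ := Metric.isOpen_iff.1 hU _ hxU
  have hpos : 0 < ‖x - w‖ := norm_pos_iff.2 (sub_ne_zero.2 hxw)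
  have hev : ∀ᶠ n : ℕ in atTop, 1 / ((n : ℝ) + 1) < min e (‖x - w‖ / 2) :=
    tendsto_one_div_add_atTop_nhds_zero_nat.eventually_lt_const (lt_min he (half_pos hpos))
  refine le_of_tendsto hx ?_
  filter_upwards [hev] with n hn
  set b := (stdBump Plane n).normed volume with hb
  have hb0 : ∀ y, 1 / (n + 1 : ℝ) ≤ ‖y‖ → b y = 0 := by
    intro y hy
    rw [← Function.notMem_support, hb, (stdBump Plane n).support_normed_eq]
    simpa [stdBump] using hy
  have e1 : mollify volume f n x = ∫ y, f y * b (x - w - (y - w)) := by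
    rw [mollify_apply, ← integral_sub_left_eq_self _ volume x]
    refine integral_congr_ae (ae_of_all _ fun y => ?_)
    simp only [sub_sub_self, sub_sub_sub_cancel_right]
    rw [mul_comm]
  rw [e1]
  obtain ⟨D, hD⟩ := ((stdBump Plane n).contDiff_normed (μ := volume)
    (n := (⊤ : ℕ∞))).lipschitzWith_of_hasCompactSupport
      (stdBump Plane n).hasCompactSupport_normed (by simp)
  refine h (fun y => b (x - w - y)) ⟨⟨D, ?_⟩, ⟨‖x - w‖ + 1 / (n + 1 : ℝ), fun y hy => ?_⟩,
    ‖x - w‖ / 2, half_pos hpos, fun y hy => ?_⟩ (fun y => (stdBump Plane n).nonneg_normed _)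
    fun y hy => ?_
  · refine LipschitzWith.of_dist_le_mul fun y y' => ?_
    have := hD.dist_le_mul (x - w - y) (x - w - y')
    rwa [dist_sub_left] at this
  · refine hb0 _ ?_
    have := norm_sub_norm_le y (x - w)
    rw [norm_sub_rev y] at this
    linarith
  · refine hb0 _ ?_
    have := norm_sub_norm_le (x - w) y
    linarith [hn.trans_le (min_le_right _ _)]
  · refine hb0 _ ?_
    by_contra hlt
    refine hy (hball ?_)
    rw [Metric.mem_ball, dist_eq_norm, norm_sub_rev]
    linarith [hn.trans_le (min_le_left _ _)]

lemma abs_div_abs_le_one (a : ℝ) : |(a / |a|)| ≤ 1 := by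
  rw [abs_div, abs_abs]
  exact div_self_le_one _

lemma setIntegral_abs_le_of_integral_admissible (hf : LocallyIntegrable f) {b : ℝ}
    (h : ∀ φ, IsAdmissible φ → (∀ y, |φ y| ≤ 1) → ∫ x, f x * φ (x - w) ≤ b) {a r : ℝ}
    (ha : 0 < a) : ∫ x in Metric.closedBall w r \ Metric.ball w a, |f x| ≤ b := by
  set S := Metric.closedBall w r \ Metric.ball w a with hS
  have hSm : MeasurableSet S := Metric.isClosed_closedBall.measurableSet.diff measurableSet_ball
  set g : Plane → ℝ := S.indicator fun x => f x / |f x| with hg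
  have hg1 : ∀ x, |g x| ≤ 1 := fun x => by
    by_cases hx : x ∈ S
    · rw [hg, indicator_of_mem hx]; exact abs_div_abs_le_one _
    · rw [hg, indicator_of_notMem hx]; simp
  have hgm : AEStronglyMeasurable g volume :=
    ((hf.aestronglyMeasurable.aemeasurable.div
      hf.aestronglyMeasurable.aemeasurable.abs).indicator hSm).aestronglyMeasurable
  have hgl : LocallyIntegrable g := (locallyIntegrable_const (1 : ℝ)).mono hgm
    (ae_of_all _ fun x => by simpa using hg1 x)
  set K := Metric.closedBall w (r + 1) with hK
  have hKc : IsCompact K := isCompact_closedBall _ _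
  have hle1 : ∀ n : ℕ, (1 : ℝ) / (n + 1) ≤ 1 := fun n => by
    rw [div_le_one (by positivity)]; linarith [n.cast_nonneg (α := ℝ)]
  have hout : ∀ (n : ℕ) x, x ∉ K → mollify volume g n x = 0 := by
    intro n x hx
    refine mollify_eq_zero volume fun y hy => ?_
    rw [hg, indicator_of_notMem]
    intro hyS
    refine hx ?_
    have h1 := Metric.mem_closedBall.1 hyS.1
    rw [hK, Metric.mem_closedBall]
    rw [← dist_eq_norm] at hy
    linarith [dist_triangle_left x w y, hle1 n]
  have hlim : Tendsto (fun n => ∫ x, f x * mollify volume g n x) atTop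
      (𝓝 (∫ x, f x * g x)) := by
    refine tendsto_integral_of_dominated_convergence (K.indicator fun x => |f x|) (fun n => ?_)
      ?_ (fun n => ae_of_all _ fun x => ?_) ?_
    · exact hf.aestronglyMeasurable.mul
        (contDiff_mollify volume hgl n).continuous.aestronglyMeasurable
    · rw [integrable_indicator_iff hKc.measurableSet]
      exact (hf.integrableOn_isCompact hKc).abs
    · by_cases hx : x ∈ K
      · rw [indicator_of_mem hx, norm_mul]
        exact mul_le_of_le_one_right (abs_nonneg _) (abs_mollify_le volume hgl n x 1 hg1)
      · rw [hout n x hx, indicator_of_notMem hx, mul_zero, norm_zero]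
    · filter_upwards [ae_tendsto_mollify volume hgl] with x hx
      exact hx.const_mul _
  have hval : ∫ x, f x * g x = ∫ x in S, |f x| := by
    rw [← integral_indicator hSm]
    refine integral_congr_ae (ae_of_all _ fun x => ?_)
    by_cases hx : x ∈ S
    · simp only [hg, indicator_of_mem hx]
      rcases eq_or_ne (f x) 0 with h0 | h0
      · simp [h0]
      · rw [← mul_div_assoc, div_eq_iff (abs_ne_zero.2 h0), abs_mul_abs_self]
    · simp only [hg, indicator_of_notMem hx, mul_zero]
  rw [← hval]
  refine le_of_tendsto hlim ?_
  have hev : ∀ᶠ n : ℕ in atTop, 1 / ((n : ℝ) + 1) < a / 2 :=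
    tendsto_one_div_add_atTop_nhds_zero_nat.eventually_lt_const (half_pos ha)
  filter_upwards [hev] with n hn
  have hc : HasCompactSupport (mollify volume g n) := HasCompactSupport.intro hKc (hout n)
  obtain ⟨D, hD⟩ := (contDiff_mollify volume hgl n).lipschitzWith_of_hasCompactSupport hc (by simp)
  have e : ∀ x, mollify volume g n x = mollify volume g n (x - w + w) := fun x => by
    rw [sub_add_cancel]
  rw [integral_congr_ae (ae_of_all _ fun x => congrArg (f x * ·) (e x))]
  refine h (fun y => mollify volume g n (y + w)) ⟨⟨D, ?_⟩, ⟨r + 2, fun y hy => ?_⟩, a / 2,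
    half_pos ha, fun y hy => ?_⟩ fun y => abs_mollify_le volume hgl n _ 1 hg1
  · refine LipschitzWith.of_dist_le_mul fun x y => ?_
    have := hD.dist_le_mul (x + w) (y + w)
    rwa [dist_add_right] at this
  · refine hout n _ ?_
    rw [hK, Metric.mem_closedBall, dist_eq_norm, add_sub_cancel_right]
    linarith
  · refine mollify_eq_zero volume fun x hx => ?_
    rw [hg, indicator_of_notMem]
    intro hxS
    refine hxS.2 ?_
    rw [Metric.mem_ball, dist_eq_norm]
    have : x - w = (x - (y + w)) + y := by abel
    rw [this]
    exact (norm_add_le _ _).trans_lt (by linarith)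

lemma lintegral_le_of_integral_admissible (hf : LocallyIntegrable f) {b : ℝ}
    (h : ∀ φ, IsAdmissible φ → (∀ y, |φ y| ≤ 1) → ∫ x, f x * φ (x - w) ≤ b) :
    ∫⁻ x, ‖f x‖ₑ ≤ ENNReal.ofReal b := by
  set S : ℕ → Set Plane := fun m => Metric.closedBall w (m + 1) \ Metric.ball w (1 / (m + 1 : ℝ))
    with hS
  have hmono : Monotone S := by
    intro m n hmn
    have : (m : ℝ) ≤ n := by exact_mod_cast hmn
    exact sdiff_subset_sdiff (Metric.closedBall_subset_closedBall (by linarith))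
      (Metric.ball_subset_ball (by gcongr))
  have hU : ⋃ m, S m = {w}ᶜ := by
    ext x
    simp only [hS, mem_iUnion, Set.mem_sdiff, Metric.mem_closedBall, Metric.mem_ball, not_lt,
      mem_compl_iff, mem_singleton_iff]
    constructor
    · rintro ⟨m, -, hm⟩ rfl
      rw [dist_self] at hm
      exact hm.not_gt (by positivity)
    · intro hx
      obtain ⟨m, hm⟩ := exists_nat_one_div_lt (dist_pos.2 hx)
      obtain ⟨n, hn⟩ := exists_nat_ge (dist x w)
      refine ⟨max m n, ?_, ?_⟩
      · push_cast
        linarith [le_max_right (m : ℝ) n]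
      · refine le_trans ?_ hm.le
        push_cast
        gcongr
        exact le_max_left _ _
  have hfull : ∫⁻ x, ‖f x‖ₑ = ∫⁻ x in ⋃ m, S m, ‖f x‖ₑ := by
    rw [hU, setLIntegral_compl (measurableSet_singleton w) (by simp)]
    simp
  rw [hfull, setLIntegral_iUnion_of_directed _ hmono.directed_le]
  refine iSup_le fun m => ?_
  have hi : IntegrableOn f (S m) :=
    (hf.integrableOn_isCompact (isCompact_closedBall w (m + 1))).mono_set sdiff_subset
  have h1 := setIntegral_abs_le_of_integral_admissible hf h (a := 1 / (m + 1 : ℝ)) (r := m + 1)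
    (by positivity)
  rw [← ofReal_integral_norm_eq_lintegral_enorm hi]
  exact ENNReal.ofReal_le_ofReal h1

end Recover

lemma WeaklyContinuousL2loc.locallyIntegrable {f : ℝ → Plane → ℝ} (h : WeaklyContinuousL2loc f)
    {t : ℝ} (ht : 0 ≤ t) : LocallyIntegrable (f t) := by
  rw [locallyIntegrable_iff]
  intro k hk
  have : IsFiniteMeasure (volume.restrict k) := ⟨by simpa using hk.measure_lt_top⟩
  exact (h.1 t ht k hk).integrable one_le_two

/-! ### Conservation of the norms and propagation of the constant region -/

section

variable {M : ℝ} {ω₀ : Plane → ℝ} {z₀ : Plane} {ω ω' : ℝ → Plane → ℝ} {z : ℝ → Plane} {t : ℝ}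

lemma IsBoundedSolution.ae_abs_representative_le (h : IsBoundedSolution M ω₀ z₀ ω z)
    (h' : IsContinuousRepresentative ω ω') {A : ℝ} (hA : ∀ᵐ x, |ω₀ x| ≤ A) (ht : 0 ≤ t) :
    ∀ᵐ x, |ω' t x| ≤ A := by
  have hf := h'.2.locallyIntegrable ht
  have h1 : ∀ᵐ x, x - z t ∈ univ → ω' t x - A ≤ 0 := by
    refine ae_nonpos_of_integral_admissible (hf.sub (locallyIntegrable_const A)) isOpen_univ
      fun φ hφ hpos _ => h.integral_le_of_initial h' (𝒟 := fun _ φ => ∀ y, 0 ≤ φ y)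
        (fun s t φ Y _ hd y => hd (Y y)) (fun φ _ hd => ?_) ht hφ hpos
    refine integral_nonpos_of_ae ?_
    filter_upwards [hA] with x hx
    exact mul_nonpos_of_nonpos_of_nonneg (by linarith [(abs_le.1 hx).2]) (hd _)
  have h2 : ∀ᵐ x, x - z t ∈ univ → -(ω' t x - -A) ≤ 0 := by
    refine ae_nonpos_of_integral_admissible (hf.sub (locallyIntegrable_const (-A))).neg
      isOpen_univ fun φ hφ hpos _ => ?_
    have := h.integral_le_of_initial h' (κ := -A) (b := 0) (𝒟 := fun _ φ => ∀ y, φ y ≤ 0)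
        (fun s t φ Y _ hd y => hd (Y y)) (fun φ _ hd => ?_) ht hφ.neg
        (fun y => neg_nonpos.2 (hpos y))
    · refine le_trans (le_of_eq (integral_congr_ae (ae_of_all _ fun x => ?_))) this
      simp only [Pi.neg_apply, Pi.sub_apply]
      ring
    refine integral_nonpos_of_ae ?_
    filter_upwards [hA] with x hx
    exact mul_nonpos_of_nonneg_of_nonpos (by linarith [(abs_le.1 hx).1]) (hd _)
  filter_upwards [h1, h2] with x hx1 hx2
  have := hx1 (mem_univ _)
  have := hx2 (mem_univ _)
  exact abs_le.2 ⟨by linarith, by linarith⟩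

lemma IsBoundedSolution.lintegral_representative_le (h : IsBoundedSolution M ω₀ z₀ ω z)
    (h' : IsContinuousRepresentative ω ω') (ht : 0 ≤ t) :
    ∫⁻ x, ‖ω' t x‖ₑ ≤ ENNReal.ofReal (∫ x, |ω₀ x|) := by
  refine lintegral_le_of_integral_admissible (w := z t) (h'.2.locallyIntegrable ht)
    fun φ hφ hb => ?_
  have := h.integral_le_of_initial h' (κ := 0) (b := ∫ x, |ω₀ x|)
    (𝒟 := fun _ φ => ∀ y, |φ y| ≤ 1) (fun s t φ Y _ hd y => hd (Y y)) (fun φ hφ hd => ?_) ht hφ hb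
  · simpa using this
  obtain ⟨D, hD⟩ := hφ.lipschitz_sub z₀
  simp_rw [sub_zero]
  refine integral_mono (h.initial_integrable.mul_bdd (c := 1) hD.continuous.aestronglyMeasurable
    (ae_of_all _ fun x => hd _)) h.initial_integrable.abs fun x => (le_abs_self _).trans ?_
  rw [abs_mul]
  exact mul_le_of_le_one_right (abs_nonneg _) (hd _)

/-- The radius of the disc on which the vorticity stays constant. -/
def barrierRadius (M R₀ t : ℝ) : ℝ :=
  Real.exp (Real.log R₀ + max 1 (1 - Real.log R₀) * (1 - Real.exp (2 * (5 * M + 1) * t)))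

lemma barrierRadius_zero {R₀ : ℝ} (M : ℝ) (hR : 0 < R₀) : barrierRadius M R₀ 0 = R₀ := by
  simp [barrierRadius, Real.exp_log hR]

lemma IsBoundedSolution.ae_representative_le (h : IsBoundedSolution M ω₀ z₀ ω z)
    (h' : IsContinuousRepresentative ω ω') {α R₀ : ℝ} (hR : 0 < R₀)
    (hα : ∀ᵐ x, x ∈ Metric.ball z₀ R₀ → ω₀ x = α) (ht : 0 ≤ t) {φ : Plane → ℝ}
    (hφ : IsAdmissible φ) (h0 : ∀ y, barrierRadius M R₀ t ≤ ‖y‖ → φ y = 0) :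
    ∫ x, (ω' t x - α) * φ (x - z t) ≤ 0 := by
  refine h.integral_le_of_initial h'
    (𝒟 := fun t φ => ∀ y, barrierRadius M R₀ t ≤ ‖y‖ → φ y = 0)
    (fun s t φ Y hY hd y hy => hd _ (hY _ _ (le_max_left _ _) (le_max_right _ _) y hy))
    (fun φ _ hd => ?_) ht hφ h0
  refine (integral_eq_zero_of_ae ?_).le
  filter_upwards [hα] with x hx
  by_cases hxb : x ∈ Metric.ball z₀ R₀
  · simp [hx hxb]
  · rw [Metric.mem_ball, not_lt, dist_eq_norm] at hxb
    rw [hd _ (by rwa [barrierRadius_zero M hR]), mul_zero]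
    rfl

theorem IsBoundedSolution.ae_representative_eq (h : IsBoundedSolution M ω₀ z₀ ω z)
    (h' : IsContinuousRepresentative ω ω') {α R₀ : ℝ} (hR : 0 < R₀)
    (hα : ∀ᵐ x, x ∈ Metric.ball z₀ R₀ → ω₀ x = α) (ht : 0 ≤ t) :
    ∀ᵐ x, x ∈ Metric.ball (z t) (barrierRadius M R₀ t) → ω' t x = α := by
  have hf := (h'.2.locallyIntegrable ht).sub (locallyIntegrable_const α)
  have hout : ∀ {φ : Plane → ℝ},
      (∀ y, y ∉ Metric.ball (0 : Plane) (barrierRadius M R₀ t) → φ y = 0) →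
      ∀ y, barrierRadius M R₀ t ≤ ‖y‖ → φ y = 0 := fun h0 y hy =>
    h0 y (by simpa using hy)
  have h1 := ae_nonpos_of_integral_admissible (w := z t) hf Metric.isOpen_ball
    fun φ hφ _ h0 => h.ae_representative_le h' hR hα ht hφ (hout h0)
  have h2 := ae_nonpos_of_integral_admissible (w := z t) hf.neg Metric.isOpen_ball
    (U := Metric.ball 0 (barrierRadius M R₀ t)) fun φ hφ _ h0 => by
      have := h.ae_representative_le h' hR hα ht hφ.neg fun y hy => by rw [hout h0 y hy, neg_zero]
      refine le_trans (le_of_eq (integral_congr_ae (ae_of_all _ fun x => ?_))) this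
      simp only [Pi.neg_apply, Pi.sub_apply]
      ring
  filter_upwards [h1, h2] with x hx1 hx2 hx
  have hm : x - z t ∈ Metric.ball (0 : Plane) (barrierRadius M R₀ t) := by
    rwa [mem_ball_zero_iff, ← dist_eq_norm]
  have e1 := hx1 hm
  have e2 := hx2 hm
  simp only [Pi.neg_apply, Pi.sub_apply] at e1 e2
  linarith

lemma IsContinuousRepresentative.congr {ω'' : ℝ → Plane → ℝ}
    (h : IsContinuousRepresentative ω ω')
    (he : ∀ᵐ t ∂(volume.restrict (Ici (0 : ℝ))), ω'' t =ᵐ[volume] ω t) :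
    IsContinuousRepresentative ω'' ω' := by
  refine ⟨?_, h.2⟩
  filter_upwards [h.1, he] with t h1 h2
  exact h1.trans h2.symm

lemma vorticityNorm_nonneg (f : Plane → ℝ) : 0 ≤ vorticityNorm f :=
  add_nonneg ENNReal.toReal_nonneg ENNReal.toReal_nonneg

lemma IsEulerianSolution.exists_representative (h : IsEulerianSolution ω₀ z₀ ω z) :
    ∃ ω', IsContinuousRepresentative ω ω' := by
  obtain ⟨M, hM⟩ := h.vorticity_mem.2
  obtain ⟨ω₁, z₁, hs, he, -⟩ := h.exists_isBoundedSolution (M := M) M.2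
    (by simpa using hM)
  obtain ⟨ω', h'⟩ := hs.exists_representative
  exact ⟨ω', h'.congr (he.mono fun t ht => ht.symm)⟩

/-- The bounds on the vorticity are those of the initial vorticity. -/
lemma IsEulerianSolution.ae_eLpNorm_le (h : IsEulerianSolution ω₀ z₀ ω z) :
    ∀ᵐ t ∂(volume.restrict (Ici (0 : ℝ))),
      eLpNorm (ω t) 1 volume ≤ ENNReal.ofReal (vorticityNorm ω₀) ∧
        eLpNorm (ω t) ∞ volume ≤ ENNReal.ofReal (vorticityNorm ω₀) := by
  obtain ⟨M, hM⟩ := h.vorticity_mem.2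
  obtain ⟨ω₁, z₁, hs, he, -⟩ := h.exists_isBoundedSolution (M := M) M.2
    (by simpa using hM)
  obtain ⟨ω', h'⟩ := hs.exists_representative
  have hω' := h'.congr (he.mono fun t ht => ht.symm)
  have hA : ∀ᵐ x, |ω₀ x| ≤ (eLpNorm ω₀ ∞ volume).toReal := by
    have hfin := h.initial_memLinfty.2.ne
    rw [eLpNorm_exponent_top] at hfin ⊢
    filter_upwards [enorm_ae_le_eLpNormEssSup ω₀ volume] with x hx
    have := ENNReal.toReal_mono hfin hx
    simpa using this
  have hI : ∫ x, |ω₀ x| = (eLpNorm ω₀ 1 volume).toReal := by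
    rw [eLpNorm_one_eq_lintegral_enorm]
    exact integral_norm_eq_lintegral_enorm h.initial_memL1.1
  filter_upwards [hω'.1, ae_restrict_mem measurableSet_Ici] with t htω ht
  rw [← eLpNorm_congr_ae htω, ← eLpNorm_congr_ae htω]
  constructor
  · rw [eLpNorm_one_eq_lintegral_enorm]
    refine (hs.lintegral_representative_le h' ht).trans (ENNReal.ofReal_le_ofReal ?_)
    rw [hI]
    exact le_add_of_nonneg_right ENNReal.toReal_nonneg
  · rw [eLpNorm_exponent_top]
    refine (eLpNormEssSup_le_of_ae_bound (hs.ae_abs_representative_le h' hA ht)).trans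
      (ENNReal.ofReal_le_ofReal ?_)
    exact le_add_of_nonneg_left ENNReal.toReal_nonneg

end

end VortexWave
end

theorem mainTheorem6 :
    ∃ (C : ℝ → ℝ) (R : ℝ → ℝ → ℝ → ℝ),
      (∀ M : ℝ, 0 ≤ M → 0 < C M) ∧
      (∀ M R₀ : ℝ, 0 ≤ M → 0 < R₀ →
        ContinuousOn (R M R₀) (Set.Ici 0) ∧
        (∀ t : ℝ, 0 ≤ t → 0 < R M R₀ t) ∧
        R M R₀ 0 = R₀ ∧
        (R₀ ≤ 1 → ∀ t : ℝ, 0 ≤ t →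
          R M R₀ t = Real.exp (1 - (1 - Real.log R₀) * Real.exp (2 * C M * t)))) ∧
      ∀ (ω₀ : VortexWave.Plane → ℝ) (z₀ : VortexWave.Plane)
        (ω : ℝ → VortexWave.Plane → ℝ) (z : ℝ → VortexWave.Plane),
        VortexWave.IsEulerianSolution ω₀ z₀ ω z →
        ∀ α R₀ : ℝ, 0 < R₀ →
          (∀ᵐ x, x ∈ Metric.ball z₀ R₀ → ω₀ x = α) →
          (∃ ω' : ℝ → VortexWave.Plane → ℝ, VortexWave.IsContinuousRepresentative ω ω') ∧
          ∀ ω' : ℝ → VortexWave.Plane → ℝ, VortexWave.IsContinuousRepresentative ω ω' →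
            ∀ t : ℝ, 0 ≤ t →
              ∀ᵐ x, x ∈ Metric.ball (z t) (R (VortexWave.vorticityNorm ω₀) R₀ t) →
                ω' t x = α := by
  refine ⟨fun M => 5 * M + 1, VortexWave.barrierRadius, fun M hM => by positivity,
    fun M R₀ hM hR => ⟨?_, fun t _ => Real.exp_pos _, VortexWave.barrierRadius_zero M hR,
      fun hR1 t _ => ?_⟩, fun ω₀ z₀ ω z h α R₀ hR hα => ⟨h.exists_representative,
        fun ω' h' t ht => ?_⟩⟩
  · unfold VortexWave.barrierRadius
    fun_prop
  · have : Real.log R₀ ≤ 0 := Real.log_nonpos hR.le hR1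
    rw [VortexWave.barrierRadius, max_eq_right (by linarith)]
    congr 1
    ring
  · obtain ⟨ω₁, z₁, hs, he, hz⟩ := h.exists_isBoundedSolution
      (VortexWave.vorticityNorm_nonneg ω₀) h.ae_eLpNorm_le
    have := hs.ae_representative_eq (h'.congr he) hR hα ht
    rwa [hz t ht] at this
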